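/- Let $G$ be a second-countable locally compact group, $A$ a separable and $B$ a $\sigma$-unital $C^*$-algebra, and let $\alpha: G\curvearrowright A$ and $\beta: G\curvearrowright B$ be point-norm continuous actions; $\beta_g$ also denotes the canonical extension to the multiplier algebra $\mathcal M(B)$. Assume that $\beta$ is strongly stable, i.e. $(B,\beta)$ is conjugate to $(B\otimes\mathcal K,\beta\otimes\mathrm{id}_{\mathcal K})$, where $\mathcal K$ denotes the compact operators on $\ell^2(\mathbb N)$. A cocycle representation $(\phi,u):(A,\alpha)\to(\mathcal M(B),\beta)$ consists of a $*$-homomorphism $\phi:A\to\mathcal M(B)$ and a strictly continuous map $u:G\to\mathcal U(\mathcal M(B))$ with $u_{gh}=u_g\beta_g(u_h)$ and $u_g\beta_g(\phi(a))u_g^*=\phi(\alpha_g(a))$ for all $g,h\in G$, $a\in A$. The set of all cocycle representations carries the topology $\tau(\alpha,\beta)$ of point-strict convergence in $\phi$ and strict convergence, uniformly over compact subsets of $G$, in $u$. Given isometries $t_1,t_2\in\mathcal M(B)^\beta$ with $t_1t_1^*+t_2t_2^*=1$, the Cuntz sum is $(\phi,u)\oplus(\psi,v)=(t_1\phi t_1^*+t_2\psi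 t_2^*,\ t_1ut_1^*+t_2vt_2^*)$; given isometries $t_n\in\mathcal M(B)^\beta$ $(n\in\mathbb N)$ with $\sum_n t_nt_n^*=1$ strictly, $\bigoplus_n(\phi^{(n)},u^{(n)})$ is given by the pointwise strict sums $\sum_n t_n\phi^{(n)}(a)t_n^*$ and $\sum_n t_nu^{(n)}_gt_n^*$. (Up to conjugation by unitaries in $\mathcal M(B)^\beta$ these do not depend on the choice of the isometries.) Write $(\phi,u)\asymp(\psi,v)$ if there is a norm-continuous path $w:[1,\infty)\to\mathcal U(\mathcal M(B))$ such that, for all $a\in A$ and every compact $K\subseteq G$, one has $\lim_{t\to\infty}\|\psi(a)-w_t\phi(a)w_t^*\|=0$ and $\lim_{t\to\infty}\sup_{g\in K}\|v_g-w_tu_g\beta_g(w_t)^*\|=0$, and such that $\psi(a)-w_t\phi(a)w_t^*\in B$ and $v_g-w_tu_g\beta_g(w_t)^*\in B$ for all $a\in A$, $g\in G$, $t\ge 1$. Let $\mathfrak C$ be a non-empty set of cocycle representations $(A,\alpha)\to(\mathcal M(B),\beta)$ that is $\sigma$-additive, i.e. closed under unitary equivalence with respect to unitaries in $\mathcal M(B)^\beta$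 and under countable Cuntz sums $\bigoplus_{n\in\mathbb N}(\phi^{(n)},u^{(n)})$ of sequences in $\mathfrak C$. If $\mathfrak C$ is separable with respect to $\tau(\alpha,\beta)$, then $\mathfrak C$ contains an absorbing element, i.e. there is $(\theta,x)\in\mathfrak C$ with $(\theta,x)\oplus(\phi,u)\asymp(\theta,x)$ for all $(\phi,u)\in\mathfrak C$. In particular, if $B$ is separable, then every non-empty $\sigma$-additive set of cocycle representations has an absorbing element. -/

import Mathlib

open Filter Topology
open scoped MultiplierAlgebra

noncomputable section

/-! ### Extending automorphisms to the multiplier algebra, and actions -/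

section Multiplier

variable {B : Type*} [NonUnitalCStarAlgebra B]

/-- A `*`-automorphism of a C⋆-algebra as a (bounded) linear map. -/
def autCLM (κ : B ≃⋆ₐ[ℂ] B) : B →L[ℂ] B where
  toFun := κ
  map_add' := map_add κ
  map_smul' := map_smul κ
  cont := (StarAlgEquiv.isometry κ).continuous

/-- The canonical extension of a `*`-automorphism `κ` of `B` to the multiplier algebra:
`κ(x) b = κ (x κ⁻¹(b))` and `b κ(x) = κ (κ⁻¹(b) x)`. -/
def multiplierFun (κ : B ≃⋆ₐ[ℂ] B) (x : 𝓜(ℂ, B)) : 𝓜(ℂ, B) where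
  fst := (autCLM κ).comp (x.fst.comp (autCLM κ.symm))
  snd := (autCLM κ).comp (x.snd.comp (autCLM κ.symm))
  central := fun a b => by
    have h := congrArg κ (x.central (κ.symm a) (κ.symm b))
    simpa [autCLM] using h

theorem multiplierFun_fst (κ : B ≃⋆ₐ[ℂ] B) (x : 𝓜(ℂ, B)) (b : B) :
    (multiplierFun κ x).fst b = κ (x.fst (κ.symm b)) := rfl

theorem multiplierFun_snd (κ : B ≃⋆ₐ[ℂ] B) (x : 𝓜(ℂ, B)) (b : B) :
    (multiplierFun κ x).snd b = κ (x.snd (κ.symm b)) := rfl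

theorem multiplier_ext {x y : 𝓜(ℂ, B)} (h₁ : ∀ b, x.fst b = y.fst b)
    (h₂ : ∀ b, x.snd b = y.snd b) : x = y :=
  DoubleCentralizer.ext ℂ B _ _
    (Prod.ext (ContinuousLinearMap.ext h₁) (ContinuousLinearMap.ext h₂))

/-- The canonical extension of a `*`-automorphism of `B` to a `*`-automorphism of `𝓜(ℂ, B)`. -/
def multiplierAut (κ : B ≃⋆ₐ[ℂ] B) : 𝓜(ℂ, B) ≃⋆ₐ[ℂ] 𝓜(ℂ, B) where
  toFun := multiplierFun κ
  invFun := multiplierFun κ.symm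
  left_inv x := by
    apply multiplier_ext <;> intro b <;> simp [multiplierFun_fst, multiplierFun_snd]
  right_inv x := by
    apply multiplier_ext <;> intro b <;> simp [multiplierFun_fst, multiplierFun_snd]
  map_mul' x y := by
    apply multiplier_ext <;> intro b <;> simp [multiplierFun_fst, multiplierFun_snd]
  map_add' x y := by
    apply multiplier_ext <;> intro b <;> simp [multiplierFun_fst, multiplierFun_snd]
  map_star' x := by
    apply multiplier_ext <;> intro b <;>
      simp [multiplierFun_fst, multiplierFun_snd, map_star]
  map_smul' c x := by
    apply multiplier_ext <;> intro b <;> simp [multiplierFun_fst, multiplierFun_snd]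

/-- The multiplier `x` lies in the ideal `B` of `𝓜(ℂ, B)`. -/
def MemIdeal (x : 𝓜(ℂ, B)) : Prop :=
  ∃ b : B, DoubleCentralizer.coe ℂ b = x

/-- The multiplier algebra equipped with its strict topology. -/
def StrictMultiplier (B : Type*) [NonUnitalCStarAlgebra B] : Type _ := 𝓜(ℂ, B)

/-- The identity map from the multiplier algebra to its copy with the strict topology. -/
def toStrict (x : 𝓜(ℂ, B)) : StrictMultiplier B := x

/-- The identity map back from the copy with the strict topology. -/
def ofStrict (x : StrictMultiplier B) : 𝓜(ℂ, B) := x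

/-- The strict uniformity, defined by the seminorms `x ↦ ‖x b‖` and `x ↦ ‖b x‖`, `b ∈ B`. -/
instance StrictMultiplier.instUniformSpace : UniformSpace (StrictMultiplier B) :=
  UniformSpace.comap
    (fun x => ((fun b => (ofStrict x).fst b, fun b => (ofStrict x).snd b) : (B → B) × (B → B)))
    inferInstance

/-- `s = ∑ₙ xₙ` in the strict topology (limit of the partial sums). -/
def HasStrictSum (x : ℕ → 𝓜(ℂ, B)) (s : 𝓜(ℂ, B)) : Prop :=
  Tendsto (fun N => toStrict (∑ n ∈ Finset.range N, x n)) atTop (𝓝 (toStrict s))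

variable (B) in
/-- `B` is σ-unital: it has a sequential contractive approximate unit. -/
def IsSigmaUnital : Prop :=
  ∃ e : ℕ → B, (∀ n, ‖e n‖ ≤ 1) ∧
    ∀ b, Tendsto (fun n => e n * b) atTop (𝓝 b) ∧ Tendsto (fun n => b * e n) atTop (𝓝 b)

end Multiplier

/-- A point-norm continuous action of `G` on the C⋆-algebra `A` by `*`-automorphisms. -/
structure CStarAction (G A : Type*) [Group G] [TopologicalSpace G] [NonUnitalCStarAlgebra A] where
  /-- the underlying group homomorphism into the automorphism group -/
  toHom : G →* (A ≃⋆ₐ[ℂ] A)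
  continuous_apply : ∀ a : A, Continuous fun g => toHom g a

/-! ### The stabilization `B ⊗ 𝒦` and strong stability -/

section Stabilization

variable {B : Type*} [NonUnitalCStarAlgebra B]
  {H : Type*} [NormedAddCommGroup H] [InnerProductSpace ℂ H] [CompleteSpace H]

/-- The operator `π(b) ⊗ e_{i,j}` on the Hilbert space `H ⊗ ℓ²(ℕ) = ℓ²(ℕ, H)`, where `e_{i,j}` are
the standard matrix units on `ℓ²(ℕ)`. -/
def elementaryTensor (π : B →⋆ₙₐ[ℂ] (H →L[ℂ] H)) (b : B) (i j : ℕ) :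
    lp (fun _ : ℕ => H) 2 →L[ℂ] lp (fun _ : ℕ => H) 2 :=
  (lp.singleContinuousLinearMap ℂ (fun _ : ℕ => H) 2 i).comp
    ((π b).comp (lp.evalCLM ℂ (fun _ : ℕ => H) 2 j))

/-- The spatial tensor product `π(B) ⊗ 𝒦` on `H ⊗ ℓ²(ℕ)`, with `𝒦` the compact operators on
`ℓ²(ℕ)`: the C⋆-algebra generated by the elementary tensors `π(b) ⊗ e_{i,j}`. When `π` is faithful
this is the C⋆-tensor product `B ⊗ 𝒦`. -/
def spatialStabilization (π : B →⋆ₙₐ[ℂ] (H →L[ℂ] H)) :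
    NonUnitalStarSubalgebra ℂ (lp (fun _ : ℕ => H) 2 →L[ℂ] lp (fun _ : ℕ => H) 2) :=
  (NonUnitalStarAlgebra.adjoin ℂ
    {T | ∃ (b : B) (i j : ℕ), T = elementaryTensor π b i j}).topologicalClosure

instance spatialStabilization.instModule (π : B →⋆ₙₐ[ℂ] (H →L[ℂ] H)) :
    Module ℂ (spatialStabilization π) :=
  SMulMemClass.toModule' _ ℂ ℂ _ (spatialStabilization π)

/-- The elementary tensor `b ⊗ e_{i,j}` as an element of `B ⊗ 𝒦`. -/
def stabilizationTensor (π : B →⋆ₙₐ[ℂ] (H →L[ℂ] H)) (b : B) (i j : ℕ) :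
    spatialStabilization π :=
  ⟨elementaryTensor π b i j,
    subset_closure (NonUnitalStarAlgebra.subset_adjoin ℂ _ ⟨b, i, j, rfl⟩)⟩

end Stabilization

namespace CStarAction

variable {G : Type*} [Group G] [TopologicalSpace G]

/-- `β` is strongly stable: `(B, β)` is conjugate to `(B ⊗ 𝒦, β ⊗ id)`. Here `B ⊗ 𝒦` is formed in a
faithful representation of `B` on a Hilbert space, and `β_g ⊗ id` is the automorphism of `B ⊗ 𝒦`
that maps `b ⊗ e_{i,j}` to `β_g(b) ⊗ e_{i,j}`; so the last clause says that `e ∘ β_g ∘ e⁻¹` is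
`β_g ⊗ id`. -/
def IsStronglyStable.{v} {B : Type v} [NonUnitalCStarAlgebra B] (β : CStarAction G B) : Prop :=
  ∃ (H : Type v) (_ : NormedAddCommGroup H) (_ : InnerProductSpace ℂ H) (_ : CompleteSpace H)
    (π : B →⋆ₙₐ[ℂ] (H →L[ℂ] H)) (_ : Function.Injective π)
    (e : B ≃⋆ₐ[ℂ] spatialStabilization π),
    ∀ (g : G) (b : B) (i j : ℕ),
      e (β.toHom g (e.symm (stabilizationTensor π b i j))) =
        stabilizationTensor π (β.toHom g b) i j

variable {B : Type*} [NonUnitalCStarAlgebra B]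

/-- The (algebraic) extension of the automorphism `β_g` to the multiplier algebra. -/
def mult (β : CStarAction G B) (g : G) : 𝓜(ℂ, B) ≃⋆ₐ[ℂ] 𝓜(ℂ, B) :=
  multiplierAut (β.toHom g)

/-- `t` is an isometry in the fixed point algebra `𝓜(B)^β`. -/
structure IsFixedIsometry (β : CStarAction G B) (t : 𝓜(ℂ, B)) : Prop where
  isometry : star t * t = 1
  fixed : ∀ g, β.mult g t = t

/-- `t₁, t₂` are isometries in `𝓜(B)^β` with `t₁t₁* + t₂t₂* = 1`. -/
structure IsCuntzPair (β : CStarAction G B) (t₁ t₂ : 𝓜(ℂ, B)) : Prop where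
  left : β.IsFixedIsometry t₁
  right : β.IsFixedIsometry t₂
  sum_eq_one : t₁ * star t₁ + t₂ * star t₂ = 1

/-- `(tₙ)` is a sequence of isometries in `𝓜(B)^β` with `∑ₙ tₙtₙ* = 1` strictly. -/
structure IsCuntzSequence (β : CStarAction G B) (t : ℕ → 𝓜(ℂ, B)) : Prop where
  isometry : ∀ n, β.IsFixedIsometry (t n)
  sum_eq_one : HasStrictSum (fun n => t n * star (t n)) 1

end CStarAction

/-! ### Cocycle representations -/

section CocycleRep

variable {G A B : Type*} [Group G] [TopologicalSpace G]
  [NonUnitalCStarAlgebra A] [NonUnitalCStarAlgebra B]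

/-- A cocycle representation `(φ, u) : (A, α) → (𝓜(B), β)`. -/
structure CocycleRep (α : CStarAction G A) (β : CStarAction G B) where
  /-- the `*`-homomorphism -/
  hom : A →⋆ₙₐ[ℂ] 𝓜(ℂ, B)
  /-- the cocycle -/
  coc : G → unitary 𝓜(ℂ, B)
  continuous_coc : Continuous fun g => toStrict (coc g : 𝓜(ℂ, B))
  coc_mul : ∀ g h, (coc (g * h) : 𝓜(ℂ, B)) = coc g * β.mult g (coc h)
  equivariant : ∀ g a,
    (coc g : 𝓜(ℂ, B)) * β.mult g (hom a) * star (coc g : 𝓜(ℂ, B)) = hom (α.toHom g a)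

/-- The Cuntz sum `x ⊕ y = t₁ x t₁* + t₂ y t₂*` of two multipliers. -/
def cuntzAdd (t₁ t₂ x y : 𝓜(ℂ, B)) : 𝓜(ℂ, B) := t₁ * x * star t₁ + t₂ * y * star t₂

theorem star_cuntzAdd (t₁ t₂ x y : 𝓜(ℂ, B)) :
    star (cuntzAdd t₁ t₂ x y) = cuntzAdd t₁ t₂ (star x) (star y) := by
  simp [cuntzAdd, mul_assoc]

theorem CStarAction.IsCuntzPair.orthogonal {β : CStarAction G B} {t₁ t₂ : 𝓜(ℂ, B)}
    (h : β.IsCuntzPair t₁ t₂) : star t₁ * t₂ = 0 := by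
  rw [← CStarRing.mul_star_self_eq_zero_iff]
  have h₂ : t₂ * star t₂ = 1 - t₁ * star t₁ := eq_sub_of_add_eq' h.sum_eq_one
  calc star t₁ * t₂ * star (star t₁ * t₂) = star t₁ * (t₂ * star t₂) * t₁ := by
        simp [mul_assoc]
    _ = star t₁ * t₁ - (star t₁ * t₁) * (star t₁ * t₁) := by rw [h₂]; noncomm_ring
    _ = 0 := by rw [h.left.isometry]; simp

theorem CStarAction.IsCuntzPair.cuntzAdd_mul {β : CStarAction G B} {t₁ t₂ : 𝓜(ℂ, B)}
    (h : β.IsCuntzPair t₁ t₂) (x y x' y' : 𝓜(ℂ, B)) :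
    cuntzAdd t₁ t₂ x y * cuntzAdd t₁ t₂ x' y' = cuntzAdd t₁ t₂ (x * x') (y * y') := by
  have h₁₂ := h.orthogonal
  have h₂₁ : star t₂ * t₁ = 0 := by simpa using congrArg star h₁₂
  calc cuntzAdd t₁ t₂ x y * cuntzAdd t₁ t₂ x' y'
      = t₁ * x * (star t₁ * t₁) * x' * star t₁ + t₁ * x * (star t₁ * t₂) * y' * star t₂
        + t₂ * y * (star t₂ * t₁) * x' * star t₁ + t₂ * y * (star t₂ * t₂) * y' * star t₂ := by
        simp only [cuntzAdd]; noncomm_ring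
    _ = cuntzAdd t₁ t₂ (x * x') (y * y') := by
        rw [h₁₂, h₂₁, h.left.isometry, h.right.isometry]; simp [cuntzAdd, mul_assoc]

theorem CStarAction.IsCuntzPair.cuntzAdd_one {β : CStarAction G B} {t₁ t₂ : 𝓜(ℂ, B)}
    (h : β.IsCuntzPair t₁ t₂) : cuntzAdd t₁ t₂ 1 1 = 1 := by
  simpa [cuntzAdd] using h.sum_eq_one

theorem CStarAction.IsCuntzPair.mult_cuntzAdd {β : CStarAction G B} {t₁ t₂ : 𝓜(ℂ, B)}
    (h : β.IsCuntzPair t₁ t₂) (g : G) (x y : 𝓜(ℂ, B)) :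
    β.mult g (cuntzAdd t₁ t₂ x y) = cuntzAdd t₁ t₂ (β.mult g x) (β.mult g y) := by
  simp [cuntzAdd, map_star, h.left.fixed g, h.right.fixed g]

theorem continuous_toStrict_iff {X : Type*} [TopologicalSpace X] {f : X → 𝓜(ℂ, B)} :
    (Continuous fun x => toStrict (f x)) ↔
      (∀ b, Continuous fun x => (f x).fst b) ∧ ∀ b, Continuous fun x => (f x).snd b := by
  have : (StrictMultiplier.instUniformSpace (B := B)).toTopologicalSpace =
      TopologicalSpace.induced (fun x : StrictMultiplier B =>
        ((fun b => (ofStrict x).fst b, fun b => (ofStrict x).snd b) : (B → B) × (B → B)))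
        inferInstance := rfl
  rw [this, continuous_induced_rng, continuous_prodMk, continuous_pi_iff, continuous_pi_iff]
  rfl

namespace CocycleRep

variable {α : CStarAction G A} {β : CStarAction G B}

/-- The Cuntz sum `(φ, u) ⊕ (ψ, v)` of two cocycle representations with respect to `t₁, t₂`. -/
def sum {t₁ t₂ : 𝓜(ℂ, B)} (h : β.IsCuntzPair t₁ t₂) (Φ Ψ : CocycleRep α β) :
    CocycleRep α β where
  hom :=
    { toFun := fun a => cuntzAdd t₁ t₂ (Φ.hom a) (Ψ.hom a)
      map_smul' := fun c a => by simp [cuntzAdd]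
      map_zero' := by simp [cuntzAdd]
      map_add' := fun a b => by simp only [cuntzAdd, map_add]; noncomm_ring
      map_mul' := fun a b => by rw [h.cuntzAdd_mul, map_mul, map_mul]
      map_star' := fun a => by rw [star_cuntzAdd, map_star, map_star] }
  coc := fun g =>
    ⟨cuntzAdd t₁ t₂ (Φ.coc g) (Ψ.coc g), by
      rw [Unitary.mem_iff, star_cuntzAdd, h.cuntzAdd_mul, h.cuntzAdd_mul]
      simp [h.cuntzAdd_one]⟩
  continuous_coc := by
    have h₁ := continuous_toStrict_iff.mp Φ.continuous_coc
    have h₂ := continuous_toStrict_iff.mp Ψ.continuous_coc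
    refine continuous_toStrict_iff.mpr ⟨fun b => ?_, fun b => ?_⟩
    · exact (t₁.fst.continuous.comp (h₁.1 ((star t₁).fst b))).add
        (t₂.fst.continuous.comp (h₂.1 ((star t₂).fst b)))
    · exact ((star t₁).snd.continuous.comp (h₁.2 (t₁.snd b))).add
        ((star t₂).snd.continuous.comp (h₂.2 (t₂.snd b)))
  coc_mul := fun g k => by
    simp only [h.mult_cuntzAdd, h.cuntzAdd_mul, Φ.coc_mul, Ψ.coc_mul]
  equivariant := fun g a => by
    change cuntzAdd t₁ t₂ (Φ.coc g) (Ψ.coc g) *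
      β.mult g (cuntzAdd t₁ t₂ (Φ.hom a) (Ψ.hom a)) *
        star (cuntzAdd t₁ t₂ (Φ.coc g) (Ψ.coc g)) =
      cuntzAdd t₁ t₂ (Φ.hom (α.toHom g a)) (Ψ.hom (α.toHom g a))
    rw [h.mult_cuntzAdd, star_cuntzAdd, h.cuntzAdd_mul, h.cuntzAdd_mul, Φ.equivariant,
      Ψ.equivariant]

/-- `Ψ` is the countable Cuntz sum `⨁ₙ Φₙ` formed with the isometries `tₙ`: its components are the
pointwise strict sums `∑ₙ tₙ φₙ(a) tₙ*` and `∑ₙ tₙ uₙ(g) tₙ*`. -/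
structure IsCountableSum (t : ℕ → 𝓜(ℂ, B)) (Φ : ℕ → CocycleRep α β) (Ψ : CocycleRep α β) :
    Prop where
  hom : ∀ a, HasStrictSum (fun n => t n * (Φ n).hom a * star (t n)) (Ψ.hom a)
  coc : ∀ g, HasStrictSum (fun n => t n * ((Φ n).coc g : 𝓜(ℂ, B)) * star (t n)) (Ψ.coc g)

/-- `Ψ = Ad(w) ∘ Φ`, that is, `ψ = w φ(·) w*` and `v_g = w u_g β_g(w)*`. -/
structure IsConjBy (w : unitary 𝓜(ℂ, B)) (Φ Ψ : CocycleRep α β) : Prop where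
  hom : ∀ a, Ψ.hom a = (w : 𝓜(ℂ, B)) * Φ.hom a * star (w : 𝓜(ℂ, B))
  coc : ∀ g, (Ψ.coc g : 𝓜(ℂ, B)) = (w : 𝓜(ℂ, B)) * Φ.coc g * star (β.mult g (w : 𝓜(ℂ, B)))

/-- The relation `Φ ≍ Ψ`: asymptotic unitary equivalence through a norm-continuous path of
unitaries `w_t ∈ 𝓜(B)`, `t ∈ [1, ∞)`, with all the differences in `B`. -/
def AsympEquiv (Φ Ψ : CocycleRep α β) : Prop :=
  ∃ w : Set.Ici (1 : ℝ) → unitary 𝓜(ℂ, B), Continuous w ∧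
    (∀ a, Tendsto (fun t => (w t : 𝓜(ℂ, B)) * Φ.hom a * star (w t : 𝓜(ℂ, B))) atTop
      (𝓝 (Ψ.hom a))) ∧
    (∀ a t, MemIdeal (Ψ.hom a - (w t : 𝓜(ℂ, B)) * Φ.hom a * star (w t : 𝓜(ℂ, B)))) ∧
    (∀ K : Set G, IsCompact K →
      TendstoUniformlyOn
        (fun t g => (w t : 𝓜(ℂ, B)) * (Φ.coc g : 𝓜(ℂ, B)) * star (β.mult g (w t : 𝓜(ℂ, B))))
        (fun g => (Ψ.coc g : 𝓜(ℂ, B))) atTop K) ∧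
    (∀ t g, MemIdeal ((Ψ.coc g : 𝓜(ℂ, B)) -
      (w t : 𝓜(ℂ, B)) * (Φ.coc g : 𝓜(ℂ, B)) * star (β.mult g (w t : 𝓜(ℂ, B)))))

/-- The topology on the set of cocycle representations: point-strict convergence in the first
variable and strict convergence, uniformly over compact subsets of `G`, in the second. -/
instance instTopologicalSpace : TopologicalSpace (CocycleRep α β) :=
  TopologicalSpace.induced
    (fun Φ => ((fun a => toStrict (Φ.hom a),
      UniformOnFun.ofFun {K : Set G | IsCompact K} fun g => toStrict (Φ.coc g : 𝓜(ℂ, B))) :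
        (A → StrictMultiplier B) × (UniformOnFun G (StrictMultiplier B) {K | IsCompact K})))
    inferInstance

/-- A σ-additive set of cocycle representations: closed under conjugation by unitaries in
`𝓜(B)^β` and under countable Cuntz sums. -/
structure IsSigmaAdditive (C : Set (CocycleRep α β)) : Prop where
  conj_mem : ∀ Φ ∈ C, ∀ w : unitary 𝓜(ℂ, B), (∀ g, β.mult g (w : 𝓜(ℂ, B)) = w) →
    ∀ Ψ, IsConjBy w Φ Ψ → Ψ ∈ C
  sum_mem : ∀ Φ : ℕ → CocycleRep α β, (∀ n, Φ n ∈ C) →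
    ∀ t, β.IsCuntzSequence t → ∀ Ψ, IsCountableSum t Φ Ψ → Ψ ∈ C

/-- `Θ` is an absorbing element of `C`: it belongs to `C` and `Θ ⊕ Φ ≍ Θ` for all `Φ ∈ C`
(for every choice of the isometries defining the Cuntz sum). -/
structure IsAbsorbing (C : Set (CocycleRep α β)) (Θ : CocycleRep α β) : Prop where
  mem : Θ ∈ C
  absorbs : ∀ Φ ∈ C, ∀ (t₁ t₂ : 𝓜(ℂ, B)) (h : β.IsCuntzPair t₁ t₂),
    AsympEquiv (sum h Θ Φ) Θ

end CocycleRep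

end CocycleRep

end

/-! The proof is a Voiculescu–Kasparov absorption argument. Strong stability yields isometries `tₙ`
in `𝓜(B)^β` with orthogonal ranges and `∑ tₙ tₙ* = 1` strictly (`exists_isCuntzFamily`), so infinite
sums can be formed inside `C`. Choose a sequence `Φₙ` in `C` that approximates every element of `C`
on vectors of `B`. Let `Ω = ⨁ Φₙ`, and let `Θ` be the infinite repeat of `Ω`. This `Θ` is absorbing.

Given `Φ ∈ C`, let `Ψ` be its infinite repeat and `Ψ'` the infinite repeat of `Ψ`; both lie in `C`.
A quasicentral approximate unit gives `fₙ ∈ B` with `∑ fₙ² = 1` strictly that almost commute with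
`Ψ'`, twisted by `β` in the case of the cocycle (`exists_quasicentral_partition`). If `Φ_{k(n)}` is
within `2⁻ⁿ` of `Ψ'` on `fₙ`, then `s = ∑ tₙ t_{k(n)} fₙ` is an isometry. Its defects `Θ(a) s - s
Ψ'(a)`, and their analogues for the cocycle, lie in `B`: for a dense set of `a` they are
norm-convergent series in `B` (`exists_intertwining_isometry`).

To make the defects vanish asymptotically, let `T_τ` be a norm-continuous path of fixed isometries
that intertwine `Ψ` with `Ψ'` and satisfy `b T_τ → 0` for `b ∈ B`. The defect of `s T_τ` as an
intertwiner of `Ψ` and `Θ` is that of `s` multiplied by `T_τ`, so it stays in `B` and tends to `0`.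
Finally `Ψ` absorbs `Φ` exactly, by the shift `S` and `t₀`. Performing this absorption inside the
range of `s T_τ` gives unitaries that conjugate `Θ ⊕ Φ` to `Θ` up to these defects
(`absorbingUnitary`, `asympEquiv_of_intertwining_isometry`). -/

noncomputable section

/-! ### `B` as a closed ideal of its multiplier algebra. -/

section MultiplierBasics

variable {B : Type*} [NonUnitalCStarAlgebra B]

variable (B) in
/-- The canonical inclusion of a C⋆-algebra into its multiplier algebra. -/
def incl : B →⋆ₙₐ[ℂ] 𝓜(ℂ, B) := DoubleCentralizer.coeHom

theorem incl_fst (a b : B) : (incl B a).fst b = a * b := rfl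

theorem incl_injective : Function.Injective (incl B) := by
  intro a b h
  have h' : ∀ c, a * c = b * c := fun c => by
    rw [← incl_fst, h, incl_fst]
  have := h' (star (a - b))
  rw [← sub_eq_zero, ← sub_mul, CStarRing.mul_star_self_eq_zero_iff] at this
  exact sub_eq_zero.mp this

theorem norm_incl (b : B) : ‖incl B b‖ = ‖b‖ :=
  NonUnitalStarAlgHom.norm_map (incl B) incl_injective b

theorem isometry_incl : Isometry (incl B) :=
  AddMonoidHomClass.isometry_of_norm _ norm_incl

theorem eq_of_forall_mul_left {a b : B} (h : ∀ c, c * a = c * b) : a = b := by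
  have := h (star (a - b))
  rw [← sub_eq_zero, ← mul_sub, CStarRing.star_mul_self_eq_zero_iff] at this
  exact sub_eq_zero.mp this

theorem eq_of_forall_mul_right {a b : B} (h : ∀ c, a * c = b * c) : a = b := by
  have := h (star (a - b))
  rw [← sub_eq_zero, ← sub_mul, CStarRing.mul_star_self_eq_zero_iff] at this
  exact sub_eq_zero.mp this

/-- Right `B`-linearity comes from the central identity, because left multiplications by elements of
`B` separate its points. -/
theorem fst_mul (x : 𝓜(ℂ, B)) (b c : B) : x.fst (b * c) = x.fst b * c :=
  eq_of_forall_mul_left fun d => by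
    rw [← x.central, ← mul_assoc, ← mul_assoc, x.central]

theorem multiplier_ext_fst {x y : 𝓜(ℂ, B)} (h : ∀ b, x.fst b = y.fst b) : x = y :=
  multiplier_ext h fun b => eq_of_forall_mul_right fun c => by rw [x.central, y.central, h]

theorem mul_incl (x : 𝓜(ℂ, B)) (b : B) : x * incl B b = incl B (x.fst b) :=
  multiplier_ext_fst fun c => by
    simp [incl_fst, fst_mul]

theorem incl_mul (x : 𝓜(ℂ, B)) (b : B) : incl B b * x = incl B (x.snd b) :=
  multiplier_ext_fst fun c => by
    simp [incl_fst, x.central]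

theorem multiplier_ext_incl {x y : 𝓜(ℂ, B)} (h : ∀ b, x * incl B b = y * incl B b) : x = y :=
  multiplier_ext_fst fun b => incl_injective <| by rw [← mul_incl, ← mul_incl, h]

theorem multiplier_ext_incl' {x y : 𝓜(ℂ, B)} (h : ∀ b, incl B b * x = incl B b * y) : x = y := by
  rw [← star_inj]
  refine multiplier_ext_incl fun b => ?_
  rw [← star_inj]
  simpa [map_star] using h (star b)

theorem norm_mul_incl (x : 𝓜(ℂ, B)) (b : B) : ‖x * incl B b‖ = ‖x.fst b‖ := by
  rw [mul_incl, norm_incl]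

theorem memIdeal_incl (b : B) : MemIdeal (incl B b) := ⟨b, rfl⟩

namespace MemIdeal

variable {x y : 𝓜(ℂ, B)}

theorem add (hx : MemIdeal x) (hy : MemIdeal y) : MemIdeal (x + y) := by
  obtain ⟨a, rfl⟩ := hx
  obtain ⟨b, rfl⟩ := hy
  exact ⟨a + b, map_add (incl B) a b⟩

theorem neg (hx : MemIdeal x) : MemIdeal (-x) := by
  obtain ⟨a, rfl⟩ := hx
  exact ⟨-a, map_neg (incl B) a⟩

theorem sub (hx : MemIdeal x) (hy : MemIdeal y) : MemIdeal (x - y) := by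
  rw [sub_eq_add_neg]
  exact hx.add hy.neg

theorem star (hx : MemIdeal x) : MemIdeal (Star.star x) := by
  obtain ⟨a, rfl⟩ := hx
  exact ⟨Star.star a, map_star (incl B) a⟩

theorem mul_left (hx : MemIdeal x) (y : 𝓜(ℂ, B)) : MemIdeal (y * x) := by
  obtain ⟨a, rfl⟩ := hx
  exact ⟨_, (mul_incl y a).symm⟩

theorem mul_right (hx : MemIdeal x) (y : 𝓜(ℂ, B)) : MemIdeal (x * y) := by
  obtain ⟨a, rfl⟩ := hx
  exact ⟨_, (incl_mul y a).symm⟩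

end MemIdeal

theorem isClosed_memIdeal : IsClosed {x : 𝓜(ℂ, B) | MemIdeal x} :=
  (isometry_incl (B := B)).isClosedEmbedding.isClosed_range

theorem memIdeal_sum {ι : Type*} {x : ι → 𝓜(ℂ, B)} (s : Finset ι)
    (h : ∀ i, MemIdeal (x i)) : MemIdeal (∑ i ∈ s, x i) := by
  classical
  induction s using Finset.induction_on with
  | empty => exact ⟨0, map_zero (incl B)⟩
  | insert i s hi ih => rw [Finset.sum_insert hi]; exact (h i).add ih

theorem memIdeal_tsum {x : ℕ → 𝓜(ℂ, B)} (h : ∀ n, MemIdeal (x n)) : MemIdeal (∑' n, x n) := by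
  by_cases hs : Summable x
  · exact isClosed_memIdeal.mem_of_tendsto hs.hasSum.tendsto_sum_nat
      (Eventually.of_forall fun N => memIdeal_sum _ h)
  -- The default value `0` of a divergent `tsum` also lies in the ideal.
  · rw [tsum_eq_zero_of_not_summable hs]
    exact ⟨0, map_zero (incl B)⟩

/-! ### The strict topology -/

theorem tendsto_toStrict_iff {ι : Type*} {l : Filter ι} {f : ι → 𝓜(ℂ, B)} {x : 𝓜(ℂ, B)} :
    Tendsto (fun i => toStrict (f i)) l (𝓝 (toStrict x)) ↔
      (∀ b, Tendsto (fun i => f i * incl B b) l (𝓝 (x * incl B b))) ∧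
        ∀ b, Tendsto (fun i => incl B b * f i) l (𝓝 (incl B b * x)) := by
  have : (StrictMultiplier.instUniformSpace (B := B)).toTopologicalSpace =
      TopologicalSpace.induced (fun x : StrictMultiplier B =>
        ((fun b => (ofStrict x).fst b, fun b => (ofStrict x).snd b) : (B → B) × (B → B)))
        inferInstance := rfl
  rw [this, nhds_induced, tendsto_comap_iff, nhds_prod_eq, tendsto_prod_iff', tendsto_pi_nhds,
    tendsto_pi_nhds]
  simp_rw [mul_incl, incl_mul,
    (isometry_incl (B := B)).isEmbedding.tendsto_nhds_iff]
  rfl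

/-- Strict sequential completeness: by Banach–Steinhaus the pointwise limits of the left and right
multiplications are bounded, and the central identity passes to the limit. -/
theorem exists_strict_limit {f : ℕ → 𝓜(ℂ, B)}
    (h₁ : ∀ b, CauchySeq fun n => f n * incl B b) (h₂ : ∀ b, CauchySeq fun n => incl B b * f n) :
    ∃ x, Tendsto (fun n => toStrict (f n)) atTop (𝓝 (toStrict x)) := by
  have k₁ : ∀ b, ∃ c, Tendsto (fun n => (f n).fst b) atTop (𝓝 c) := fun b => by
    refine cauchySeq_tendsto_of_complete ?_
    have := h₁ b
    simp_rw [mul_incl] at this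
    exact (isometry_incl (B := B)).isUniformInducing.cauchy_map_iff.mp
      (by rwa [Filter.map_map])
  have k₂ : ∀ b, ∃ c, Tendsto (fun n => (f n).snd b) atTop (𝓝 c) := fun b => by
    refine cauchySeq_tendsto_of_complete ?_
    have := h₂ b
    simp_rw [incl_mul] at this
    exact (isometry_incl (B := B)).isUniformInducing.cauchy_map_iff.mp
      (by rwa [Filter.map_map])
  choose L hL using k₁
  choose R hR using k₂
  let x : 𝓜(ℂ, B) :=
    { fst := continuousLinearMapOfTendsto (fun n => (f n).fst) (tendsto_pi_nhds.mpr hL)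
      snd := continuousLinearMapOfTendsto (fun n => (f n).snd) (tendsto_pi_nhds.mpr hR)
      central := fun a b => by
        refine tendsto_nhds_unique ((hR a).mul_const b) ?_
        simp_rw [(f _).central]
        exact (hL b).const_mul a }
  refine ⟨x, tendsto_toStrict_iff.mpr ⟨fun b => ?_, fun b => ?_⟩⟩
  · simp_rw [mul_incl]
    exact (isometry_incl.continuous.tendsto _).comp (hL b)
  · simp_rw [incl_mul]
    exact (isometry_incl.continuous.tendsto _).comp (hR b)

theorem strict_limit_mul_left {f : ℕ → 𝓜(ℂ, B)} {x y z : 𝓜(ℂ, B)}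
    (h : Tendsto (fun n => toStrict (f n)) atTop (𝓝 (toStrict x)))
    (h' : ∀ᶠ n in atTop, y * f n = z) : y * x = z := by
  refine multiplier_ext_incl fun b => ?_
  rw [mul_assoc]
  refine tendsto_nhds_unique (((tendsto_toStrict_iff.mp h).1 b).const_mul y) ?_
  refine tendsto_const_nhds.congr' ?_
  filter_upwards [h'] with n hn
  rw [← hn, mul_assoc]

/-! ### Norms of isometries and unitaries -/

theorem norm_le_one_of_isometry {M : Type*} [CStarAlgebra M] {t : M}
    (h : star t * t = 1) : ‖t‖ ≤ 1 := by
  -- The algebra may be trivial, so only `‖1‖² = ‖1‖` is used and not `‖1‖ = 1`.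
  have h1 : ‖(1 : M)‖ ≤ 1 := by
    have : ‖(1 : M)‖ * ‖(1 : M)‖ = ‖(1 : M)‖ := by
      rw [← CStarRing.norm_star_mul_self (x := (1 : M))]; simp
    nlinarith [norm_nonneg (1 : M)]
  have h2 : ‖t‖ * ‖t‖ ≤ 1 := by rw [← CStarRing.norm_star_mul_self (x := t), h]; exact h1
  nlinarith [norm_nonneg t]

theorem norm_unitary_le_one {M : Type*} [CStarAlgebra M] (u : unitary M) : ‖(u : M)‖ ≤ 1 :=
  norm_le_one_of_isometry (Unitary.coe_star_mul_self u)

end MultiplierBasics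

/-! ### The action on `B`, its extension to multipliers, and joint continuity. -/

section ActionBasics

variable {G B : Type*} [Group G] [TopologicalSpace G] [NonUnitalCStarAlgebra B]
  (β : CStarAction G B)

namespace CStarAction

theorem mult_incl (g : G) (b : B) : β.mult g (incl B b) = incl B (β.toHom g b) :=
  multiplier_ext_fst fun c => by
    change β.toHom g (b * (β.toHom g).symm c) = β.toHom g b * c
    simp

theorem norm_mult (g : G) (x : 𝓜(ℂ, B)) : ‖β.mult g x‖ = ‖x‖ :=
  StarAlgEquiv.norm_map (β.mult g) x

theorem toHom_one_apply (b : B) : β.toHom 1 b = b := by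
  rw [map_one]; rfl

theorem toHom_mul_apply (g h : G) (b : B) : β.toHom (g * h) b = β.toHom g (β.toHom h b) := by
  rw [map_mul]; rfl

theorem toHom_symm_apply (g : G) (b : B) : (β.toHom g).symm b = β.toHom g⁻¹ b := by
  rw [StarAlgEquiv.symm_apply_eq, ← toHom_mul_apply, mul_inv_cancel, toHom_one_apply]

/-- A point-norm continuous action is jointly continuous. -/
theorem continuous_apply_apply {X : Type*} [TopologicalSpace X] {γ : X → G} {f : X → B}
    (hγ : Continuous γ) (hf : Continuous f) : Continuous fun x => β.toHom (γ x) (f x) := by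
  rw [continuous_iff_continuousAt]
  intro x₀
  rw [ContinuousAt, tendsto_iff_norm_sub_tendsto_zero]
  have h₁ : Tendsto (fun x => ‖f x - f x₀‖ + ‖β.toHom (γ x) (f x₀) - β.toHom (γ x₀) (f x₀)‖)
      (𝓝 x₀) (𝓝 0) := by
    have := (tendsto_iff_norm_sub_tendsto_zero.mp (hf.tendsto x₀)).add
      (tendsto_iff_norm_sub_tendsto_zero.mp
        (((β.continuous_apply (f x₀)).comp hγ).tendsto x₀))
    simpa using this
  refine squeeze_zero (fun _ => norm_nonneg _) (fun x => ?_) h₁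
  calc ‖β.toHom (γ x) (f x) - β.toHom (γ x₀) (f x₀)‖
      = ‖β.toHom (γ x) (f x - f x₀) +
          (β.toHom (γ x) (f x₀) - β.toHom (γ x₀) (f x₀))‖ := by
        rw [map_sub]; congr 1; abel
    _ ≤ _ := (norm_add_le _ _).trans
        (by rw [StarAlgEquiv.norm_map (β.toHom (γ x))])

end CStarAction

end ActionBasics

/-! ### Amplified isometries on `ℓ²(ℕ, H)` -/

section Amplification

set_option linter.unusedSectionVars false

variable {H : Type*} [NormedAddCommGroup H] [InnerProductSpace ℂ H] [CompleteSpace H]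

/-- The inclusion of `H` as the `i`-th coordinate subspace of `ℓ²(ℕ, H)`. -/
def lpSingleIsometry (i : ℕ) : H →ₗᵢ[ℂ] lp (fun _ : ℕ => H) 2 where
  toLinearMap := lp.lsingle (E := fun _ : ℕ => H) 2 i
  norm_map' x := lp.norm_single (E := fun _ : ℕ => H) (p := 2) (by norm_num) i x

theorem lpSingleIsometry_apply (i : ℕ) (x : H) :
    lpSingleIsometry i x = lp.single (E := fun _ : ℕ => H) 2 i x := rfl

/-- The pairing bijection splits `ℕ` into infinitely many infinite blocks; block `n` will carry the
range of the `n`-th isometry. -/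
theorem orthogonalFamily_lpSingle (n : ℕ) :
    OrthogonalFamily ℂ (fun _ : ℕ => H) fun j => lpSingleIsometry (H := H) (Nat.pair n j) := by
  intro i j hij x y
  rw [lpSingleIsometry_apply, lpSingleIsometry_apply, lp.inner_single_left, lp.single_apply_ne]
  · simp
  · simpa using hij

/-- The isometry `1 ⊗ vₙ` on `ℓ²(ℕ, H)`, where `vₙ δⱼ = δ_{⟨n, j⟩}`. -/
def ampIsometry (n : ℕ) : lp (fun _ : ℕ => H) 2 →L[ℂ] lp (fun _ : ℕ => H) 2 :=
  (orthogonalFamily_lpSingle n).linearIsometry.toContinuousLinearMap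

theorem ampIsometry_single (n j : ℕ) (x : H) :
    ampIsometry n (lp.single (E := fun _ : ℕ => H) 2 j x) = lp.single 2 (Nat.pair n j) x :=
  (orthogonalFamily_lpSingle n).linearIsometry_apply_single x

theorem ampIsometry_apply_of_ne {m n : ℕ} (h : m ≠ n) (j : ℕ) (f : lp (fun _ : ℕ => H) 2) :
    ampIsometry n f (Nat.pair m j) = 0 := by
  have h₁ := (lp.evalCLM ℂ (fun _ : ℕ => H) 2 (Nat.pair m j)).hasSum
    ((orthogonalFamily_lpSingle (H := H) n).hasSum_linearIsometry f)
  refine h₁.unique ?_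
  have : ∀ i, lp.evalCLM ℂ (fun _ : ℕ => H) 2 (Nat.pair m j)
      (lpSingleIsometry (Nat.pair n i) (f i)) = 0 := fun i => by
    change lp.single (E := fun _ : ℕ => H) 2 (Nat.pair n i) (f i) (Nat.pair m j) = 0
    rw [lp.single_apply_ne]
    simp [h]
  simp_rw [this]
  exact hasSum_zero

theorem star_ampIsometry_mul_self (n : ℕ) :
    star (ampIsometry (H := H) n) * ampIsometry n = 1 := by
  rw [ContinuousLinearMap.star_eq_adjoint]
  exact (ContinuousLinearMap.norm_map_iff_adjoint_comp_self _).mp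
    (orthogonalFamily_lpSingle (H := H) n).linearIsometry.norm_map

theorem star_ampIsometry_single_of_ne {m n : ℕ} (h : m ≠ n) (j : ℕ) (x : H) :
    star (ampIsometry (H := H) n) (lp.single (E := fun _ : ℕ => H) 2 (Nat.pair m j) x) = 0 := by
  rw [← inner_self_eq_zero (𝕜 := ℂ), ContinuousLinearMap.star_eq_adjoint,
    ContinuousLinearMap.adjoint_inner_left, lp.inner_single_left, ampIsometry_apply_of_ne h,
    inner_zero_right]

theorem star_ampIsometry_mul_of_ne {m n : ℕ} (h : m ≠ n) :
    star (ampIsometry (H := H) n) * ampIsometry m = 0 := by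
  ext1 f
  have h₁ := (star (ampIsometry (H := H) n)).hasSum
    ((orthogonalFamily_lpSingle (H := H) m).hasSum_linearIsometry f)
  refine h₁.unique ?_
  have : ∀ i, star (ampIsometry (H := H) n) (lpSingleIsometry (Nat.pair m i) (f i)) = 0 := fun i =>
    star_ampIsometry_single_of_ne h i (f i)
  simp_rw [this]
  exact hasSum_zero

variable {B : Type*} [NonUnitalCStarAlgebra B] (π : B →⋆ₙₐ[ℂ] (H →L[ℂ] H))

theorem elementaryTensor_apply (b : B) (i j : ℕ) (f : lp (fun _ : ℕ => H) 2) :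
    elementaryTensor π b i j f = lp.single (E := fun _ : ℕ => H) 2 i (π b (f j)) := rfl

theorem ampIsometry_mul_elementaryTensor (n : ℕ) (b : B) (i j : ℕ) :
    ampIsometry n * elementaryTensor π b i j = elementaryTensor π b (Nat.pair n i) j := by
  ext1 f
  rw [mul_apply_eq_comp, elementaryTensor_apply, ampIsometry_single,
    elementaryTensor_apply]

theorem star_ampIsometry_mul_elementaryTensor (n : ℕ) (b : B) (i j : ℕ) :
    star (ampIsometry (H := H) n) * elementaryTensor π b (Nat.pair n i) j =
      elementaryTensor π b i j := by
  rw [← ampIsometry_mul_elementaryTensor, ← mul_assoc, star_ampIsometry_mul_self, one_mul]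

theorem star_ampIsometry_mul_elementaryTensor_of_ne {m n : ℕ} (h : m ≠ n) (b : B) (i j : ℕ) :
    star (ampIsometry (H := H) n) * elementaryTensor π b (Nat.pair m i) j = 0 := by
  rw [← ampIsometry_mul_elementaryTensor, ← mul_assoc, star_ampIsometry_mul_of_ne h, zero_mul]

theorem star_elementaryTensor (b : B) (i j : ℕ) :
    star (elementaryTensor π b i j) = elementaryTensor π (star b) j i := by
  rw [ContinuousLinearMap.star_eq_adjoint]
  symm
  rw [ContinuousLinearMap.eq_adjoint_iff]
  intro f g
  rw [elementaryTensor_apply, elementaryTensor_apply, lp.inner_single_left, lp.inner_single_right,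
    map_star, ContinuousLinearMap.star_eq_adjoint, ContinuousLinearMap.adjoint_inner_left]

theorem elementaryTensor_mem (b : B) (i j : ℕ) :
    elementaryTensor π b i j ∈ spatialStabilization π :=
  (stabilizationTensor π b i j).2

/-- The embedding of a stable C⋆-algebra into the operators on `ℓ²(ℕ, H)`. -/
def stabEmbedding (e : B ≃⋆ₐ[ℂ] spatialStabilization π) :
    B →⋆ₙₐ[ℂ] (lp (fun _ : ℕ => H) 2 →L[ℂ] lp (fun _ : ℕ => H) 2) where
  toFun b := e b
  map_smul' c b := congrArg Subtype.val (map_smul e c b)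
  map_zero' := congrArg Subtype.val (map_zero e)
  map_add' a b := congrArg Subtype.val (map_add e a b)
  map_mul' a b := congrArg Subtype.val (map_mul e a b)
  map_star' a := congrArg Subtype.val (map_star e a)

variable {π} (e : B ≃⋆ₐ[ℂ] spatialStabilization π)

theorem stabEmbedding_injective : Function.Injective (stabEmbedding π e) :=
  fun _ _ h => e.injective (Subtype.ext h)

theorem isometry_stabEmbedding : Isometry (stabEmbedding π e) :=
  AddMonoidHomClass.isometry_of_norm _ fun b =>
    NonUnitalStarAlgHom.norm_map (stabEmbedding π e) (stabEmbedding_injective e) b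

theorem stabEmbedding_mem (b : B) : stabEmbedding π e b ∈ spatialStabilization π := (e b).2

theorem stabEmbedding_symm {T : lp (fun _ : ℕ => H) 2 →L[ℂ] lp (fun _ : ℕ => H) 2}
    (hT : T ∈ spatialStabilization π) : stabEmbedding π e (e.symm ⟨T, hT⟩) = T := by
  change ((e (e.symm ⟨T, hT⟩) : spatialStabilization π) : _ →L[ℂ] _) = T
  rw [StarAlgEquiv.apply_symm_apply]

theorem stabEmbedding_symm_tensor (b : B) (i j : ℕ) :
    stabEmbedding π e (e.symm (stabilizationTensor π b i j)) = elementaryTensor π b i j :=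
  stabEmbedding_symm e _

/-- Induction principle: a property that holds for the elementary tensors and is stable under the
algebra operations and limits holds for all elements. -/
theorem stab_induction {p : B → Prop}
    (tensor : ∀ b i j, p (e.symm (stabilizationTensor π b i j)))
    (add : ∀ a b, p a → p b → p (a + b)) (smul : ∀ (c : ℂ) a, p a → p (c • a))
    (mul : ∀ a b, p a → p b → p (a * b)) (closed : IsClosed {b | p b}) (b : B) : p b := by
  have hcl : IsClosed (stabEmbedding π e '' {b | p b}) :=
    (isometry_stabEmbedding e).isClosedEmbedding.isClosedMap _ closed
  have hadj : ∀ T ∈ NonUnitalStarAlgebra.adjoin ℂ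
      {T | ∃ (b : B) (i j : ℕ), T = elementaryTensor π b i j},
      T ∈ stabEmbedding π e '' {b | p b} := by
    intro T hT
    have hgen : ∀ b i j, elementaryTensor π b i j ∈ stabEmbedding π e '' {b | p b} :=
      fun b i j => ⟨_, tensor b i j, stabEmbedding_symm_tensor e b i j⟩
    -- The star-closed adjoin is the plain adjoin of the generators and their adjoints. Adjoints of
    -- elementary tensors are elementary tensors, so `p` need not be stable under `star`.
    rw [← NonUnitalStarSubalgebra.mem_toNonUnitalSubalgebra,
      NonUnitalStarAlgebra.adjoin_toNonUnitalSubalgebra] at hT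
    induction hT using NonUnitalAlgebra.adjoin_induction with
    | mem x hx =>
      rcases hx with ⟨b, i, j, rfl⟩ | ⟨b, i, j, h⟩
      · exact hgen b i j
      · rw [← star_star x, h, star_elementaryTensor]
        exact hgen _ _ _
    | add x y _ _ hx hy =>
      obtain ⟨a, ha, rfl⟩ := hx
      obtain ⟨b, hb, rfl⟩ := hy
      exact ⟨a + b, add a b ha hb, map_add _ _ _⟩
    | zero =>
      obtain ⟨a, ha, -⟩ := hgen 0 0 0
      exact ⟨_, smul 0 a ha, by simp⟩
    | mul x y _ _ hx hy =>
      obtain ⟨a, ha, rfl⟩ := hx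
      obtain ⟨b, hb, rfl⟩ := hy
      exact ⟨a * b, mul a b ha hb, map_mul _ _ _⟩
    | smul c x _ hx =>
      obtain ⟨a, ha, rfl⟩ := hx
      exact ⟨c • a, smul c a ha, map_smul _ _ _⟩
  have hb : stabEmbedding π e b ∈ stabEmbedding π e '' {b | p b} :=
    closure_minimal hadj hcl (stabEmbedding_mem e b)
  obtain ⟨a, ha, hab⟩ := hb
  rwa [stabEmbedding_injective e hab] at ha

/-- Membership is inherited by products through their left factor, so it suffices to treat
elementary tensors, whose row index the isometry merely moves. -/
theorem ampIsometry_mul_mem (n : ℕ) (b : B) :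
    ampIsometry n * stabEmbedding π e b ∈ spatialStabilization π := by
  induction b using stab_induction e with
  | tensor b i j =>
    rw [stabEmbedding_symm_tensor, ampIsometry_mul_elementaryTensor]
    exact elementaryTensor_mem _ _ _ _
  | add a b ha hb => rw [map_add, mul_add]; exact add_mem ha hb
  | smul c a ha =>
    rw [map_smul, mul_smul_comm]
    exact (spatialStabilization π).smul_mem' c ha
  | mul a b ha hb =>
    rw [map_mul, ← mul_assoc]
    exact mul_mem ha (stabEmbedding_mem e b)
  | closed =>
    exact isClosed_closure.preimage
      (continuous_const.mul (isometry_stabEmbedding e).continuous)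

theorem star_ampIsometry_mul_mem (n : ℕ) (b : B) :
    star (ampIsometry (H := H) n) * stabEmbedding π e b ∈ spatialStabilization π := by
  induction b using stab_induction e with
  | tensor b i j =>
    rw [stabEmbedding_symm_tensor, ← Nat.pair_unpair i]
    by_cases h : (Nat.unpair i).1 = n
    · rw [h, star_ampIsometry_mul_elementaryTensor]
      exact elementaryTensor_mem _ _ _ _
    · rw [star_ampIsometry_mul_elementaryTensor_of_ne π h]
      exact zero_mem _
  | add a b ha hb => rw [map_add, mul_add]; exact add_mem ha hb
  | smul c a ha =>
    rw [map_smul, mul_smul_comm]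
    exact (spatialStabilization π).smul_mem' c ha
  | mul a b ha hb =>
    rw [map_mul, ← mul_assoc]
    exact mul_mem ha (stabEmbedding_mem e b)
  | closed =>
    exact isClosed_closure.preimage
      (continuous_const.mul (isometry_stabEmbedding e).continuous)

theorem mul_ampIsometry_mem (n : ℕ) (b : B) :
    stabEmbedding π e b * ampIsometry n ∈ spatialStabilization π := by
  have := star_mem (star_ampIsometry_mul_mem e n (star b))
  simpa [map_star] using this

end Amplification

/-! ### Cuntz sequences for strongly stable actions -/

section CuntzFamily

variable {G B : Type*} [Group G] [TopologicalSpace G] [NonUnitalCStarAlgebra B]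

/-- A Cuntz sequence whose isometries are known to have pairwise orthogonal ranges. -/
structure CStarAction.IsCuntzFamily (β : CStarAction G B) (t : ℕ → 𝓜(ℂ, B)) : Prop extends
    β.IsCuntzSequence t where
  orthogonal : ∀ m n, m ≠ n → star (t m) * t n = 0

/-- An `ε/3` argument. It serves to test `∑ tₙ tₙ* b → b` on elementary tensors only. -/
theorem isClosed_setOf_tendsto_of_norm_le {E : Type*} [NormedAddCommGroup E] {f : ℕ → E → E}
    (hadd : ∀ n x y, f n (x - y) = f n x - f n y) (hf : ∀ n x, ‖f n x‖ ≤ ‖x‖) :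
    IsClosed {x | Tendsto (fun n => f n x) atTop (𝓝 x)} := by
  refine isClosed_of_closure_subset fun x hx => ?_
  rw [Set.mem_ofPred_eq, Metric.tendsto_atTop]
  intro ε hε
  obtain ⟨y, hy, hxy⟩ := Metric.mem_closure_iff.mp hx (ε / 3) (by positivity)
  obtain ⟨N, hN⟩ := Metric.tendsto_atTop.mp hy (ε / 3) (by positivity)
  refine ⟨N, fun n hn => ?_⟩
  have h₁ : dist (f n x) (f n y) ≤ dist x y := by
    rw [dist_eq_norm, dist_eq_norm, ← hadd]; exact hf n _
  calc dist (f n x) x ≤ dist (f n x) (f n y) + dist (f n y) y + dist y x :=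
        dist_triangle4 _ _ _ _
    _ < ε := by linarith [hN n hn, dist_comm x y]

/-- The range projections of isometries with orthogonal ranges have contractive partial sums. -/
theorem norm_sum_range_proj_le {M : Type*} [CStarAlgebra M] {t : ℕ → M}
    (h₁ : ∀ n, star (t n) * t n = 1) (h₂ : ∀ m n, m ≠ n → star (t m) * t n = 0) (s : Finset ℕ) :
    ‖∑ n ∈ s, t n * star (t n)‖ ≤ 1 := by
  set P := ∑ n ∈ s, t n * star (t n) with hP
  have hs : star P = P := by simp [hP]
  have hPP : P * P = P := by
    rw [hP, Finset.sum_mul]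
    refine Finset.sum_congr rfl fun m hm => ?_
    rw [Finset.mul_sum, Finset.sum_eq_single m]
    · rw [mul_assoc, ← mul_assoc (star (t m)), h₁, one_mul]
    · intro n _ hn
      rw [mul_assoc, ← mul_assoc (star (t m)), h₂ m n hn.symm, zero_mul, mul_zero]
    · exact fun h => absurd hm h
  have : ‖P‖ * ‖P‖ = ‖P‖ := by
    rw [← CStarRing.norm_star_mul_self, hs, hPP]
  nlinarith [norm_nonneg P]

/-- An operator that multiplies an embedded C⋆-algebra into itself from both sides defines a
multiplier. -/
theorem exists_multiplier {L : Type*} [CStarAlgebra L] (j : B →⋆ₙₐ[ℂ] L)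
    (hinj : Function.Injective j) {V : L} (h₁ : ∀ b, ∃ c, j c = V * j b)
    (h₂ : ∀ b, ∃ c, j c = j b * V) :
    ∃ t : 𝓜(ℂ, B), (∀ b, j (t.fst b) = V * j b) ∧ ∀ b, j (t.snd b) = j b * V := by
  have hn := NonUnitalStarAlgHom.norm_map j hinj
  choose l hl using h₁
  choose r hr using h₂
  let L : B →ₗ[ℂ] B :=
    { toFun := l
      map_add' := fun a b => hinj <| by rw [map_add, hl, hl, hl, map_add, mul_add]
      map_smul' := fun c a => hinj <| by
        rw [map_smul, hl, hl, map_smul, mul_smul_comm]; rfl }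
  let R : B →ₗ[ℂ] B :=
    { toFun := r
      map_add' := fun a b => hinj <| by rw [map_add, hr, hr, hr, map_add, add_mul]
      map_smul' := fun c a => hinj <| by
        rw [map_smul, hr, hr, map_smul, smul_mul_assoc]; rfl }
  refine ⟨{ fst := L.mkContinuous ‖V‖ fun b => ?_
            snd := R.mkContinuous ‖V‖ fun b => ?_
            central := fun a b => hinj ?_ }, hl, hr⟩
  · rw [← hn, ← hn b]
    exact (congrArg norm (hl b)).trans_le (norm_mul_le _ _)
  · rw [← hn, ← hn b, mul_comm]
    exact (congrArg norm (hr b)).trans_le (norm_mul_le _ _)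
  · rw [map_mul, map_mul]
    change j (r a) * _ = _ * j (l b)
    rw [hl, hr, mul_assoc]

/-- A concrete system of matrix units compatible with the action yields a Cuntz family. -/
theorem CStarAction.exists_isCuntzFamily_of_tensors (β : CStarAction G B)
    {L : Type*} [CStarAlgebra L] (j : B →⋆ₙₐ[ℂ] L) (hinj : Function.Injective j) (V : ℕ → L)
    (hV : ∀ n, star (V n) * V n = 1) (hV' : ∀ m n, m ≠ n → star (V m) * V n = 0)
    (hl : ∀ n b, ∃ c, j c = V n * j b) (hr : ∀ n b, ∃ c, j c = j b * V n)
    (τ : B → ℕ → ℕ → B)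
    (ind : ∀ p : B → Prop, (∀ b i k, p (τ b i k)) → (∀ a b, p a → p b → p (a + b)) →
      (∀ (c : ℂ) a, p a → p (c • a)) → (∀ a b, p a → p b → p (a * b)) → IsClosed {b | p b} →
      ∀ b, p b)
    (hτ : ∀ n b i k, V n * j (τ b i k) = j (τ b (Nat.pair n i) k))
    (hβ : ∀ g b i k, β.toHom g (τ b i k) = τ (β.toHom g b) i k) :
    ∃ t, β.IsCuntzFamily t := by
  choose t ht₁ ht₂ using fun n : ℕ => exists_multiplier j hinj (hl n) (hr n)
  have hs₁ : ∀ n b, j ((star (t n)).fst b) = star (V n) * j b := fun n b => by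
    rw [DoubleCentralizer.star_fst, map_star, ht₂, star_mul, map_star, star_star]
  have hiso : ∀ n, star (t n) * t n = 1 := fun n => multiplier_ext_fst fun b => hinj <| by
    change j ((star (t n)).fst ((t n).fst b)) = j b
    rw [hs₁, ht₁, ← mul_assoc, hV, one_mul]
  have horth : ∀ m n, m ≠ n → star (t m) * t n = 0 := fun m n h =>
    multiplier_ext_fst fun b => hinj <| by
      change j ((star (t m)).fst ((t n).fst b)) = j 0
      rw [hs₁, ht₁, ← mul_assoc, hV' m n h, zero_mul, map_zero]
  have hpair : ∀ n b i k, (t n).fst (τ b i k) = τ b (Nat.pair n i) k := fun n b i k =>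
    hinj <| by rw [ht₁, hτ]
  -- `tₙ` changes only the row index and `β_g` only the coefficient of an elementary tensor, so they
  -- commute.
  have hcomm : ∀ n g b, (t n).fst (β.toHom g b) = β.toHom g ((t n).fst b) := by
    intro n g
    refine ind _ (fun b i k => ?_) (fun a b ha hb => ?_) (fun c a ha => ?_)
      (fun a b ha hb => ?_) ?_
    · rw [hβ, hpair, hpair, hβ]
    · simp only [map_add, ha, hb]
    · simp only [map_smul, ha]
    · rw [map_mul, fst_mul, ha, fst_mul, map_mul]
    · have hc := (StarAlgEquiv.isometry (β.toHom g)).continuous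
      exact isClosed_eq ((t n).fst.continuous.comp hc) (hc.comp (t n).fst.continuous)
  have hP : ∀ b, Tendsto (fun N => (∑ n ∈ Finset.range N, t n * star (t n)).fst b) atTop
      (𝓝 b) := by
    refine ind _ (fun b i k => ?_) (fun a b ha hb => ?_) (fun c a ha => ?_)
      (fun a b ha hb => ?_) ?_
    -- Row `i` belongs to block `m = (Nat.unpair i).1`, so the partial sums fix this tensor as soon
    -- as `N > m`.
    · refine tendsto_const_nhds.congr' ?_
      filter_upwards [eventually_gt_atTop (Nat.unpair i).1] with N hN
      refine (incl_injective ?_).symm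
      obtain ⟨m, i, rfl⟩ : ∃ m l, i = Nat.pair m l := ⟨_, _, (Nat.pair_unpair i).symm⟩
      rw [Nat.unpair_pair] at hN
      rw [← mul_incl, ← hpair, Finset.sum_mul, Finset.sum_eq_single m]
      · rw [← mul_incl, mul_assoc, ← mul_assoc (star (t m)), hiso, one_mul]
      · intro n _ hn
        rw [← mul_incl, mul_assoc, ← mul_assoc (star (t n)), horth n m hn, zero_mul, mul_zero]
      · intro h
        exact absurd (Finset.mem_range.mpr hN) h
    · simpa only [map_add] using ha.add hb
    · simpa only [map_smul] using ha.const_smul c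
    · simpa only [fst_mul] using ha.mul_const b
    · refine isClosed_setOf_tendsto_of_norm_le (fun n x y => map_sub _ _ _) fun n x => ?_
      refine (ContinuousLinearMap.le_opNorm _ _).trans ?_
      rw [DoubleCentralizer.norm_fst]
      exact mul_le_of_le_one_left (norm_nonneg _) (norm_sum_range_proj_le hiso horth _)
  have hP' : ∀ b, Tendsto (fun N => (∑ n ∈ Finset.range N, t n * star (t n)) * incl B b) atTop
      (𝓝 (incl B b)) := fun b => by
    simp_rw [mul_incl]
    exact (isometry_incl.continuous.tendsto _).comp (hP b)
  refine ⟨t, ⟨⟨fun n => ⟨hiso n, fun g => multiplier_ext_fst fun b => ?_⟩, ?_⟩, horth⟩⟩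
  · change β.toHom g ((t n).fst ((β.toHom g).symm b)) = _
    rw [← hcomm, StarAlgEquiv.apply_symm_apply]
  · refine tendsto_toStrict_iff.mpr ⟨fun b => by simpa using hP' b, fun b => ?_⟩
    have := (continuous_star.tendsto _).comp (hP' (star b))
    simpa [Function.comp_def, map_star] using this

/-- The operators `1 ⊗ vₙ` are isometric multipliers of `B ⊗ 𝒦` fixed by `β ⊗ id`; the conjugacy `e`
transports them to `B`. -/
theorem CStarAction.IsStronglyStable.exists_isCuntzFamily {β : CStarAction G B}
    (hβ : β.IsStronglyStable) : ∃ t, β.IsCuntzFamily t := by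
  obtain ⟨H, _, _, _, π, -, e, he⟩ := hβ
  refine β.exists_isCuntzFamily_of_tensors (stabEmbedding π e) (stabEmbedding_injective e)
    (fun n => ampIsometry n) star_ampIsometry_mul_self
    (fun m n h => star_ampIsometry_mul_of_ne h.symm)
    (fun n b => ⟨_, stabEmbedding_symm e (ampIsometry_mul_mem e n b)⟩)
    (fun n b => ⟨_, stabEmbedding_symm e (mul_ampIsometry_mem e n b)⟩)
    (fun b i k => e.symm (stabilizationTensor π b i k))
    (fun p h₁ h₂ h₃ h₄ h₅ b => stab_induction e h₁ h₂ h₃ h₄ h₅ b) (fun n b i k => ?_)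
    fun g b i k => ?_
  · rw [stabEmbedding_symm_tensor, stabEmbedding_symm_tensor, ampIsometry_mul_elementaryTensor]
  · rw [← he, StarAlgEquiv.symm_apply_apply]

end CuntzFamily

/-! ### Strict sums along a Cuntz family -/

theorem cauchySeq_of_modulus {E F : Type*} [SeminormedAddCommGroup E] [SeminormedAddCommGroup F]
    {f : ℕ → E} {g : ℕ → F} (hg : CauchySeq g)
    (h : ∀ ε > 0, ∃ δ > 0, ∀ N M, N ≤ M → ‖g M - g N‖ < δ → ‖f M - f N‖ < ε) : CauchySeq f := by
  rw [Metric.cauchySeq_iff']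
  intro ε hε
  obtain ⟨δ, hδ, H⟩ := h ε hε
  obtain ⟨N, hN⟩ := Metric.cauchySeq_iff'.mp hg δ hδ
  refine ⟨N, fun M hM => ?_⟩
  rw [dist_eq_norm]
  exact H N M hM (by rw [← dist_eq_norm]; exact hN M hM)

theorem cauchySeq_of_norm_sub_le {E F : Type*} [SeminormedAddCommGroup E]
    [SeminormedAddCommGroup F] {f : ℕ → E} {g : ℕ → F} (hg : CauchySeq g) (C : ℝ) (hC : 0 ≤ C)
    (h : ∀ N M, N ≤ M → ‖f M - f N‖ ≤ C * ‖g M - g N‖) : CauchySeq f := by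
  refine cauchySeq_of_modulus hg fun ε hε => ⟨ε / (C + 1), by positivity, fun N M hNM hlt => ?_⟩
  calc ‖f M - f N‖ ≤ C * ‖g M - g N‖ := h N M hNM
    _ ≤ (C + 1) * ‖g M - g N‖ := by nlinarith [norm_nonneg (g M - g N)]
    _ < (C + 1) * (ε / (C + 1)) := by gcongr
    _ = ε := by field_simp

section BlockDiagonal

variable {M : Type*} [CStarAlgebra M] {t : ℕ → M}

/-- A finite sum `∑ tₙ yₙ` along isometries with orthogonal ranges satisfies the Pythagorean
identity. -/
theorem star_sum_mul_sum (h₁ : ∀ n, star (t n) * t n = 1)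
    (h₂ : ∀ m n, m ≠ n → star (t m) * t n = 0) (s : Finset ℕ) (y : ℕ → M) :
    star (∑ n ∈ s, t n * y n) * ∑ n ∈ s, t n * y n = ∑ n ∈ s, star (y n) * y n := by
  rw [star_sum, Finset.sum_mul]
  refine Finset.sum_congr rfl fun m hm => ?_
  rw [Finset.mul_sum, Finset.sum_eq_single m]
  · rw [star_mul, mul_assoc, ← mul_assoc (star (t m)), h₁, one_mul]
  · intro n _ hn
    rw [star_mul, mul_assoc, ← mul_assoc (star (t m)), h₂ m n hn.symm, zero_mul, mul_zero]
  · exact fun h => absurd hm h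

/-- For `T = ∑ tₙ xₙ tₙ*`, orthogonality gives `T* T = ∑ tₙ xₙ* xₙ tₙ* ≤ C² ∑ tₙ tₙ*`, and the last
sum is a projection. -/
theorem norm_sum_diag_le (h₁ : ∀ n, star (t n) * t n = 1)
    (h₂ : ∀ m n, m ≠ n → star (t m) * t n = 0) (s : Finset ℕ) {x : ℕ → M} {C : ℝ} (hC : 0 ≤ C)
    (hx : ∀ n, ‖x n‖ ≤ C) : ‖∑ n ∈ s, t n * x n * star (t n)‖ ≤ C := by
  let _ := CStarAlgebra.spectralOrder M
  have := CStarAlgebra.spectralOrderedRing M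
  have h : star (∑ n ∈ s, t n * x n * star (t n)) * ∑ n ∈ s, t n * x n * star (t n) =
      ∑ n ∈ s, t n * (star (x n) * x n) * star (t n) := by
    simp_rw [mul_assoc (t _)]
    rw [star_sum_mul_sum h₁ h₂]
    simp only [star_mul, star_star, mul_assoc]
  have hle : ∑ n ∈ s, t n * (star (x n) * x n) * star (t n) ≤
      (C ^ 2 : ℝ) • ∑ n ∈ s, t n * star (t n) := by
    rw [Finset.smul_sum]
    refine Finset.sum_le_sum fun n _ => ?_
    have h₃ : star (x n) * x n ≤ algebraMap ℝ M (C ^ 2) :=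
      CStarAlgebra.star_mul_le_algebraMap_norm_sq.trans
        (algebraMap_mono M (by have := hx n; gcongr))
    refine (star_right_conjugate_le_conjugate h₃ (t n)).trans_eq ?_
    rw [Algebra.algebraMap_eq_smul_one, mul_smul_comm, mul_one, smul_mul_assoc]
  have hnonneg : 0 ≤ ∑ n ∈ s, t n * (star (x n) * x n) * star (t n) := by
    rw [← h]; exact star_mul_self_nonneg _
  have hnorm := CStarAlgebra.norm_le_norm_of_nonneg_of_le hnonneg hle
  rw [← h, CStarRing.norm_star_mul_self, norm_smul, Real.norm_of_nonneg (by positivity)] at hnorm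
  have := norm_sum_range_proj_le h₁ h₂ s
  have h₄ : ‖∑ n ∈ s, t n * x n * star (t n)‖ ^ 2 ≤ C ^ 2 := by
    rw [sq]; exact hnorm.trans (mul_le_of_le_one_right (by positivity) this)
  exact abs_le_of_sq_le_sq' h₄ hC |>.2

end BlockDiagonal

namespace CStarAction.IsCuntzFamily

variable {G B : Type*} [Group G] [TopologicalSpace G] [NonUnitalCStarAlgebra B]
  {β : CStarAction G B} {t : ℕ → 𝓜(ℂ, B)}

theorem star_mul_self (ht : β.IsCuntzFamily t)
    (n : ℕ) : star (t n) * t n = 1 := (ht.isometry n).isometry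

theorem fixed (ht : β.IsCuntzFamily t)
    (n : ℕ) (g : G) : β.mult g (t n) = t n := (ht.isometry n).fixed g

theorem star_mul_self_assoc (ht : β.IsCuntzFamily t)
    (n : ℕ) (x : 𝓜(ℂ, B)) : star (t n) * (t n * x) = x := by
  rw [← mul_assoc, ht.star_mul_self, one_mul]

theorem orthogonal_assoc (ht : β.IsCuntzFamily t)
    {m n : ℕ} (h : m ≠ n) (x : 𝓜(ℂ, B)) : star (t m) * (t n * x) = 0 := by
  rw [← mul_assoc, ht.orthogonal m n h, zero_mul]

theorem norm_le_one (ht : β.IsCuntzFamily t)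
    (n : ℕ) : ‖t n‖ ≤ 1 := norm_le_one_of_isometry (ht.star_mul_self n)

theorem tendsto_proj_mul (ht : β.IsCuntzFamily t) (b : B) :
    Tendsto (fun N => (∑ n ∈ Finset.range N, t n * star (t n)) * incl B b) atTop
      (𝓝 (incl B b)) := by
  simpa using (tendsto_toStrict_iff.mp ht.sum_eq_one).1 b

theorem tendsto_mul_proj (ht : β.IsCuntzFamily t) (b : B) :
    Tendsto (fun N => incl B b * (∑ n ∈ Finset.range N, t n * star (t n))) atTop
      (𝓝 (incl B b)) := by
  simpa using (tendsto_toStrict_iff.mp ht.sum_eq_one).2 b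

/-- As `∑ tₙ tₙ* = 1` strictly, the coordinates `tₙ* x` determine `x`. Identities between infinite
sums are thus checked one coordinate at a time. -/
theorem ext_left (ht : β.IsCuntzFamily t)
    {x y : 𝓜(ℂ, B)} (h : ∀ n, star (t n) * x = star (t n) * y) : x = y := by
  refine multiplier_ext_incl' fun b => ?_
  refine tendsto_nhds_unique ((ht.tendsto_mul_proj b).mul_const x) ?_
  refine ((ht.tendsto_mul_proj b).mul_const y).congr fun N => ?_
  simp only [mul_assoc, Finset.sum_mul, h]

theorem ext_right (ht : β.IsCuntzFamily t)
    {x y : 𝓜(ℂ, B)} (h : ∀ n, x * t n = y * t n) : x = y := by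
  rw [← star_inj]
  refine ht.ext_left fun n => ?_
  rw [← star_mul, ← star_mul, h]

theorem star_mul_sum (ht : β.IsCuntzFamily t)
    (s : Finset ℕ) (y : ℕ → 𝓜(ℂ, B)) {m : ℕ} (hm : m ∈ s) :
    star (t m) * ∑ n ∈ s, t n * y n = y m := by
  rw [Finset.mul_sum, Finset.sum_eq_single m]
  · exact ht.star_mul_self_assoc m _
  · exact fun n _ hn => ht.orthogonal_assoc hn.symm _
  · exact fun h => absurd hm h

theorem proj_mul_sum (ht : β.IsCuntzFamily t) (s s' : Finset ℕ) (y : ℕ → 𝓜(ℂ, B)) (h : s ⊆ s') :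
    (∑ n ∈ s, t n * star (t n)) * ∑ n ∈ s', t n * y n = ∑ n ∈ s, t n * y n := by
  rw [Finset.sum_mul]
  exact Finset.sum_congr rfl fun n hn => by rw [mul_assoc, ht.star_mul_sum s' y (h hn)]

/-- The strict sum `∑ₙ tₙ yₙ` exists if `∑ₙ yₙ* yₙ` is bounded and strictly Cauchy. -/
theorem exists_column (ht : β.IsCuntzFamily t) (y : ℕ → 𝓜(ℂ, B)) {C : ℝ} (hC : 0 ≤ C)
    (h₁ : ∀ N, ‖∑ n ∈ Finset.range N, star (y n) * y n‖ ≤ C ^ 2)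
    (h₂ : ∀ b, CauchySeq fun N => (∑ n ∈ Finset.range N, star (y n) * y n) * incl B b) :
    ∃ s : 𝓜(ℂ, B), HasStrictSum (fun n => t n * y n) s ∧ ∀ n, star (t n) * s = y n := by
  have hS : ∀ N, ‖∑ n ∈ Finset.range N, t n * y n‖ ≤ C := fun N => by
    have := h₁ N
    rw [← star_sum_mul_sum ht.star_mul_self ht.orthogonal, CStarRing.norm_star_mul_self,
      ← sq] at this
    exact abs_le_of_sq_le_sq' this hC |>.2
  have hsub : ∀ (x : ℕ → 𝓜(ℂ, B)) {N M : ℕ}, N ≤ M →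
      ∑ n ∈ Finset.range M, x n - ∑ n ∈ Finset.range N, x n = ∑ n ∈ Finset.Ico N M, x n :=
    fun x N M h => (Finset.sum_Ico_eq_sub x h).symm
  obtain ⟨s, hs⟩ := exists_strict_limit (f := fun N => ∑ n ∈ Finset.range N, t n * y n)
    (fun b => by
      -- A block `S` of the sum satisfies `‖S b‖² ≤ ‖b‖ ‖S* S b‖`, and `S* S` is a block of `∑ yₙ*
      -- yₙ`.
      refine cauchySeq_of_modulus (h₂ b) fun ε hε =>
        ⟨ε ^ 2 / (‖b‖ + 1), by positivity, fun N M hNM hlt => ?_⟩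
      rw [← sub_mul, hsub _ hNM] at hlt ⊢
      refine lt_of_pow_lt_pow_left₀ 2 hε.le ?_
      rw [sq, ← CStarRing.norm_star_mul_self, star_mul, mul_assoc,
        ← mul_assoc (star (∑ n ∈ _, _)), star_sum_mul_sum ht.star_mul_self ht.orthogonal]
      calc ‖star (incl B b) * ((∑ n ∈ Finset.Ico N M, star (y n) * y n) * incl B b)‖
          ≤ ‖star (incl B b)‖ * ‖(∑ n ∈ Finset.Ico N M, star (y n) * y n) * incl B b‖ :=
            norm_mul_le _ _
        _ ≤ (‖b‖ + 1) * ‖(∑ n ∈ Finset.Ico N M, star (y n) * y n) * incl B b‖ := by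
            rw [norm_star, norm_incl]; gcongr; linarith
        _ < (‖b‖ + 1) * (ε ^ 2 / (‖b‖ + 1)) := by gcongr
        _ = ε ^ 2 := by field_simp)
    (fun b => by
      -- With partial sums `S_N` and `P_N = ∑ tₙ tₙ*`, one has `S_N = P_N S_M`, hence `b S_M - b S_N
      -- = (b P_M - b P_N) S_M`.
      refine cauchySeq_of_norm_sub_le (ht.tendsto_mul_proj b).cauchySeq C hC fun N M hNM => ?_
      rw [← mul_sub, ← ht.proj_mul_sum (Finset.range N) (Finset.range M) y
        (Finset.range_mono hNM)]
      have : (∑ n ∈ Finset.range M, t n * y n) = (∑ n ∈ Finset.range M, t n * star (t n)) *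
          ∑ n ∈ Finset.range M, t n * y n := (ht.proj_mul_sum _ _ y subset_rfl).symm
      conv_lhs => enter [1, 2, 1]; rw [this]
      rw [← sub_mul, ← mul_assoc, mul_sub, mul_comm C]
      exact (norm_mul_le _ _).trans (by gcongr; exact hS M))
  refine ⟨s, hs, fun n => strict_limit_mul_left hs ?_⟩
  filter_upwards [eventually_gt_atTop n] with N hN
  exact ht.star_mul_sum _ y (Finset.mem_range.mpr hN)

/-- If `tₙ* s = yₙ` and `∑ₙ yₙ* yₙ = 1` strictly, then `s` is an isometry. -/
theorem isometry_of_column (ht : β.IsCuntzFamily t)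
    {s : 𝓜(ℂ, B)} {y : ℕ → 𝓜(ℂ, B)} (hs : ∀ n, star (t n) * s = y n)
    (h : ∀ b, Tendsto (fun N => (∑ n ∈ Finset.range N, star (y n) * y n) * incl B b) atTop
      (𝓝 (incl B b))) : star s * s = 1 := by
  refine multiplier_ext_incl fun b => ?_
  rw [one_mul, mul_assoc, mul_incl s]
  refine tendsto_nhds_unique ((ht.tendsto_proj_mul (s.fst b)).const_mul (star s)) ?_
  refine (h b).congr fun N => ?_
  have : star s * (∑ n ∈ Finset.range N, t n * star (t n)) * s =
      ∑ n ∈ Finset.range N, star (y n) * y n := by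
    rw [Finset.mul_sum, Finset.sum_mul]
    refine Finset.sum_congr rfl fun n _ => ?_
    rw [← mul_assoc, mul_assoc, hs, ← hs n, star_mul, star_star]
  rw [← mul_incl, ← mul_assoc, ← mul_assoc, this]

/-- Block-diagonal strict sums `∑ₙ tₙ xₙ tₙ*` of bounded sequences. -/
theorem exists_diag (ht : β.IsCuntzFamily t)
    (x : ℕ → 𝓜(ℂ, B)) {C : ℝ} (hC : 0 ≤ C) (hx : ∀ n, ‖x n‖ ≤ C) :
    ∃ s : 𝓜(ℂ, B), HasStrictSum (fun n => t n * x n * star (t n)) s ∧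
      (∀ n, star (t n) * s = x n * star (t n)) ∧ ∀ n, s * t n = t n * x n := by
  have hS := fun N => norm_sum_diag_le ht.star_mul_self ht.orthogonal (Finset.range N) hC hx
  have hE : ∀ s : Finset ℕ, ∑ n ∈ s, star (x n * star (t n)) * (x n * star (t n)) =
      star (∑ n ∈ s, t n * x n * star (t n)) * ∑ n ∈ s, t n * x n * star (t n) := fun s => by
    simp_rw [mul_assoc (t _)]
    rw [star_sum_mul_sum ht.star_mul_self ht.orthogonal]
  obtain ⟨s, hs, hs'⟩ := ht.exists_column (fun n => x n * star (t n)) hC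
    (fun N => by
      rw [hE, CStarRing.norm_star_mul_self, ← sq]
      have := hS N
      gcongr)
    (fun b => by
      refine cauchySeq_of_norm_sub_le (ht.tendsto_proj_mul b).cauchySeq (C ^ 2) (by positivity)
        fun N M hNM => ?_
      rw [← sub_mul, ← sub_mul, ← Finset.sum_Ico_eq_sub _ hNM, ← Finset.sum_Ico_eq_sub _ hNM]
      -- A block absorbs the matching block of `∑ tₙ tₙ*` on its right, so it inherits the strict
      -- Cauchy property from that sum.
      have h₁ : ∑ n ∈ Finset.Ico N M, star (x n * star (t n)) * (x n * star (t n)) =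
          (∑ n ∈ Finset.Ico N M, star (x n * star (t n)) * (x n * star (t n))) *
            ∑ n ∈ Finset.Ico N M, t n * star (t n) := by
        rw [Finset.sum_mul]
        refine Finset.sum_congr rfl fun n hn => ?_
        rw [mul_assoc, mul_assoc, ht.star_mul_sum _ _ hn]
      rw [h₁, mul_assoc]
      refine (norm_mul_le _ _).trans ?_
      gcongr
      rw [hE, CStarRing.norm_star_mul_self, ← sq]
      have := norm_sum_diag_le ht.star_mul_self ht.orthogonal (Finset.Ico N M) hC hx
      gcongr)
  refine ⟨s, ?_, hs', fun n => ht.ext_left fun m => ?_⟩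
  · simpa only [mul_assoc] using hs
  · rw [← mul_assoc, hs', mul_assoc]
    rcases eq_or_ne m n with rfl | h
    · rw [ht.star_mul_self, mul_one, ht.star_mul_self_assoc]
    · rw [ht.orthogonal m n h, mul_zero, ht.orthogonal_assoc h]

/-- The unilateral shift `tₙ ↦ tₙ₊₁`. -/
theorem exists_shift (ht : β.IsCuntzFamily t) : ∃ s : 𝓜(ℂ, B), star s * s = 1 ∧ star (t 0) * s = 0 ∧
    s * star s + t 0 * star (t 0) = 1 ∧ (∀ n, s * t n = t (n + 1)) ∧ ∀ g, β.mult g s = s := by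
  -- These are the coordinates `tₙ* s` of the shift: `0` for `n = 0`, and `tₘ*` for `n = m + 1`.
  let y : ℕ → 𝓜(ℂ, B) := fun n => Nat.casesOn n 0 fun m => star (t m)
  have hy : ∀ N, ∑ n ∈ Finset.range (N + 1), star (y n) * y n =
      ∑ n ∈ Finset.range N, t n * star (t n) := fun N => by
    rw [Finset.sum_range_succ']
    simp [y]
  have hlim : ∀ b, Tendsto (fun N => (∑ n ∈ Finset.range N, star (y n) * y n) * incl B b) atTop
      (𝓝 (incl B b)) := fun b => by
    rw [← tendsto_add_atTop_iff_nat 1]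
    simp_rw [hy]
    exact ht.tendsto_proj_mul b
  obtain ⟨s, -, hs⟩ := ht.exists_column y zero_le_one
    (fun N => by
      rcases N with _ | N
      · simp
      · rw [hy, one_pow]
        exact norm_sum_range_proj_le ht.star_mul_self ht.orthogonal _)
    (fun b => (hlim b).cauchySeq)
  have h0 : star (t 0) * s = 0 := hs 0
  have hsucc : ∀ n, star (t (n + 1)) * s = star (t n) := fun n => hs (n + 1)
  have hstar0 : star s * t 0 = 0 := by simpa using congrArg star h0
  have hstar : ∀ n, star s * t (n + 1) = t n := fun n => by simpa using congrArg star (hsucc n)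
  have hshift : ∀ n, s * t n = t (n + 1) := fun n => ht.ext_left fun m => by
    rw [← mul_assoc]
    rcases m with _ | m
    · rw [h0, zero_mul, ht.orthogonal 0 (n + 1) (by simp)]
    · rw [hsucc]
      rcases eq_or_ne m n with rfl | h
      · rw [ht.star_mul_self, ht.star_mul_self]
      · rw [ht.orthogonal m n h, ht.orthogonal _ _ (by simpa using h)]
  refine ⟨s, ht.isometry_of_column hs hlim, h0, ?_, hshift, fun g => ?_⟩
  · refine ht.ext_right fun n => ?_
    rw [add_mul, one_mul, mul_assoc, mul_assoc]
    rcases n with _ | n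
    · rw [hstar0, ht.star_mul_self]; simp
    · rw [hstar, hshift, ht.orthogonal 0 (n + 1) (by simp)]; simp
  · refine ht.ext_left fun n => ?_
    conv_lhs => rw [← ht.fixed n g]
    rw [← map_star, ← map_mul, hs]
    rcases n with _ | n
    · exact map_zero _
    · change β.mult g (star (t n)) = star (t n)
      rw [map_star, ht.fixed]

end CStarAction.IsCuntzFamily

/-! ### Countable sums of cocycle representations -/

section CountableSum

variable {G A B : Type*} [Group G] [TopologicalSpace G]
  [NonUnitalCStarAlgebra A] [NonUnitalCStarAlgebra B]
  {α : CStarAction G A} {β : CStarAction G B}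

theorem continuous_toStrict_iff_incl {X : Type*} [TopologicalSpace X] {f : X → 𝓜(ℂ, B)} :
    (Continuous fun x => toStrict (f x)) ↔
      (∀ b, Continuous fun x => f x * incl B b) ∧ ∀ b, Continuous fun x => incl B b * f x := by
  rw [continuous_toStrict_iff]
  simp_rw [mul_incl, incl_mul, (isometry_incl (B := B)).isEmbedding.continuous_iff]
  rfl

theorem CocycleRep.norm_coc_le (Φ : CocycleRep α β) (g : G) : ‖(Φ.coc g : 𝓜(ℂ, B))‖ ≤ 1 :=
  norm_unitary_le_one _

theorem CocycleRep.norm_hom_le (Φ : CocycleRep α β) (a : A) : ‖Φ.hom a‖ ≤ ‖a‖ :=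
  NonUnitalStarAlgHom.norm_apply_le Φ.hom a

/-- The cocycle representation `Ψ` restricts along the isometry `t` to `Φ`. -/
structure CocycleRep.Intertwines (t : 𝓜(ℂ, B)) (Φ Ψ : CocycleRep α β) : Prop where
  hom : ∀ a, Ψ.hom a * t = t * Φ.hom a
  coc : ∀ g, (Ψ.coc g : 𝓜(ℂ, B)) * t = t * Φ.coc g

/-- Algebraic identities reduce, after right multiplication by `tₙ`, to those of `Φₙ`. Strict
continuity of the cocycle survives because its truncations converge on each `b` uniformly in `g`:
the error is at most that of `∑ tₙ tₙ*` on `b`. -/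
theorem CocycleRep.exists_isCountableSum {t : ℕ → 𝓜(ℂ, B)} (ht : β.IsCuntzFamily t)
    (Φ : ℕ → CocycleRep α β) :
    ∃ Ψ, CocycleRep.IsCountableSum t Φ Ψ ∧ ∀ n, CocycleRep.Intertwines (t n) (Φ n) Ψ := by
  choose φ hφ hφ₁ hφ₂ using fun a => ht.exists_diag (fun n => (Φ n).hom a) (norm_nonneg a)
    (fun n => (Φ n).norm_hom_le a)
  choose u hu hu₁ hu₂ using fun g => ht.exists_diag (fun n => ((Φ n).coc g : 𝓜(ℂ, B)))
    zero_le_one (fun n => (Φ n).norm_coc_le g)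
  have hφs : ∀ a n, star (φ a) * t n = t n * star ((Φ n).hom a) := fun a n => by
    simpa using congrArg star (hφ₁ a n)
  have hus : ∀ g n, star (u g) * t n = t n * star ((Φ n).coc g : 𝓜(ℂ, B)) := fun g n => by
    simpa using congrArg star (hu₁ g n)
  have hβ : ∀ g n x y, x * t n = t n * y → β.mult g x * t n = t n * β.mult g y := by
    intro g n x y h
    have := congrArg (β.mult g) h
    rwa [map_mul, map_mul, ht.fixed] at this
  let v : G → unitary 𝓜(ℂ, B) := fun g => ⟨u g, by
    rw [Unitary.mem_iff]
    constructor <;> refine ht.ext_right fun n => ?_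
    · rw [mul_assoc, hu₂, ← mul_assoc, hus, mul_assoc, Unitary.coe_star_mul_self]; simp
    · rw [mul_assoc, hus, ← mul_assoc, hu₂, mul_assoc,
        Unitary.mul_star_self_of_mem (SetLike.coe_mem _)]; simp⟩
  let Ψ : CocycleRep α β :=
    { hom :=
        { toFun := φ
          map_smul' := fun c a => ht.ext_right fun n => by
            rw [hφ₂, map_smul, mul_smul_comm, MonoidHom.id_apply, smul_mul_assoc, hφ₂]
          map_zero' := ht.ext_right fun n => by rw [hφ₂]; simp
          map_add' := fun a b => ht.ext_right fun n => by
            rw [hφ₂, map_add, mul_add, add_mul, hφ₂, hφ₂]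
          map_mul' := fun a b => ht.ext_right fun n => by
            rw [hφ₂, map_mul, mul_assoc, hφ₂, ← mul_assoc, ← mul_assoc, hφ₂]
          map_star' := fun a => ht.ext_right fun n => by
            rw [hφ₂, hφs, map_star] }
      coc := v
      continuous_coc := by
        rw [continuous_toStrict_iff_incl]
        constructor
        · intro b
          have hunif : TendstoUniformly
              (fun N g => u g * (∑ n ∈ Finset.range N, t n * star (t n)) * incl B b)
              (fun g => u g * incl B b) atTop := by
            rw [Metric.tendstoUniformly_iff]
            intro ε hε
            filter_upwards [Metric.tendsto_nhds.mp (ht.tendsto_proj_mul b) ε hε] with N hN g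
            rw [dist_comm, dist_eq_norm] at hN ⊢
            rw [mul_assoc, ← mul_sub]
            refine lt_of_le_of_lt (norm_mul_le _ _) ?_
            exact lt_of_le_of_lt (mul_le_of_le_one_left (norm_nonneg _)
              (norm_unitary_le_one (v g))) (by rwa [norm_sub_rev])
          refine hunif.continuous (Frequently.of_forall fun N => ?_)
          simp_rw [Finset.mul_sum, Finset.sum_mul, ← mul_assoc, hu₂]
          refine continuous_finsetSum _ fun n _ => ?_
          have := (continuous_toStrict_iff_incl.mp (Φ n).continuous_coc).1 ((star (t n)).fst b)
          simp_rw [← mul_incl] at this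
          simpa only [mul_assoc] using this.const_mul (t n)
        · intro b
          have hunif : TendstoUniformly
              (fun N g => incl B b * (∑ n ∈ Finset.range N, t n * star (t n)) * u g)
              (fun g => incl B b * u g) atTop := by
            rw [Metric.tendstoUniformly_iff]
            intro ε hε
            filter_upwards [Metric.tendsto_nhds.mp (ht.tendsto_mul_proj b) ε hε] with N hN g
            rw [dist_comm, dist_eq_norm] at hN ⊢
            rw [← sub_mul]
            refine lt_of_le_of_lt (norm_mul_le _ _) ?_
            exact lt_of_le_of_lt (mul_le_of_le_one_right (norm_nonneg _)
              (norm_unitary_le_one (v g))) (by rwa [norm_sub_rev])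
          refine hunif.continuous (Frequently.of_forall fun N => ?_)
          simp_rw [Finset.mul_sum, Finset.sum_mul, mul_assoc, hu₁]
          refine continuous_finsetSum _ fun n _ => ?_
          have := (continuous_toStrict_iff_incl.mp (Φ n).continuous_coc).2 ((t n).snd b)
          simp_rw [← incl_mul] at this
          simpa only [mul_assoc] using this.mul_const (star (t n))
      coc_mul := fun g h => ht.ext_right fun n => by
        change u (g * h) * t n = u g * β.mult g (u h) * t n
        rw [hu₂, (Φ n).coc_mul, mul_assoc, hβ g n _ _ (hu₂ h n), ← mul_assoc, ← mul_assoc, hu₂]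
      equivariant := fun g a => ht.ext_right fun n => by
        change u g * β.mult g (φ a) * star (u g) * t n = φ (α.toHom g a) * t n
        rw [hφ₂, ← (Φ n).equivariant, mul_assoc, hus, mul_assoc (u g),
          ← mul_assoc (β.mult g (φ a)), hβ g n _ _ (hφ₂ a n), ← mul_assoc, ← mul_assoc, hu₂]
        simp only [mul_assoc] }
  exact ⟨Ψ, ⟨hφ, hu⟩, fun n => ⟨fun a => hφ₂ a n, fun g => hu₂ g n⟩⟩

end CountableSum

/-! ### Averaging almost orthogonal elements -/

section Averaging

variable {M : Type*} [CStarAlgebra M]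

/-- In `(∑ yⱼ)* (∑ yₖ)` the `N` diagonal terms cost `C²` each and the off-diagonal ones at most `N²
δ` together; then divide by `N²`. -/
theorem norm_average_sq_le {y : ℕ → M} {C δ : ℝ} {N : ℕ} (hN : 0 < N) (hδ : 0 ≤ δ)
    (hy : ∀ k, ‖y k‖ ≤ C) (h : ∀ j k, j < k → ‖star (y j) * y k‖ ≤ δ) :
    ‖∑ k ∈ Finset.range N, (N : ℝ)⁻¹ • y k‖ ^ 2 ≤ C ^ 2 / N + δ := by
  have hoff : ∀ j k, j ≠ k → ‖star (y j) * y k‖ ≤ δ := fun j k hjk => by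
    rcases lt_or_gt_of_ne hjk with hlt | hlt
    · exact h j k hlt
    · rw [← norm_star, star_mul, star_star]; exact h k j hlt
  have hall : ∀ j k, ‖star (y j) * y k‖ ≤ (if j = k then C ^ 2 else 0) + δ := fun j k => by
    split_ifs with hjk
    · subst hjk
      rw [CStarRing.norm_star_mul_self, ← sq]
      have := hy j
      have : ‖y j‖ ^ 2 ≤ C ^ 2 := by gcongr
      linarith
    · linarith [hoff j k hjk]
  have hN' : (0 : ℝ) < N := by exact_mod_cast hN
  rw [← Finset.smul_sum, norm_smul, mul_pow, norm_inv, Real.norm_natCast]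
  have key : ‖∑ k ∈ Finset.range N, y k‖ ^ 2 ≤ N * C ^ 2 + N ^ 2 * δ := by
    rw [sq, ← CStarRing.norm_star_mul_self, star_sum, Finset.sum_mul_sum]
    calc ‖∑ j ∈ Finset.range N, ∑ k ∈ Finset.range N, star (y j) * y k‖
        ≤ ∑ j ∈ Finset.range N, ∑ k ∈ Finset.range N, ((if j = k then C ^ 2 else 0) + δ) :=
          norm_sum_le_of_le _ fun j _ => norm_sum_le_of_le _ fun k _ => hall j k
      _ = N * C ^ 2 + N ^ 2 * δ := by
          have : ∀ j ∈ Finset.range N,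
              ∑ k ∈ Finset.range N, ((if j = k then C ^ 2 else 0) + δ) = C ^ 2 + N * δ := by
            intro j hj
            rw [Finset.sum_add_distrib, Finset.sum_ite_eq, if_pos hj]
            simp
          rw [Finset.sum_congr rfl this]
          simp
          ring
  calc ((N : ℝ)⁻¹) ^ 2 * ‖∑ k ∈ Finset.range N, y k‖ ^ 2
      ≤ ((N : ℝ)⁻¹) ^ 2 * (N * C ^ 2 + N ^ 2 * δ) := by gcongr
    _ = C ^ 2 / N + δ := by field_simp

/-- A family of linear maps that is asymptotically orthogonal along a filter becomes uniformly small
on suitable convex combinations. -/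
theorem exists_mem_forall_norm_le {E I : Type*} [NormedAddCommGroup E] [NormedSpace ℝ E]
    {l : Filter E} [l.NeBot] (D : I → E →ₗ[ℝ] M) {C : ℝ}
    (hD : ∀ᶠ e in l, ∀ i, ‖D i e‖ ≤ C)
    (horth : ∀ᶠ e₀ in l, ∀ δ > 0, ∀ᶠ e in l, ∀ i, ‖star (D i e₀) * D i e‖ ≤ δ)
    {S : Set E} (hS : S ∈ l) (hconv : Convex ℝ S) {ε : ℝ} (hε : 0 < ε) :
    ∃ e ∈ S, ∀ i, ‖D i e‖ ≤ ε := by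
  -- With this `N` the diagonal terms contribute at most `ε²/2` to the squared norm. The points are
  -- then chosen greedily, each almost orthogonal to its predecessors under every `D i`, which
  -- leaves `ε²/2` for the off-diagonal terms.
  obtain ⟨N, hN⟩ := exists_nat_gt (C ^ 2 / (ε ^ 2 / 2))
  have hN₀ : (0 : ℝ) < N := lt_of_le_of_lt (by positivity) hN
  obtain ⟨f, hf, hff⟩ := exists_seq_of_forall_finset_exists
    (fun e => e ∈ S ∧ (∀ i, ‖D i e‖ ≤ C) ∧
      ∀ δ > 0, ∀ᶠ e' in l, ∀ i, ‖star (D i e) * D i e'‖ ≤ δ)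
    (fun e e' => ∀ i, ‖star (D i e) * D i e'‖ ≤ ε ^ 2 / 2) (fun s hs => by
      have h₁ : ∀ᶠ e in l, ∀ x ∈ s, ∀ i, ‖star (D i x) * D i e‖ ≤ ε ^ 2 / 2 :=
        (Filter.eventually_all_finset s).mpr fun x hx => (hs x hx).2.2 _ (by positivity)
      have hS' : ∀ᶠ e in l, e ∈ S := hS
      obtain ⟨e, he₁, he₂, he₃, he₄⟩ := (hS'.and (hD.and (horth.and h₁))).exists
      exact ⟨e, ⟨he₁, he₂, he₃⟩, he₄⟩)
  refine ⟨∑ k ∈ Finset.range N, (N : ℝ)⁻¹ • f k, ?_, fun i => ?_⟩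
  · refine hconv.sum_mem (fun _ _ => by positivity) ?_ fun k _ => (hf k).1
    simp [hN₀.ne']
  · rw [map_sum]
    simp_rw [map_smul]
    have h₁ := norm_average_sq_le (y := fun k => D i (f k)) (C := C) (δ := ε ^ 2 / 2)
      (N := N) (by exact_mod_cast hN₀) (by positivity) (fun k => (hf k).2.1 i)
      (fun j k hjk => hff j k hjk i)
    have h₂ : C ^ 2 / N ≤ ε ^ 2 / 2 := by
      rw [div_lt_iff₀ (by positivity)] at hN
      rw [div_le_iff₀ hN₀]
      linarith
    exact abs_le_of_sq_le_sq' (h₁.trans (by linarith)) hε.le |>.2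

end Averaging

/-! ### Square roots and approximate intertwining -/

section SquareRoot

/-- For monomials `dⁿ x - x d'ⁿ` telescopes into `n` terms, each containing the factor `d x - x d'`.
The constant depends on `p` alone. -/
theorem exists_polynomial_intertwining_bound {M : Type*} [CStarAlgebra M] (p : Polynomial ℝ) :
    ∃ L : ℝ, 0 ≤ L ∧ ∀ d d' x : M, ‖d‖ ≤ 1 → ‖d'‖ ≤ 1 →
      ‖Polynomial.aeval d p * x - x * Polynomial.aeval d' p‖ ≤ L * ‖d * x - x * d'‖ := by
  induction p using Polynomial.induction_on' with
  | add p q hp hq =>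
    obtain ⟨L, hL, h⟩ := hp
    obtain ⟨L', hL', h'⟩ := hq
    refine ⟨L + L', by positivity, fun d d' x hd hd' => ?_⟩
    have : Polynomial.aeval d (p + q) * x - x * Polynomial.aeval d' (p + q) =
        (Polynomial.aeval d p * x - x * Polynomial.aeval d' p) +
          (Polynomial.aeval d q * x - x * Polynomial.aeval d' q) := by
      simp only [map_add]; noncomm_ring
    rw [this, add_mul]
    exact (norm_add_le _ _).trans (add_le_add (h d d' x hd hd') (h' d d' x hd hd'))
  | monomial n a =>
    refine ⟨‖a‖ * n, by positivity, fun d d' x hd hd' => ?_⟩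
    have key : ∀ n : ℕ, ‖d ^ n * x - x * d' ^ n‖ ≤ n * ‖d * x - x * d'‖ := by
      intro n
      induction n with
      | zero => simp
      | succ n ih =>
        have h₁ : d ^ (n + 1) * x - x * d' ^ (n + 1) =
            d * (d ^ n * x - x * d' ^ n) + (d * x - x * d') * d' ^ n := by
          rw [pow_succ', pow_succ']; noncomm_ring
        have h₂ : ‖(d * x - x * d') * d' ^ n‖ ≤ ‖d * x - x * d'‖ := by
          rcases n with _ | n
          · simp
          · refine (norm_mul_le _ _).trans (mul_le_of_le_one_right (norm_nonneg _) ?_)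
            exact (norm_pow_le' d' n.succ_pos).trans (pow_le_one₀ (norm_nonneg _) hd')
        rw [h₁]
        refine (norm_add_le _ _).trans ?_
        push_cast
        have h₃ : ‖d * (d ^ n * x - x * d' ^ n)‖ ≤ n * ‖d * x - x * d'‖ :=
          (norm_mul_le _ _).trans ((mul_le_of_le_one_left (norm_nonneg _) hd).trans ih)
        linarith
    have h₁ : Polynomial.aeval d (Polynomial.monomial n a) * x -
        x * Polynomial.aeval d' (Polynomial.monomial n a) = a • (d ^ n * x - x * d' ^ n) := by
      rw [Polynomial.aeval_monomial, Polynomial.aeval_monomial, smul_sub,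
        Algebra.algebraMap_eq_smul_one, smul_mul_assoc, smul_mul_assoc, one_mul, smul_mul_assoc,
        one_mul, mul_smul_comm]
    rw [h₁, norm_smul, mul_assoc]
    exact mul_le_mul_of_nonneg_left (key n) (norm_nonneg _)

/-- Positive contractions approximately intertwine as soon as their squares do. -/
theorem exists_sqrt_intertwining_delta {M : Type*} [CStarAlgebra M] [PartialOrder M]
    [StarOrderedRing M] (C : ℝ) {ε : ℝ} (hC : 0 ≤ C) (hε : 0 < ε) :
    ∃ δ > 0, ∀ f f' x : M, 0 ≤ f → 0 ≤ f' → ‖f‖ ≤ 1 → ‖f'‖ ≤ 1 → ‖x‖ ≤ C →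
      ‖f * f * x - x * (f' * f')‖ ≤ δ → ‖f * x - x * f'‖ ≤ ε := by
  -- With `p` within `η` of the square root on `[0, 1]`, replacing `f = √(f²)` by `p(f²)`, and
  -- likewise for `f'`, costs at most `ε/4` each; the polynomial estimate gets the other `ε/2`.
  set η := ε / (4 * (C + 1)) with hη
  have hη₀ : 0 < η := by positivity
  obtain ⟨p, hp⟩ := exists_polynomial_near_of_continuousOn 0 1 Real.sqrt
    Real.continuous_sqrt.continuousOn η hη₀
  obtain ⟨L, hL, hLp⟩ := exists_polynomial_intertwining_bound (M := M) p
  have happrox : ∀ f : M, 0 ≤ f → ‖f‖ ≤ 1 → ‖f - Polynomial.aeval (f * f) p‖ ≤ η := by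
    intro f hf hf₁
    have hsa : IsSelfAdjoint f := .of_nonneg hf
    have h₁ : f - Polynomial.aeval (f * f) p =
        cfc (fun t : ℝ => (Polynomial.X - p.comp (Polynomial.X ^ 2) : Polynomial ℝ).eval t) f := by
      rw [cfc_polynomial (Polynomial.X - p.comp (Polynomial.X ^ 2)) f hsa]
      simp [Polynomial.aeval_comp, sq]
    rw [h₁]
    refine norm_cfc_le hη₀.le fun t ht => ?_
    have ht₀ : 0 ≤ t := spectrum_nonneg_of_nonneg hf ht
    have ht₁ : t ≤ 1 := by
      obtain _ | _ := subsingleton_or_nontrivial M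
      · simp [spectrum.of_subsingleton] at ht
      · exact ((le_abs_self t).trans (spectrum.norm_le_norm_of_mem ht)).trans hf₁
    have := hp (t ^ 2) ⟨by positivity, by nlinarith⟩
    rw [Real.sqrt_sq ht₀, abs_sub_comm] at this
    simpa using this.le
  refine ⟨ε / (2 * (L + 1)), by positivity, fun f f' x hf hf' hf₁ hf₁' hx h => ?_⟩
  have hsq : ∀ f : M, ‖f‖ ≤ 1 → ‖f * f‖ ≤ 1 := fun f hf =>
    (norm_mul_le _ _).trans (mul_le_one₀ hf (norm_nonneg _) hf)
  have h₁ : f * x - x * f' = (f - Polynomial.aeval (f * f) p) * x +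
      (Polynomial.aeval (f * f) p * x - x * Polynomial.aeval (f' * f') p) -
      x * (f' - Polynomial.aeval (f' * f') p) := by noncomm_ring
  have h₂ : ‖(f - Polynomial.aeval (f * f) p) * x‖ ≤ η * C :=
    (norm_mul_le _ _).trans (mul_le_mul (happrox f hf hf₁) hx (norm_nonneg _) hη₀.le)
  have h₃ : ‖x * (f' - Polynomial.aeval (f' * f') p)‖ ≤ C * η :=
    (norm_mul_le _ _).trans (mul_le_mul hx (happrox f' hf' hf₁') (norm_nonneg _) hC)
  have h₄ : ‖Polynomial.aeval (f * f) p * x - x * Polynomial.aeval (f' * f') p‖ ≤ ε / 2 := by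
    refine (hLp _ _ _ (hsq f hf₁) (hsq f' hf₁')).trans ?_
    calc L * ‖f * f * x - x * (f' * f')‖ ≤ L * (ε / (2 * (L + 1))) := by gcongr
      _ ≤ (L + 1) * (ε / (2 * (L + 1))) := by gcongr; linarith
      _ = ε / 2 := by field_simp
  have h₅ : η * C ≤ ε / 4 := by
    calc η * C ≤ η * (C + 1) := by gcongr; linarith
      _ = ε / 4 := by rw [hη]; field_simp
  rw [h₁]
  refine (norm_sub_le _ _).trans ?_
  have := norm_add_le ((f - Polynomial.aeval (f * f) p) * x)
    (Polynomial.aeval (f * f) p * x - x * Polynomial.aeval (f' * f') p)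
  linarith

end SquareRoot

/-! ### Uniformity on compact sets -/

/-- Uniformly Lipschitz maps that converge pointwise converge uniformly on compact sets, by a finite
net. -/
theorem eventually_forall_mem_norm_lt_of_compact {ι E F : Type*} [NormedAddCommGroup E]
    [NormedAddCommGroup F] {l : Filter ι} (f : ι → E → F) (C : ℝ) (hC : 0 ≤ C)
    (hsub : ∀ i x y, f i (x - y) = f i x - f i y) (hf : ∀ᶠ i in l, ∀ x, ‖f i x‖ ≤ C * ‖x‖)
    {K : Set E} (hK : IsCompact K) (h : ∀ x, Tendsto (fun i => f i x) l (𝓝 0)) {ε : ℝ}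
    (hε : 0 < ε) : ∀ᶠ i in l, ∀ x ∈ K, ‖f i x‖ < ε := by
  obtain ⟨s, -, hs, hcov⟩ := hK.finite_cover_balls (e := ε / (2 * (C + 1))) (by positivity)
  have h₁ : ∀ᶠ i in l, ∀ x ∈ s, ‖f i x‖ < ε / 2 := by
    rw [Filter.eventually_all_finite hs]
    intro x _
    have := (h x).norm
    rw [norm_zero] at this
    exact this.eventually_lt_const (by positivity)
  filter_upwards [h₁, hf] with i hi hfi x hx
  obtain ⟨y, hy, hxy⟩ := Set.mem_iUnion₂.mp (hcov hx)
  rw [Metric.mem_ball, dist_eq_norm] at hxy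
  have h₂ : ‖f i (x - y)‖ ≤ ε / 2 := by
    refine (hfi _).trans ?_
    calc C * ‖x - y‖ ≤ (C + 1) * (ε / (2 * (C + 1))) := by gcongr; linarith
      _ = ε / 2 := by field_simp
  calc ‖f i x‖ = ‖f i (x - y) + f i y‖ := by rw [hsub]; congr 1; abel
    _ ≤ ‖f i (x - y)‖ + ‖f i y‖ := norm_add_le _ _
    _ < ε := by linarith [hi y hy]

/-! ### Quasicentral approximate units -/

section Quasicentral

theorem continuous_clm_apply_of_norm_le {X E F : Type*} [TopologicalSpace X]
    [NormedAddCommGroup E] [NormedSpace ℂ E] [NormedAddCommGroup F] [NormedSpace ℂ F]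
    {T : X → E →L[ℂ] F} {b : X → E} (hT : ∀ x, ‖T x‖ ≤ 1) (hT' : ∀ c, Continuous fun x => T x c)
    (hb : Continuous b) : Continuous fun x => T x (b x) := by
  rw [continuous_iff_continuousAt]
  intro x₀
  rw [ContinuousAt, tendsto_iff_norm_sub_tendsto_zero]
  have h₁ : Tendsto (fun x => ‖b x - b x₀‖ + ‖T x (b x₀) - T x₀ (b x₀)‖) (𝓝 x₀) (𝓝 0) := by
    have := (tendsto_iff_norm_sub_tendsto_zero.mp (hb.tendsto x₀)).add
      (tendsto_iff_norm_sub_tendsto_zero.mp ((hT' (b x₀)).tendsto x₀))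
    simpa using this
  refine squeeze_zero (fun _ => norm_nonneg _) (fun x => ?_) h₁
  calc ‖T x (b x) - T x₀ (b x₀)‖ = ‖T x (b x - b x₀) + (T x (b x₀) - T x₀ (b x₀))‖ := by
        rw [map_sub]; congr 1; abel
    _ ≤ ‖T x (b x - b x₀)‖ + ‖T x (b x₀) - T x₀ (b x₀)‖ := norm_add_le _ _
    _ ≤ _ := by
        gcongr
        exact ((T x).le_opNorm _).trans (mul_le_of_le_one_left (norm_nonneg _) (hT x))

variable {G A B : Type*} [Group G] [TopologicalSpace G]
  [NonUnitalCStarAlgebra A] [NonUnitalCStarAlgebra B]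
  {α : CStarAction G A} {β : CStarAction G B}

theorem CocycleRep.continuous_coc_fst (Φ : CocycleRep α β) {b : G → B} (hb : Continuous b) :
    Continuous fun g => (Φ.coc g : 𝓜(ℂ, B)).fst (b g) :=
  continuous_clm_apply_of_norm_le
    (fun g => (DoubleCentralizer.norm_fst _).trans_le (Φ.norm_coc_le g))
    (continuous_toStrict_iff.mp Φ.continuous_coc).1 hb

theorem CocycleRep.continuous_coc_snd (Φ : CocycleRep α β) {b : G → B} (hb : Continuous b) :
    Continuous fun g => (Φ.coc g : 𝓜(ℂ, B)).snd (b g) :=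
  continuous_clm_apply_of_norm_le
    (fun g => (DoubleCentralizer.norm_snd _).trans_le (Φ.norm_coc_le g))
    (continuous_toStrict_iff.mp Φ.continuous_coc).2 hb

/-- The map `e ↦ e x - x κ(e)` measuring the failure of `x` to intertwine `κ(e)` and `e`. -/
def twistedCommutator (x : 𝓜(ℂ, B)) (κ : B ≃⋆ₐ[ℂ] B) : B →ₗ[ℝ] 𝓜(ℂ, B) where
  toFun e := incl B e * x - x * incl B (κ e)
  map_add' e e' := by simp only [map_add]; noncomm_ring
  map_smul' c e := by
    rw [← Complex.coe_smul c e, map_smul, map_smul, map_smul, smul_mul_assoc, mul_smul_comm,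
      ← smul_sub, RingHom.id_apply, Complex.coe_smul]

theorem twistedCommutator_apply (x : 𝓜(ℂ, B)) (κ : B ≃⋆ₐ[ℂ] B) (e : B) :
    twistedCommutator x κ e = incl B e * x - x * incl B (κ e) := rfl

theorem norm_twistedCommutator_le (x : 𝓜(ℂ, B)) (κ : B ≃⋆ₐ[ℂ] B) (e : B) :
    ‖twistedCommutator x κ e‖ ≤ 2 * ‖x‖ * ‖e‖ := by
  rw [twistedCommutator_apply]
  refine (norm_sub_le _ _).trans ?_
  have h₁ := norm_mul_le (incl B e) x
  have h₂ := norm_mul_le x (incl B (κ e))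
  rw [norm_incl] at h₁ h₂
  rw [StarAlgEquiv.norm_map κ] at h₂
  linarith

/-- With `d = D(e₀)* ∈ B`, one has `D(e₀)* D(e) = (d e - d) x - (d x κ(e) - d x)`, and `κ⁻¹`
preserves the norm of the second bracket. Both terms vanish as `e` runs through an approximate unit:
this is the asymptotic orthogonality needed for averaging. -/
theorem norm_star_twistedCommutator_mul_le (x : 𝓜(ℂ, B)) (κ : B ≃⋆ₐ[ℂ] B) (e₀ e : B) :
    ‖star (twistedCommutator x κ e₀) * twistedCommutator x κ e‖ ≤
      ‖star (x.snd e₀ - x.fst (κ e₀)) * e - star (x.snd e₀ - x.fst (κ e₀))‖ * ‖x‖ +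
      ‖κ.symm (x.snd (star (x.snd e₀ - x.fst (κ e₀)))) * e -
        κ.symm (x.snd (star (x.snd e₀ - x.fst (κ e₀))))‖ := by
  set d := star (x.snd e₀ - x.fst (κ e₀)) with hd
  have h₁ : star (twistedCommutator x κ e₀) = incl B d := by
    rw [twistedCommutator_apply, mul_incl, incl_mul, ← map_sub, ← map_star]
  have h₂ : star (twistedCommutator x κ e₀) * twistedCommutator x κ e =
      incl B (d * e - d) * x - incl B (x.snd d * κ e - x.snd d) := by
    rw [h₁, twistedCommutator_apply, mul_sub, ← mul_assoc, ← mul_assoc, incl_mul x d, map_sub,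
      map_sub, map_mul, map_mul, sub_mul, incl_mul x d]
    abel
  have h₃ : ‖x.snd d * κ e - x.snd d‖ = ‖κ.symm (x.snd d) * e - κ.symm (x.snd d)‖ := by
    rw [← StarAlgEquiv.norm_map κ (κ.symm (x.snd d) * e - κ.symm (x.snd d))]
    simp
  rw [h₂]
  refine (norm_sub_le _ _).trans ?_
  rw [norm_incl (x.snd d * κ e - x.snd d), h₃]
  gcongr
  refine (norm_mul_le _ _).trans_eq ?_
  rw [norm_incl]

variable [IsTopologicalGroup G]

/-- Commutators with members of the approximate unit are asymptotically orthogonal, so suitable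
averages have small commutators, uniformly over `X` and `K`. The other requirements define a convex
set and survive averaging. -/
theorem CocycleRep.exists_quasicentral_step [PartialOrder B] [StarOrderedRing B]
    (Ψ : CocycleRep α β) {e' : B}
    (he' : 0 ≤ e') (he₁ : ‖e'‖ < 1) (F : Finset B) (X : Finset 𝓜(ℂ, B)) {K : Set G}
    (hK : IsCompact K) {η ρ : ℝ} (hη : 0 < η) (hρ : 0 < ρ) :
    ∃ e, e' ≤ e ∧ ‖e‖ < 1 ∧ (∀ h ∈ F, ‖e * h - h‖ ≤ ρ) ∧
      (∀ x ∈ X, ‖incl B e * x - x * incl B e‖ ≤ η) ∧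
      ∀ g ∈ K, ‖incl B e * Ψ.coc g - Ψ.coc g * incl B (β.toHom g e)‖ ≤ η := by
  -- Only elements of norm `< 1` index the basis of the filter; staying in the open ball lets the
  -- chosen `e` be the lower bound of a further step.
  let l : Filter B := CStarAlgebra.approximateUnit B ⊓ 𝓟 (Metric.ball 0 1)
  have hbasis := CStarAlgebra.hasBasis_approximateUnit B
  have hne : l.NeBot := by
    refine (hbasis.inf_principal _).neBot_iff.mpr fun {a} ha => ?_
    exact ⟨a, ⟨le_rfl, by simpa using ha.2.le⟩, by simpa using ha.2⟩
  have hau := CStarAlgebra.increasingApproximateUnit B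
  have hball : ∀ᶠ e in l, ‖e‖ < 1 := by
    have : Metric.ball (0 : B) 1 ∈ l := mem_inf_of_right (mem_principal_self _)
    filter_upwards [this] with e he
    simpa using he
  have hge : ∀ᶠ e in l, e' ≤ e := by
    have h := hbasis.mem_of_mem (i := e') ⟨he', he₁⟩
    exact mem_inf_of_left (mem_of_superset h fun x hx => hx.1)
  have hF : ∀ᶠ e in l, ∀ h ∈ F, ‖e * h - h‖ ≤ ρ := by
    rw [Filter.eventually_all_finset]
    intro h _
    have := (hau.tendsto_mul_right h).mono_left (inf_le_left : l ≤ _)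
    rw [tendsto_iff_norm_sub_tendsto_zero] at this
    exact this.eventually_le_const hρ
  have hunit : ∀ b : B, Tendsto (fun e => b * e - b) l (𝓝 0) := fun b => by
    simpa using ((hau.tendsto_mul_left b).mono_left (inf_le_left : l ≤ _)).sub_const b
  obtain ⟨C, hC⟩ := (X.image norm).exists_le
  have hC' : ∀ x ∈ X, ‖x‖ ≤ |C| + 1 := fun x hx =>
    ((hC _ (Finset.mem_image_of_mem _ hx)).trans (le_abs_self C)).trans (by linarith)
  let D : X ⊕ K → B →ₗ[ℝ] 𝓜(ℂ, B) := Sum.elim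
    (fun x => twistedCommutator (x : 𝓜(ℂ, B)) (StarAlgEquiv.refl ..))
    fun g => twistedCommutator (Ψ.coc g : 𝓜(ℂ, B)) (β.toHom g)
  have hbound : ∀ᶠ e in l, ∀ i, ‖D i e‖ ≤ 2 * (|C| + 1) := by
    filter_upwards [hball] with e he
    have aux : ∀ (x : 𝓜(ℂ, B)) (κ : B ≃⋆ₐ[ℂ] B), ‖x‖ ≤ |C| + 1 →
        ‖twistedCommutator x κ e‖ ≤ 2 * (|C| + 1) := fun x κ hx => by
      refine (norm_twistedCommutator_le x κ e).trans ?_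
      calc 2 * ‖x‖ * ‖e‖ ≤ 2 * ‖x‖ * 1 := by gcongr
        _ ≤ 2 * (|C| + 1) := by linarith
    rintro (x | g)
    · exact aux _ _ (hC' x x.2)
    · exact aux _ _ ((Ψ.norm_coc_le g).trans (by linarith [abs_nonneg C]))
  have horth : ∀ᶠ e₀ in l, ∀ δ > 0, ∀ᶠ e in l, ∀ i, ‖star (D i e₀) * D i e‖ ≤ δ := by
    refine Eventually.of_forall fun e₀ δ hδ => ?_
    have hX : ∀ᶠ e in l, ∀ x ∈ X, ‖star (twistedCommutator x (StarAlgEquiv.refl ..) e₀) *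
        twistedCommutator x (StarAlgEquiv.refl ..) e‖ ≤ δ := by
      rw [Filter.eventually_all_finset]
      intro x _
      have h := ((hunit (star (x.snd e₀ - x.fst e₀))).norm.mul_const ‖x‖).add
        (hunit (x.snd (star (x.snd e₀ - x.fst e₀)))).norm
      simp only [norm_zero, zero_mul, add_zero] at h
      filter_upwards [h.eventually_le_const hδ] with e he
      exact (norm_star_twistedCommutator_mul_le _ _ _ _).trans he
    -- The elements of `B` in the orthogonality estimate depend continuously on `g`. For `g ∈ K`
    -- they fill compact sets, on which the approximate unit converges uniformly.
    have hcont₁ : Continuous fun g => star ((Ψ.coc g : 𝓜(ℂ, B)).snd e₀ -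
        (Ψ.coc g : 𝓜(ℂ, B)).fst (β.toHom g e₀)) :=
      ((Ψ.continuous_coc_snd continuous_const).sub
        (Ψ.continuous_coc_fst (β.continuous_apply e₀))).star
    have hcont₂ : Continuous fun g => β.toHom g⁻¹ ((Ψ.coc g : 𝓜(ℂ, B)).snd
        (star ((Ψ.coc g : 𝓜(ℂ, B)).snd e₀ - (Ψ.coc g : 𝓜(ℂ, B)).fst (β.toHom g e₀)))) :=
      β.continuous_apply_apply continuous_inv (Ψ.continuous_coc_snd hcont₁)
    have huc : ∀ {K' : Set B}, IsCompact K' → ∀ᶠ e in l, ∀ b ∈ K', ‖b * e - b‖ < δ / 2 :=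
      fun hK' => eventually_forall_mem_norm_lt_of_compact (fun e b => b * e - b) 2 (by norm_num)
        (fun e x y => by rw [sub_mul]; abel)
        (by
          filter_upwards [hball] with e he x
          refine (norm_sub_le _ _).trans ?_
          have := (norm_mul_le x e).trans (mul_le_of_le_one_right (norm_nonneg x) he.le)
          linarith) hK' hunit (by positivity)
    filter_upwards [hX, huc (hK.image hcont₁), huc (hK.image hcont₂)] with e h₁ h₂ h₃
    rintro (x | g)
    · exact h₁ x x.2
    · refine (norm_star_twistedCommutator_mul_le _ _ _ _).trans ?_
      have h₄ := h₂ _ (Set.mem_image_of_mem _ g.2)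
      have h₅ := h₃ _ (Set.mem_image_of_mem _ g.2)
      simp_rw [CStarAction.toHom_symm_apply]
      have h₆ := (mul_le_of_le_one_right (norm_nonneg _) (Ψ.norm_coc_le g)).trans h₄.le
      linarith
  have hconv : Convex ℝ {e : B | e' ≤ e ∧ ‖e‖ < 1 ∧ ∀ h ∈ F, ‖e * h - h‖ ≤ ρ} := by
    have h₁ : Convex ℝ {e : B | e' ≤ e} := convex_Ici e'
    have h₂ : Convex ℝ {e : B | ‖e‖ < 1} := by
      simpa [Metric.ball] using convex_ball (0 : B) 1
    refine h₁.inter (h₂.inter ?_)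
    have : {e : B | ∀ h ∈ F, ‖e * h - h‖ ≤ ρ} = ⋂ h ∈ F, {e : B | ‖e * h - h‖ ≤ ρ} := by
      ext; simp
    change Convex ℝ {e : B | ∀ h ∈ F, ‖e * h - h‖ ≤ ρ}
    rw [this]
    refine convex_iInter₂ fun h _ => ?_
    have : {e : B | ‖e * h - h‖ ≤ ρ} =
        (LinearMap.mulRight ℝ h) ⁻¹' (Metric.closedBall h ρ) := by
      ext e; simp [dist_eq_norm]
    rw [this]
    exact (convex_closedBall h ρ).linear_preimage _
  obtain ⟨e, ⟨h₁, h₂, h₃⟩, he⟩ := exists_mem_forall_norm_le D hbound horth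
    (hge.and (hball.and hF)) hconv hη
  exact ⟨e, h₁, h₂, h₃, fun x hx => he (Sum.inl ⟨x, hx⟩), fun g hg => he (Sum.inr ⟨g, hg⟩)⟩

/-- A square-root partition of unity that is asymptotically central for `ψ` and asymptotically
invariant under the twisted action of the cocycle. -/
theorem CocycleRep.exists_quasicentral_partition (hB : IsSigmaUnital B) (Ψ : CocycleRep α β)
    (a : ℕ → A) {K : ℕ → Set G} (hK : ∀ n, IsCompact (K n)) (hKm : Monotone K) :
    ∃ f : ℕ → B, (∀ n, star (f n) = f n) ∧ (∀ n, ‖f n‖ ≤ 1) ∧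
      (∀ N, ‖∑ n ∈ Finset.range N, f n * f n‖ ≤ 1) ∧
      (∀ b, Tendsto (fun N => (∑ n ∈ Finset.range N, f n * f n) * b) atTop (𝓝 b)) ∧
      (∀ n, ∀ k ≤ n, ‖incl B (f n) * Ψ.hom (a k) - Ψ.hom (a k) * incl B (f n)‖ ≤ (1 / 2) ^ n) ∧
      ∀ n, ∀ g ∈ K n,
        ‖incl B (f n) * Ψ.coc g - Ψ.coc g * incl B (β.toHom g (f n))‖ ≤ (1 / 2) ^ n := by
  classical
  let _ := CStarAlgebra.spectralOrder B
  have := CStarAlgebra.spectralOrderedRing B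
  let _ := CStarAlgebra.spectralOrder 𝓜(ℂ, B)
  have := CStarAlgebra.spectralOrderedRing 𝓜(ℂ, B)
  obtain ⟨h, hh₁, hh⟩ := hB
  -- A common norm bound for the cocycle and for `ψ(a₀), …, ψ(aₙ)`.
  let c : ℕ → ℝ := fun n => 1 + ∑ k ∈ Finset.range (n + 1), ‖a k‖
  have hc₁ : ∀ n, 1 ≤ c n := fun n =>
    le_add_of_nonneg_right (Finset.sum_nonneg fun _ _ => norm_nonneg _)
  have hc : ∀ n, ∀ k ≤ n, ‖Ψ.hom (a k)‖ ≤ c n := fun n k hk => by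
    have h₁ : ‖a k‖ ≤ ∑ k ∈ Finset.range (n + 1), ‖a k‖ :=
      Finset.single_le_sum (f := fun k => ‖a k‖) (fun _ _ => norm_nonneg _)
        (Finset.mem_range.mpr (Nat.lt_succ_of_le hk))
    linarith [Ψ.norm_hom_le (a k)]
  choose δ hδ₀ hδ using fun n : ℕ => exists_sqrt_intertwining_delta (M := 𝓜(ℂ, B)) (c n)
    (ε := (1 / 2) ^ n) (zero_le_one.trans (hc₁ n)) (by positivity)
  -- `eₙ` enters both `eₙ - eₙ₋₁` and `eₙ₊₁ - eₙ`, hence the minimum; each difference has two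
  -- errors, hence the half. At `n = 0` the truncated `n - 1` just repeats `δ 0`.
  let η : ℕ → ℝ := fun n => min (δ (n - 1)) (δ n) / 2
  have hη₀ : ∀ n, 0 < η n := fun n => half_pos (lt_min (hδ₀ _) (hδ₀ _))
  let P : ℕ → B → Prop := fun n e => 0 ≤ e ∧ ‖e‖ < 1 ∧
    (∀ i < n, ‖e * h i - h i‖ ≤ 1 / (n + 1)) ∧
    (∀ k ≤ n, ‖incl B e * Ψ.hom (a k) - Ψ.hom (a k) * incl B e‖ ≤ η n) ∧
    ∀ g ∈ K n, ‖incl B e * Ψ.coc g - Ψ.coc g * incl B (β.toHom g e)‖ ≤ η n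
  have hP₀ : P 0 0 := by
    refine ⟨le_rfl, by simp, by simp, fun k _ => ?_, fun g _ => ?_⟩
    · simpa using (hη₀ 0).le
    · simpa using (hη₀ 0).le
  have hstep : ∀ n e, P n e → ∃ e', P (n + 1) e' ∧ e ≤ e' := fun n e he => by
    obtain ⟨e', h₁, h₂, h₃, h₄, h₅⟩ := Ψ.exists_quasicentral_step he.1 he.2.1
      ((Finset.range (n + 1)).image h) ((Finset.range (n + 2)).image fun k => Ψ.hom (a k))
      (hK (n + 1)) (hη₀ (n + 1)) (ρ := 1 / ((n + 1 : ℕ) + 1)) (by positivity)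
    refine ⟨e', ⟨he.1.trans h₁, h₂, fun i hi => ?_, fun k hk => ?_, h₅⟩, h₁⟩
    · exact h₃ _ (Finset.mem_image_of_mem _ (Finset.mem_range.mpr hi))
    · exact h₄ _ (Finset.mem_image_of_mem (fun k => Ψ.hom (a k))
        (Finset.mem_range.mpr (Nat.lt_succ_of_le hk)))
  choose! next hnext hle using hstep
  let e : ℕ → B := fun n => Nat.rec 0 next n
  have he : ∀ n, P n (e n) := fun n => by
    induction n with
    | zero => exact hP₀
    | succ n ih => exact hnext n _ ih
  have hmono : ∀ n, e n ≤ e (n + 1) := fun n => hle n _ (he n)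
  have hd₀ : ∀ n, 0 ≤ e (n + 1) - e n := fun n => sub_nonneg.mpr (hmono n)
  have hd₁ : ∀ n, ‖e (n + 1) - e n‖ ≤ 1 := fun n =>
    (CStarAlgebra.norm_le_norm_of_nonneg_of_le (hd₀ n)
      (sub_le_self _ (he n).1)).trans (he (n + 1)).2.1.le
  -- Since `e₀ = 0`, the squares telescope to `∑_{n<N} fₙ² = e_N`.
  let f : ℕ → B := fun n => CFC.sqrt (e (n + 1) - e n)
  have hff : ∀ n, f n * f n = e (n + 1) - e n := fun n => CFC.sqrt_mul_sqrt_self _ (hd₀ n)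
  have hf₀ : ∀ n, 0 ≤ f n := fun n => CFC.sqrt_nonneg _
  have hfs : ∀ n, star (f n) = f n := fun n => (IsSelfAdjoint.of_nonneg (hf₀ n)).star_eq
  have hf₁ : ∀ n, ‖f n‖ ≤ 1 := fun n => by
    have h₁ : ‖f n‖ * ‖f n‖ ≤ 1 := by
      rw [← CStarRing.norm_star_mul_self, hfs, hff]; exact hd₁ n
    nlinarith [norm_nonneg (f n)]
  have hsum : ∀ N, ∑ n ∈ Finset.range N, f n * f n = e N := fun N => by
    simp_rw [hff]
    rw [Finset.sum_range_sub]
    exact sub_zero _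
  have hpos : ∀ b : B, 0 ≤ b → 0 ≤ incl B b := fun b hb => by
    rw [← CFC.sqrt_mul_sqrt_self b hb, map_mul]
    nth_rw 1 [← (IsSelfAdjoint.of_nonneg (CFC.sqrt_nonneg b)).star_eq]
    rw [map_star]
    exact star_mul_self_nonneg _
  have hposβ : ∀ g, ∀ b : B, 0 ≤ b → 0 ≤ β.toHom g b := fun g b hb => by
    rw [← CFC.sqrt_mul_sqrt_self b hb, map_mul]
    nth_rw 1 [← (IsSelfAdjoint.of_nonneg (CFC.sqrt_nonneg b)).star_eq]
    rw [map_star]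
    exact star_mul_self_nonneg _
  have hη₁ : ∀ n, η n ≤ δ n / 2 := fun n => by
    have := min_le_right (δ (n - 1)) (δ n)
    simp only [η]; linarith
  have hη₂ : ∀ n, η (n + 1) ≤ δ n / 2 := fun n => by
    have := min_le_left (δ (n + 1 - 1)) (δ (n + 1))
    simp only [η, Nat.add_sub_cancel] at this ⊢; linarith
  have hcomm : ∀ n (x : 𝓜(ℂ, B)) (κ : B ≃⋆ₐ[ℂ] B), (∀ b, 0 ≤ b → 0 ≤ κ b) → ‖x‖ ≤ c n →
      ‖incl B (e n) * x - x * incl B (κ (e n))‖ ≤ η n →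
      ‖incl B (e (n + 1)) * x - x * incl B (κ (e (n + 1)))‖ ≤ η (n + 1) →
      ‖incl B (f n) * x - x * incl B (κ (f n))‖ ≤ (1 / 2) ^ n := by
    intro n x κ hκ hx h₁ h₂
    refine hδ n _ _ x (hpos _ (hf₀ n)) (hpos _ (hκ _ (hf₀ n))) ?_ ?_ hx ?_
    · rw [norm_incl]; exact hf₁ n
    · rw [norm_incl, StarAlgEquiv.norm_map κ]; exact hf₁ n
    · rw [← map_mul, ← map_mul, ← map_mul, hff]
      have h₃ : incl B (e (n + 1) - e n) * x - x * incl B (κ (e (n + 1) - e n)) =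
          (incl B (e (n + 1)) * x - x * incl B (κ (e (n + 1)))) -
            (incl B (e n) * x - x * incl B (κ (e n))) := by
        simp only [map_sub]; noncomm_ring
      rw [h₃]
      refine (norm_sub_le _ _).trans ?_
      linarith [hη₁ n, hη₂ n]
  refine ⟨f, hfs, hf₁, fun N => ?_, fun b => ?_, fun n k hk => ?_, fun n g hg => ?_⟩
  · rw [hsum]; exact (he N).2.1.le
  · simp_rw [hsum]
    rw [Metric.tendsto_atTop]
    intro ε hε
    -- The `eₙ` are controlled only on the elements `hᵢ`, so `b` is compared with `hᵢ b`.
    obtain ⟨i, hi⟩ := (Metric.tendsto_atTop.mp (hh b).1 (ε / 4) (by positivity))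
    have hi := hi i le_rfl
    rw [dist_eq_norm] at hi
    obtain ⟨N, hN⟩ := exists_nat_gt ((‖b‖ + 1) * (4 / ε))
    refine ⟨max N (i + 1), fun n hn => ?_⟩
    have hn₁ : N ≤ n := (le_max_left _ _).trans hn
    have hn₂ : i < n := (le_max_right _ _).trans hn
    have h₁ : ‖(e n * h i - h i) * b‖ ≤ ε / 4 := by
      refine (norm_mul_le _ _).trans ?_
      have h₂ := (he n).2.2.1 i hn₂
      have h₃ : (‖b‖ + 1) * (4 / ε) ≤ (n : ℝ) + 1 := by
        have : (N : ℝ) ≤ n := by exact_mod_cast hn₁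
        linarith
      calc ‖e n * h i - h i‖ * ‖b‖ ≤ 1 / (n + 1) * (‖b‖ + 1) := by gcongr; linarith
        _ ≤ ε / 4 := by
          rw [one_div, inv_mul_le_iff₀ (by positivity)]
          calc ‖b‖ + 1 = (‖b‖ + 1) * (4 / ε) * (ε / 4) := by field_simp
            _ ≤ (n + 1) * (ε / 4) := by gcongr
    have h₂ : ‖e n * (h i * b - b)‖ ≤ ε / 4 :=
      (norm_mul_le _ _).trans
        ((mul_le_of_le_one_left (norm_nonneg _) (he n).2.1.le).trans hi.le)
    rw [dist_eq_norm]
    calc ‖e n * b - b‖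
        = ‖(e n * h i - h i) * b + (h i * b - b) - e n * (h i * b - b)‖ := by
          congr 1; rw [sub_mul, mul_sub, mul_assoc]; abel
      _ ≤ ‖(e n * h i - h i) * b‖ + ‖h i * b - b‖ + ‖e n * (h i * b - b)‖ :=
          (norm_sub_le _ _).trans (by gcongr; exact norm_add_le _ _)
      _ < ε := by linarith
  · exact hcomm n _ (StarAlgEquiv.refl ..) (fun _ hb => hb) (hc n k hk) ((he n).2.2.2.1 k hk)
      ((he (n + 1)).2.2.2.1 k (hk.trans n.le_succ))
  · exact hcomm n _ (β.toHom g) (hposβ g) ((Ψ.norm_coc_le g).trans (hc₁ n))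
      ((he n).2.2.2.2 g hg) ((he (n + 1)).2.2.2.2 g (hKm n.le_succ hg))

end Quasicentral

/-! ### Isometries intertwining modulo `B` -/

section IntertwiningIsometry

variable {G A B : Type*} [Group G] [TopologicalSpace G]
  [NonUnitalCStarAlgebra A] [NonUnitalCStarAlgebra B]
  {α : CStarAction G A} {β : CStarAction G B}

/-- A multiplier with norm-summable coordinates in `B` along a Cuntz family is the norm sum of its
coordinates. -/
theorem CStarAction.IsCuntzFamily.hasSum_of_summable {t : ℕ → 𝓜(ℂ, B)} (ht : β.IsCuntzFamily t)
    {c : 𝓜(ℂ, B)} {w : ℕ → 𝓜(ℂ, B)} (hc : ∀ n, star (t n) * c = w n)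
    (hw : Summable fun n => ‖w n‖) : HasSum (fun n => t n * w n) c := by
  have hs : Summable fun n => t n * w n :=
    Summable.of_norm_bounded hw fun n => (norm_mul_le _ _).trans
      (mul_le_of_le_one_left (norm_nonneg _) (ht.norm_le_one n))
  have : c = ∑' n, t n * w n := ht.ext_left fun m => by
    rw [hc, ← hs.tsum_mul_left, tsum_eq_single m, ht.star_mul_self_assoc]
    exact fun n hn => ht.orthogonal_assoc hn.symm _
  rw [this]
  exact hs.hasSum

namespace CocycleRep

theorem Intertwines.hom_star {t : 𝓜(ℂ, B)} {Φ Ψ : CocycleRep α β} (h : Intertwines t Φ Ψ) (a : A) :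
    star t * Ψ.hom a = Φ.hom a * star t := by
  have := congrArg star (h.hom (star a))
  simpa [map_star] using this

/-- Unitarity of both cocycles turns `v t = t u` into `v* t = t u*`; then take adjoints. -/
theorem Intertwines.coc_star {t : 𝓜(ℂ, B)} {Φ Ψ : CocycleRep α β} (h : Intertwines t Φ Ψ) (g : G) :
    star t * (Ψ.coc g : 𝓜(ℂ, B)) = Φ.coc g * star t := by
  have h₁ : star (Ψ.coc g : 𝓜(ℂ, B)) * t = t * star (Φ.coc g : 𝓜(ℂ, B)) := by
    calc star (Ψ.coc g : 𝓜(ℂ, B)) * t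
        = star (Ψ.coc g : 𝓜(ℂ, B)) * (t * Φ.coc g) * star (Φ.coc g : 𝓜(ℂ, B)) := by
          rw [mul_assoc, mul_assoc t, Unitary.mul_star_self_of_mem (SetLike.coe_mem _), mul_one]
      _ = t * star (Φ.coc g : 𝓜(ℂ, B)) := by
          rw [← h.coc, ← mul_assoc, Unitary.star_mul_self_of_mem (SetLike.coe_mem _), one_mul]
  simpa using congrArg star h₁

/-- The sequence `Φ` approximates `Ψ` point-strictly at the elements `aᵢ` and, uniformly on the
sets `Kₙ`, in the cocycle. -/
def Approximates (a : ℕ → A) (K : ℕ → Set G) (Φ : ℕ → CocycleRep α β) (Ψ : CocycleRep α β) : Prop :=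
  ∀ (f : B) (n : ℕ) (ε : ℝ), 0 < ε → ∃ k,
    (∀ i ≤ n, ‖((Φ k).hom (a i) - Ψ.hom (a i)) * incl B f‖ ≤ ε) ∧
    ∀ g ∈ K n, ‖((Φ k).coc g - Ψ.coc g : 𝓜(ℂ, B)) * incl B (β.toHom g f)‖ ≤ ε

variable [IsTopologicalGroup G]

/-- Take `s = ∑ tₙ t_{k(n)} fₙ`; the outer `tₙ` keep the ranges orthogonal even if `k` repeats
values. The `n`-th coordinate of a defect is `t_{k(n)}` times `Φ_{k(n)}(a) fₙ - fₙ Ψ(a)`, an element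
of `B`. Approximation on `fₙ` and quasicentrality each contribute `2⁻ⁿ` to its norm. In the cocycle
defect `β_g(fₙ)` replaces the first `fₙ`, which is why `Approximates` tests the cocycles on
`β_g(f)`. -/
theorem exists_intertwining_isometry (hB : IsSigmaUnital B) {t : ℕ → 𝓜(ℂ, B)}
    (ht : β.IsCuntzFamily t) {Φ : ℕ → CocycleRep α β} {Ω Θ Ψ : CocycleRep α β}
    (hΩ : ∀ n, Intertwines (t n) (Φ n) Ω) (hΘ : ∀ n, Intertwines (t n) Ω Θ)
    {a : ℕ → A} (ha : DenseRange a) (K : CompactExhaustion G)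
    (happ : Approximates a K Φ Ψ) :
    ∃ s : 𝓜(ℂ, B), star s * s = 1 ∧ (∀ a, MemIdeal (Θ.hom a * s - s * Ψ.hom a)) ∧
      (∀ g, MemIdeal ((Θ.coc g : 𝓜(ℂ, B)) * β.mult g s - s * (Ψ.coc g : 𝓜(ℂ, B)))) ∧
      Continuous fun g => (Θ.coc g : 𝓜(ℂ, B)) * β.mult g s - s * Ψ.coc g := by
  have hKmono : Monotone K := fun _ _ h => K.subset h
  obtain ⟨f, hfs, hf₁, hsum, hlim, hfa, hfg⟩ :=
    Ψ.exists_quasicentral_partition hB a K.isCompact hKmono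
  choose k hka hkg using fun n : ℕ => happ (f n) n ((1 / 2) ^ n) (by positivity)
  have hy : ∀ N, ∑ n ∈ Finset.range N, star (t (k n) * incl B (f n)) * (t (k n) * incl B (f n)) =
      incl B (∑ n ∈ Finset.range N, f n * f n) := fun N => by
    rw [map_sum]
    refine Finset.sum_congr rfl fun n _ => ?_
    rw [star_mul, mul_assoc, ht.star_mul_self_assoc, ← map_star, hfs, map_mul]
  have hylim : ∀ b, Tendsto (fun N => (∑ n ∈ Finset.range N,
      star (t (k n) * incl B (f n)) * (t (k n) * incl B (f n))) * incl B b) atTop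
      (𝓝 (incl B b)) := fun b => by
    simp_rw [hy, ← map_mul]
    exact (isometry_incl.continuous.tendsto _).comp (hlim b)
  obtain ⟨s, -, hs⟩ := ht.exists_column (fun n => t (k n) * incl B (f n)) zero_le_one
    (fun N => by rw [hy, norm_incl, one_pow]; exact hsum N) (fun b => (hylim b).cauchySeq)
  have hcoord_hom : ∀ a n, star (t n) * (Θ.hom a * s - s * Ψ.hom a) =
      t (k n) * ((Φ (k n)).hom a * incl B (f n) - incl B (f n) * Ψ.hom a) := fun a n => by
    rw [mul_sub, ← mul_assoc, ← mul_assoc, (hΘ n).hom_star, hs, mul_assoc, hs, ← mul_assoc,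
      (hΩ (k n)).hom, mul_sub, mul_assoc, mul_assoc]
  have hcoord_coc : ∀ g n, star (t n) * ((Θ.coc g : 𝓜(ℂ, B)) * β.mult g s - s * Ψ.coc g) =
      t (k n) * (((Φ (k n)).coc g : 𝓜(ℂ, B)) * incl B (β.toHom g (f n)) - incl B (f n) * Ψ.coc g) :=
    fun g n => by
    have h₁ : star (t n) * β.mult g s = t (k n) * incl B (β.toHom g (f n)) := by
      have := congrArg (β.mult g) (hs n)
      rwa [map_mul, map_star, ht.fixed, map_mul, ht.fixed, β.mult_incl] at this
    rw [mul_sub, ← mul_assoc, ← mul_assoc, (hΘ n).coc_star, hs, mul_assoc, h₁, ← mul_assoc,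
      (hΩ (k n)).coc, mul_sub, mul_assoc, mul_assoc]
  have hmem : ∀ (x : 𝓜(ℂ, B)) (n : ℕ) (b : B) (y : 𝓜(ℂ, B)),
      MemIdeal (t (k n) * (x * incl B b - incl B (f n) * y)) := fun x n b y =>
    (((memIdeal_incl b).mul_left x).sub ((memIdeal_incl _).mul_right y)).mul_left _
  have hnormt : ∀ n (x : 𝓜(ℂ, B)), ‖t n * x‖ ≤ ‖x‖ := fun n x =>
    (norm_mul_le _ _).trans (mul_le_of_le_one_left (norm_nonneg _) (ht.norm_le_one n))
  refine ⟨s, ht.isometry_of_column hs hylim, ?_, ?_⟩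
  · have hcl : IsClosed {a : A | MemIdeal (Θ.hom a * s - s * Ψ.hom a)} := by
      have hΘc : Continuous Θ.hom :=
        AddMonoidHomClass.continuous_of_bound Θ.hom 1 fun a => by
          rw [one_mul]; exact Θ.norm_hom_le a
      have hΨc : Continuous Ψ.hom :=
        AddMonoidHomClass.continuous_of_bound Ψ.hom 1 fun a => by
          rw [one_mul]; exact Ψ.norm_hom_le a
      exact isClosed_memIdeal.preimage ((hΘc.mul_const s).sub (hΨc.const_mul s))
    intro x
    refine ha.induction_on (p := fun x => MemIdeal (Θ.hom x * s - s * Ψ.hom x)) x hcl fun i => ?_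
    have hbound : ∀ᶠ n in atTop,
        ‖‖t (k n) * ((Φ (k n)).hom (a i) * incl B (f n) - incl B (f n) * Ψ.hom (a i))‖‖ ≤
          2 * (1 / 2 : ℝ) ^ n := by
      filter_upwards [eventually_ge_atTop i] with n hn
      rw [norm_norm]
      refine (hnormt _ _).trans ?_
      have h₁ := hka n i hn
      have h₂ := hfa n i hn
      calc ‖(Φ (k n)).hom (a i) * incl B (f n) - incl B (f n) * Ψ.hom (a i)‖
          = ‖((Φ (k n)).hom (a i) - Ψ.hom (a i)) * incl B (f n) -
              (incl B (f n) * Ψ.hom (a i) - Ψ.hom (a i) * incl B (f n))‖ := by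
            congr 1; rw [sub_mul]; abel
        _ ≤ _ := norm_sub_le _ _
        _ ≤ 2 * (1 / 2 : ℝ) ^ n := by linarith
    have hsumm := Summable.of_norm_bounded_eventually_nat (g := fun n => 2 * (1 / 2 : ℝ) ^ n)
      (summable_geometric_two.mul_left 2) hbound
    have := ht.hasSum_of_summable (hcoord_hom (a i)) hsumm
    rw [← this.tsum_eq]
    exact memIdeal_tsum fun n => (hmem _ n _ _).mul_left _
  · let w : ℕ → G → 𝓜(ℂ, B) := fun n g =>
      t (k n) * (((Φ (k n)).coc g : 𝓜(ℂ, B)) * incl B (β.toHom g (f n)) - incl B (f n) * Ψ.coc g)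
    have hw_le : ∀ n g, ‖w n g‖ ≤ 2 := fun n g => by
      refine (hnormt _ _).trans ((norm_sub_le _ _).trans ?_)
      have h₁ := (norm_mul_le ((Φ (k n)).coc g : 𝓜(ℂ, B)) (incl B (β.toHom g (f n)))).trans
        (mul_le_of_le_one_left (norm_nonneg _) ((Φ (k n)).norm_coc_le g))
      have h₂ := (norm_mul_le (incl B (f n)) (Ψ.coc g : 𝓜(ℂ, B))).trans
        (mul_le_of_le_one_right (norm_nonneg _) (Ψ.norm_coc_le g))
      rw [norm_incl, StarAlgEquiv.norm_map (β.toHom g)] at h₁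
      rw [norm_incl] at h₂
      linarith [hf₁ n]
    have hw_K : ∀ n, ∀ g ∈ K n, ‖w n g‖ ≤ 2 * (1 / 2 : ℝ) ^ n := fun n g hg => by
      refine (hnormt _ _).trans ?_
      have h₁ := hkg n g hg
      have h₂ := hfg n g hg
      calc ‖((Φ (k n)).coc g : 𝓜(ℂ, B)) * incl B (β.toHom g (f n)) - incl B (f n) * Ψ.coc g‖
          = ‖((Φ (k n)).coc g - Ψ.coc g : 𝓜(ℂ, B)) * incl B (β.toHom g (f n)) -
              (incl B (f n) * Ψ.coc g - Ψ.coc g * incl B (β.toHom g (f n)))‖ := by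
            congr 1; rw [sub_mul]; abel
        _ ≤ _ := norm_sub_le _ _
        _ ≤ 2 * (1 / 2 : ℝ) ^ n := by linarith
    -- The factor `2 ^ (N + 1)` absorbs the crude bound `2` for `n < N`, so a single geometric
    -- series dominates on all of `K N`.
    have hw : ∀ N n, ∀ g ∈ K N, ‖w n g‖ ≤ 2 ^ (N + 1) * (1 / 2 : ℝ) ^ n := fun N n g hg => by
      rcases le_or_gt N n with h | h
      · refine (hw_K n g (hKmono h hg)).trans ?_
        gcongr
        calc (2 : ℝ) = 2 ^ 1 := by norm_num
          _ ≤ 2 ^ (N + 1) := by gcongr <;> simp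
      · refine (hw_le n g).trans ?_
        obtain ⟨m, rfl⟩ := Nat.exists_eq_add_of_lt h
        have : (2 : ℝ) ^ (n + m + 1 + 1) * (1 / 2) ^ n = 2 ^ (m + 2) := by
          rw [one_div, inv_pow, show n + m + 1 + 1 = n + (m + 2) by ring, pow_add]
          field_simp
        rw [this]
        calc (2 : ℝ) = 2 ^ 1 := by norm_num
          _ ≤ 2 ^ (m + 2) := by gcongr <;> simp
    have hsummable : ∀ N, Summable fun n => 2 ^ (N + 1) * (1 / 2 : ℝ) ^ n := fun N =>
      summable_geometric_two.mul_left _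
    have hcsum : ∀ g, HasSum (fun n => t n * w n g)
        ((Θ.coc g : 𝓜(ℂ, B)) * β.mult g s - s * Ψ.coc g) := by
      intro g
      obtain ⟨N, hN⟩ := K.exists_mem g
      exact ht.hasSum_of_summable (hcoord_coc g) (Summable.of_norm_bounded (hsummable N)
        fun n => by rw [norm_norm]; exact hw N n g hN)
    refine ⟨fun g => ?_, ?_⟩
    · rw [← (hcsum g).tsum_eq]
      exact memIdeal_tsum fun n => (hmem _ n _ _).mul_left _
    · have hcw : ∀ n, Continuous (w n) := fun n => by
        refine Continuous.const_mul ?_ _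
        simp_rw [mul_incl, incl_mul]
        exact (isometry_incl.continuous.comp
          ((Φ (k n)).continuous_coc_fst (β.continuous_apply _))).sub
            (isometry_incl.continuous.comp (Ψ.continuous_coc_snd continuous_const))
      rw [continuous_iff_continuousAt]
      intro g
      obtain ⟨N, hN⟩ := K.exists_mem g
      -- On this neighbourhood the series of continuous functions converges uniformly.
      have hnhds : K (N + 1) ∈ 𝓝 g := mem_interior_iff_mem_nhds.mp (K.subset_interior_succ N hN)
      refine ContinuousOn.continuousAt ?_ hnhds
      have := continuousOn_tsum (f := fun n g => t n * w n g) (s := K (N + 1))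
        (fun n => ((hcw n).const_mul (t n)).continuousOn) (hsummable (N + 1))
        fun n g hg => (hnormt _ _).trans (hw (N + 1) n g hg)
      exact this.congr fun g _ => (hcsum g).tsum_eq.symm

end CocycleRep

end IntertwiningIsometry

/-! ### The absorbing unitary -/

section AbsorbingUnitary

variable {M : Type*} [CStarAlgebra M]

/-- The operator `(s S s* + 1 - s s*) t₁* + s T t₂*`. -/
def absorbingUnitary (s S T t₁ t₂ : M) : M :=
  (s * S * star s + (1 - s * star s)) * star t₁ + s * T * star t₂

variable {s S T t₁ t₂ : M}

/-- `r = s S s* + 1 - s s*` is an isometry whose range misses exactly `s (1 - S S*) s* = s T T* s*`,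
the range projection of `q = s T`. So `r t₁* + q t₂*` carries one pair of complementary isometries
to another. -/
theorem absorbingUnitary_mem (hs : star s * s = 1) (hS : star S * S = 1) (hT : star T * T = 1)
    (hTS : star T * S = 0) (hST : S * star S + T * star T = 1) (h₁ : star t₁ * t₁ = 1)
    (h₂ : star t₂ * t₂ = 1) (h₁₂ : star t₁ * t₂ = 0) (ht : t₁ * star t₁ + t₂ * star t₂ = 1) :
    absorbingUnitary s S T t₁ t₂ ∈ unitary M := by
  have h₂₁ : star t₂ * t₁ = 0 := by simpa using congrArg star h₁₂
  have hST' : star S * T = 0 := by simpa using congrArg star hTS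
  set r := s * S * star s + (1 - s * star s) with hr
  set q := s * T with hq
  have hrs : star r = s * star S * star s + (1 - s * star s) := by
    simp [hr, mul_assoc]
  have hrr : star r * r = 1 := by
    calc star r * r = s * star S * (star s * s) * S * star s
          + s * star S * (star s - star s * s * star s)
          + (s - s * (star s * s)) * S * star s
          + (1 - s * star s - s * star s + s * (star s * s) * star s) := by
          rw [hrs, hr]; noncomm_ring
      _ = s * (star S * S) * star s + (1 - s * star s) := by rw [hs]; noncomm_ring
      _ = 1 := by rw [hS]; noncomm_ring
  have hrr' : r * star r = s * (S * star S) * star s + (1 - s * star s) := by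
    calc r * star r = s * S * (star s * s) * star S * star s
          + s * S * (star s - star s * s * star s)
          + (s - s * (star s * s)) * star S * star s
          + (1 - s * star s - s * star s + s * (star s * s) * star s) := by
          rw [hrs, hr]; noncomm_ring
      _ = s * (S * star S) * star s + (1 - s * star s) := by rw [hs]; noncomm_ring
  have hqq : star q * q = 1 := by
    rw [hq, star_mul, mul_assoc, ← mul_assoc (star s), hs, one_mul, hT]
  have hsum : r * star r + q * star q = 1 := by
    calc r * star r + q * star q = s * (S * star S + T * star T) * star s + (1 - s * star s) := by
          rw [hrr', hq, star_mul]; noncomm_ring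
      _ = 1 := by rw [hST]; noncomm_ring
  have hrq : star r * q = 0 := by
    calc star r * q = s * star S * (star s * s) * T + (s - s * (star s * s)) * T := by
          rw [hrs, hq]; noncomm_ring
      _ = s * (star S * T) := by rw [hs]; noncomm_ring
      _ = 0 := by rw [hST', mul_zero]
  have hqr : star q * r = 0 := by simpa using congrArg star hrq
  have hw : absorbingUnitary s S T t₁ t₂ = r * star t₁ + q * star t₂ := rfl
  have hws : star (absorbingUnitary s S T t₁ t₂) = t₁ * star r + t₂ * star q := by
    rw [hw]; simp
  rw [Unitary.mem_iff]
  constructor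
  · calc star (absorbingUnitary s S T t₁ t₂) * absorbingUnitary s S T t₁ t₂
        = t₁ * (star r * r) * star t₁ + t₁ * (star r * q) * star t₂
          + t₂ * (star q * r) * star t₁ + t₂ * (star q * q) * star t₂ := by
          rw [hws, hw]; noncomm_ring
      _ = 1 := by rw [hrr, hrq, hqr, hqq]; simpa using ht
  · calc absorbingUnitary s S T t₁ t₂ * star (absorbingUnitary s S T t₁ t₂)
        = r * (star t₁ * t₁) * star r + r * (star t₁ * t₂) * star q
          + q * (star t₂ * t₁) * star r + q * (star t₂ * t₂) * star q := by
          rw [hws, hw]; noncomm_ring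
      _ = 1 := by rw [h₁, h₁₂, h₂₁, h₂]; simpa using hsum

/-- Write `r = 1 + s (S - 1) s*`. The summand `1` cancels, and `V S = S V`, `V T = T U` leave only
terms containing the defects of `s`. In the application `X`, `V`, `U` come from `Θ`, `Ψ`, `Φ`. -/
theorem mul_map_absorbingUnitary_sub (κ : M ≃⋆ₐ[ℂ] M) (hκS : κ S = S) (hκT : κ T = T)
    (hκ₁ : κ t₁ = t₁) (hκ₂ : κ t₂ = t₂) (h₁ : star t₁ * t₁ = 1)
    (h₂ : star t₂ * t₂ = 1) (h₁₂ : star t₁ * t₂ = 0) {X V U : M} (hVS : V * S = S * V)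
    (hVT : V * T = T * U) :
    X * κ (absorbingUnitary s S T t₁ t₂) -
        absorbingUnitary s S T t₁ t₂ * (t₁ * X * star t₁ + t₂ * U * star t₂) =
      ((X * κ s - s * V) * (S - 1) * star (κ s) -
        s * (S - 1) * (star s * X - V * star (κ s))) * star t₁ +
        (X * κ s - s * V) * T * star t₂ := by
  have h₂₁ : star t₂ * t₁ = 0 := by simpa using congrArg star h₁₂
  have hκw : κ (absorbingUnitary s S T t₁ t₂) = absorbingUnitary (κ s) S T t₁ t₂ := by
    simp [absorbingUnitary, map_star, hκS, hκT, hκ₁, hκ₂]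
  have hw₁ : absorbingUnitary s S T t₁ t₂ * t₁ = s * S * star s + (1 - s * star s) := by
    rw [absorbingUnitary, add_mul, mul_assoc _ (star t₁), h₁, mul_assoc _ (star t₂), h₂₁]
    simp
  have hw₂ : absorbingUnitary s S T t₁ t₂ * t₂ = s * T := by
    rw [absorbingUnitary, add_mul, mul_assoc _ (star t₁), h₁₂, mul_assoc _ (star t₂), h₂]
    simp
  have hsplit : absorbingUnitary s S T t₁ t₂ * (t₁ * X * star t₁ + t₂ * U * star t₂) =
      (s * S * star s + (1 - s * star s)) * X * star t₁ + s * T * U * star t₂ := by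
    rw [← hw₁, ← hw₂]; noncomm_ring
  have hE : (X * κ s - s * V) * (S - 1) * star (κ s) -
      s * (S - 1) * (star s * X - V * star (κ s)) =
      X * κ s * (S - 1) * star (κ s) - s * (S - 1) * star s * X -
        s * (V * S - S * V) * star (κ s) := by noncomm_ring
  have hE' : (X * κ s - s * V) * T = X * κ s * T - s * (V * T) := by noncomm_ring
  rw [hκw, hsplit, hE, hE', hVS, hVT, absorbingUnitary]
  noncomm_ring

/-- The defect of `absorbingUnitary` as an intertwiner, in terms of the defects of `s`. -/
theorem sub_absorbingUnitary_conj (κ : M ≃⋆ₐ[ℂ] M) (hκS : κ S = S) (hκT : κ T = T)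
    (hκ₁ : κ t₁ = t₁) (hκ₂ : κ t₂ = t₂) (h₁ : star t₁ * t₁ = 1)
    (h₂ : star t₂ * t₂ = 1) (h₁₂ : star t₁ * t₂ = 0) {X V U : M} (hVS : V * S = S * V)
    (hVT : V * T = T * U) (hw : absorbingUnitary s S T t₁ t₂ ∈ unitary M) :
    X - absorbingUnitary s S T t₁ t₂ * (t₁ * X * star t₁ + t₂ * U * star t₂) *
        star (κ (absorbingUnitary s S T t₁ t₂)) =
      (((X * κ s - s * V) * (S - 1) * star (κ s) -
        s * (S - 1) * (star s * X - V * star (κ s))) * star t₁ +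
        (X * κ s - s * V) * T * star t₂) * star (κ (absorbingUnitary s S T t₁ t₂)) := by
  rw [← mul_map_absorbingUnitary_sub κ hκS hκT hκ₁ hκ₂ h₁ h₂ h₁₂ hVS hVT, sub_mul, mul_assoc X,
    ← map_star, ← map_mul, Unitary.mul_star_self_of_mem hw, map_one, mul_one]

theorem norm_defect_le {c c' s s' S T t₁ t₂ w : M} (hs : ‖s‖ ≤ 1) (hs' : ‖s'‖ ≤ 1) (hS : ‖S‖ ≤ 1)
    (hT : ‖T‖ ≤ 1) (h₁ : ‖t₁‖ ≤ 1) (h₂ : ‖t₂‖ ≤ 1) (hw : ‖w‖ ≤ 1) :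
    ‖((c * (S - 1) * star s' - s * (S - 1) * c') * star t₁ + c * T * star t₂) * star w‖ ≤
      3 * ‖c‖ + 2 * ‖c'‖ := by
  have hone : ‖(1 : M)‖ ≤ 1 := norm_le_one_of_isometry (by simp)
  have hS1 : ‖S - 1‖ ≤ 2 := (norm_sub_le _ _).trans (by linarith)
  have hr : ∀ x y : M, ‖y‖ ≤ 1 → ‖x * y‖ ≤ ‖x‖ := fun x y hy =>
    (norm_mul_le _ _).trans (mul_le_of_le_one_right (norm_nonneg _) hy)
  have a₁ : ‖c * (S - 1) * star s'‖ ≤ 2 * ‖c‖ := by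
    refine (hr _ _ (by rwa [norm_star])).trans ((norm_mul_le _ _).trans ?_)
    nlinarith [norm_nonneg c]
  have a₂ : ‖s * (S - 1) * c'‖ ≤ 2 * ‖c'‖ := by
    refine (norm_mul_le _ _).trans ?_
    gcongr
    refine (norm_mul_le _ _).trans ?_
    nlinarith [norm_nonneg s, norm_nonneg (S - 1)]
  have a₃ : ‖c * T * star t₂‖ ≤ ‖c‖ := (hr _ _ (by rwa [norm_star])).trans (hr _ _ hT)
  refine (hr _ _ (by rwa [norm_star])).trans ((norm_add_le _ _).trans ?_)
  have a₄ := (hr (c * (S - 1) * star s' - s * (S - 1) * c') (star t₁)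
    (by rwa [norm_star])).trans (norm_sub_le _ _)
  linarith

end AbsorbingUnitary

/-! ### A path of isometries through a Cuntz family -/

section IsometryPath

/-- The square root of the tent function around `n`. -/
def tentSqrt (n : ℕ) (τ : ℝ) : ℝ := Real.sqrt (1 - |τ - n|)

theorem continuous_tentSqrt (n : ℕ) : Continuous (tentSqrt n) := by
  unfold tentSqrt; fun_prop

theorem tentSqrt_eq_zero {n : ℕ} {τ : ℝ} (h : 1 ≤ |τ - n|) : tentSqrt n τ = 0 :=
  Real.sqrt_eq_zero'.mpr (by linarith)

theorem tentSqrt_floor {τ : ℝ} (hτ : 0 ≤ τ) :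
    tentSqrt ⌊τ⌋₊ τ ^ 2 + tentSqrt (⌊τ⌋₊ + 1) τ ^ 2 = 1 := by
  have h₁ := Nat.floor_le hτ
  have h₂ := Nat.lt_floor_add_one τ
  have h₃ : |τ - ⌊τ⌋₊| = τ - ⌊τ⌋₊ := abs_of_nonneg (by linarith)
  have h₄ : |τ - ((⌊τ⌋₊ + 1 : ℕ) : ℝ)| = ⌊τ⌋₊ + 1 - τ := by
    push_cast
    rw [abs_sub_comm, abs_of_nonneg (by linarith)]
  rw [tentSqrt, tentSqrt, Real.sq_sqrt (by rw [h₃]; linarith), Real.sq_sqrt (by rw [h₄]; linarith),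
    h₃, h₄]
  ring

variable {M : Type*} [CStarAlgebra M]

/-- The path `τ ↦ ∑ₙ √(1 - |τ - n|)₊ tₙ`. -/
def isometryPath (t : ℕ → M) (τ : ℝ) : M :=
  ∑ n ∈ Finset.range (⌊τ⌋₊ + 2), (tentSqrt n τ : ℂ) • t n

/-- Enlarging the range makes the path locally a fixed finite sum, whence its continuity across
integers. -/
theorem isometryPath_eq_sum (t : ℕ → M) {τ : ℝ} {N : ℕ} (hN : ⌊τ⌋₊ + 2 ≤ N) :
    isometryPath t τ = ∑ n ∈ Finset.range N, (tentSqrt n τ : ℂ) • t n := by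
  refine Finset.sum_subset (Finset.range_mono hN) fun n _ hn => ?_
  have h₁ : ⌊τ⌋₊ + 2 ≤ n := by simpa using hn
  have h₂ : ((⌊τ⌋₊ + 2 : ℕ) : ℝ) ≤ n := by exact_mod_cast h₁
  have h₃ := Nat.lt_floor_add_one τ
  push_cast at h₂
  rw [tentSqrt_eq_zero]
  · simp
  · rw [abs_sub_comm]
    exact le_trans (by linarith) (le_abs_self _)

theorem isometryPath_eq_add (t : ℕ → M) {τ : ℝ} (hτ : 0 ≤ τ) :
    isometryPath t τ = (tentSqrt ⌊τ⌋₊ τ : ℂ) • t ⌊τ⌋₊ +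
      (tentSqrt (⌊τ⌋₊ + 1) τ : ℂ) • t (⌊τ⌋₊ + 1) := by
  rw [isometryPath, Finset.sum_range_succ, Finset.sum_range_succ, Finset.sum_eq_zero, zero_add]
  intro n hn
  have h₁ : n + 1 ≤ ⌊τ⌋₊ := Finset.mem_range.mp hn
  have h₂ : ((n + 1 : ℕ) : ℝ) ≤ τ := (Nat.le_floor_iff hτ).mp h₁
  push_cast at h₂
  rw [tentSqrt_eq_zero]
  · simp
  · exact le_trans (by linarith) (le_abs_self _)

theorem continuous_isometryPath (t : ℕ → M) : Continuous (isometryPath t) := by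
  rw [continuous_iff_continuousAt]
  intro τ₀
  have hc : Continuous fun τ : ℝ =>
      ∑ n ∈ Finset.range (⌊τ₀ + 1⌋₊ + 2), (tentSqrt n τ : ℂ) • t n :=
    continuous_finsetSum _ fun n _ =>
      (Complex.continuous_ofReal.comp (continuous_tentSqrt n)).smul continuous_const
  refine hc.continuousAt.congr ?_
  filter_upwards [eventually_lt_nhds (show τ₀ < τ₀ + 1 by linarith)] with τ hτ
  exact (isometryPath_eq_sum t (by gcongr)).symm

theorem isometryPath_isometry {t : ℕ → M} (h₁ : ∀ n, star (t n) * t n = 1)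
    (h₂ : ∀ m n, m ≠ n → star (t m) * t n = 0) {τ : ℝ} (hτ : 0 ≤ τ) :
    star (isometryPath t τ) * isometryPath t τ = 1 := by
  rw [isometryPath_eq_add t hτ]
  have h := tentSqrt_floor hτ
  set c := tentSqrt ⌊τ⌋₊ τ
  set d := tentSqrt (⌊τ⌋₊ + 1) τ
  simp only [star_add, star_smul, mul_add, add_mul, smul_mul_smul_comm, h₁,
    h₂ ⌊τ⌋₊ (⌊τ⌋₊ + 1) (by simp), h₂ (⌊τ⌋₊ + 1) ⌊τ⌋₊ (by simp), smul_zero, add_zero, zero_add]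
  rw [← add_smul]
  have : star (c : ℂ) * c + star (d : ℂ) * d = 1 := by
    simp only [Complex.star_def, Complex.conj_ofReal]
    rw [← sq, ← sq]
    exact_mod_cast h
  rw [this, one_smul]

theorem norm_mul_isometryPath_le (t : ℕ → M) (x : M) {τ : ℝ} (hτ : 0 ≤ τ) :
    ‖x * isometryPath t τ‖ ≤ ‖x * t ⌊τ⌋₊‖ + ‖x * t (⌊τ⌋₊ + 1)‖ := by
  have hle : ∀ n, ‖(tentSqrt n τ : ℂ)‖ ≤ 1 := fun n => by
    rw [Complex.norm_real, tentSqrt, Real.norm_of_nonneg (Real.sqrt_nonneg _), Real.sqrt_le_one]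
    linarith [abs_nonneg (τ - n)]
  rw [isometryPath_eq_add t hτ, mul_add, mul_smul_comm, mul_smul_comm]
  refine (norm_add_le _ _).trans ?_
  rw [norm_smul, norm_smul]
  exact add_le_add (mul_le_of_le_one_left (norm_nonneg _) (hle _))
    (mul_le_of_le_one_left (norm_nonneg _) (hle _))

end IsometryPath

/-! ### Absorption -/

section Absorption

variable {G A B : Type*} [Group G] [TopologicalSpace G]
  [NonUnitalCStarAlgebra A] [NonUnitalCStarAlgebra B]
  {α : CStarAction G A} {β : CStarAction G B}

/-- `b tₙ tₙ*` is a difference of consecutive terms of a convergent sequence, and `b tₙ = (b tₙ tₙ*)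
tₙ`. -/
theorem CStarAction.IsCuntzFamily.tendsto_incl_mul {t : ℕ → 𝓜(ℂ, B)} (ht : β.IsCuntzFamily t)
    (b : B) : Tendsto (fun n => incl B b * t n) atTop (𝓝 0) := by
  have h₁ : Tendsto (fun n => incl B b * (t n * star (t n))) atTop (𝓝 0) := by
    have h := ((tendsto_add_atTop_iff_nat 1).mpr (ht.tendsto_mul_proj b)).sub
      (ht.tendsto_mul_proj b)
    rw [sub_self] at h
    refine h.congr fun n => ?_
    rw [← mul_sub, Finset.sum_range_succ, add_sub_cancel_left]
  refine squeeze_zero_norm (fun n => ?_) (by simpa using h₁.norm)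
  calc ‖incl B b * t n‖ = ‖incl B b * (t n * star (t n)) * t n‖ := by
        rw [mul_assoc, mul_assoc (t n), ht.star_mul_self, mul_one]
    _ ≤ ‖incl B b * (t n * star (t n))‖ :=
        (norm_mul_le _ _).trans (mul_le_of_le_one_right (norm_nonneg _) (ht.norm_le_one n))

theorem CStarAction.IsCuntzFamily.tendsto_incl_mul_isometryPath {t : ℕ → 𝓜(ℂ, B)}
    (ht : β.IsCuntzFamily t) (b : B) :
    Tendsto (fun τ : ℝ => incl B b * isometryPath t τ) atTop (𝓝 0) := by
  have h₁ : Tendsto (fun n => ‖incl B b * t n‖ + ‖incl B b * t (n + 1)‖) atTop (𝓝 0) := by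
    have h := (ht.tendsto_incl_mul b).norm
    simpa using h.add ((tendsto_add_atTop_iff_nat 1).mpr h)
  refine squeeze_zero_norm' ?_ (h₁.comp tendsto_nat_floor_atTop)
  filter_upwards [eventually_ge_atTop 0] with τ hτ
  exact norm_mul_isometryPath_le t _ hτ

theorem CStarAction.IsCuntzFamily.mult_isometryPath {t : ℕ → 𝓜(ℂ, B)} (ht : β.IsCuntzFamily t)
    (g : G) (τ : ℝ) : β.mult g (isometryPath t τ) = isometryPath t τ := by
  simp only [isometryPath, map_sum, map_smul, ht.fixed]

/-- For cocycles, unitarity lets the first defect control the adjoint one; for the homomorphisms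
`star a` plays this role. -/
theorem star_mul_sub_eq {M : Type*} [CStarAlgebra M] {X V σ σ' : M} (hX : star X * X = 1)
    (hV : V * star V = 1) :
    star σ * X - V * star σ' = -(V * star (X * σ' - σ * V) * X) := by
  have : V * star (X * σ' - σ * V) * X =
      V * star σ' * (star X * X) - V * star V * star σ * X := by
    simp only [star_sub, star_mul]; noncomm_ring
  rw [this, hX, hV]
  noncomm_ring

namespace CocycleRep

theorem intertwines_isometryPath {t : ℕ → 𝓜(ℂ, B)} {Φ Ψ : CocycleRep α β}
    (h : ∀ n, Intertwines (t n) Φ Ψ) (τ : ℝ) : Intertwines (isometryPath t τ) Φ Ψ where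
  hom a := by
    simp only [isometryPath, Finset.mul_sum, Finset.sum_mul, mul_smul_comm, smul_mul_assoc,
      (h _).hom]
  coc g := by
    simp only [isometryPath, Finset.mul_sum, Finset.sum_mul, mul_smul_comm, smul_mul_assoc,
      (h _).coc]

theorem coc_sum_apply {t₁ t₂ : 𝓜(ℂ, B)} (h : β.IsCuntzPair t₁ t₂) (Φ Ψ : CocycleRep α β) (g : G) :
    ((sum h Φ Ψ).coc g : 𝓜(ℂ, B)) = t₁ * Φ.coc g * star t₁ + t₂ * Ψ.coc g * star t₂ := rfl

theorem hom_sum_apply {t₁ t₂ : 𝓜(ℂ, B)} (h : β.IsCuntzPair t₁ t₂) (Φ Ψ : CocycleRep α β) (a : A) :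
    (sum h Φ Ψ).hom a = t₁ * Φ.hom a * star t₁ + t₂ * Ψ.hom a * star t₂ := rfl

/-- If an isometry intertwines the infinite repeat of the infinite repeat of `Φ` and `Θ` modulo `B`,
then `Θ` absorbs `Φ`. -/
theorem asympEquiv_of_intertwining_isometry {t : ℕ → 𝓜(ℂ, B)} (ht : β.IsCuntzFamily t)
    {Θ Φ Ψ Ψ' : CocycleRep α β} (hΨ : ∀ n, Intertwines (t n) Φ Ψ)
    (hΨ' : ∀ n, Intertwines (t n) Ψ Ψ') {s : 𝓜(ℂ, B)} (hs : star s * s = 1)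
    (hhom : ∀ a, MemIdeal (Θ.hom a * s - s * Ψ'.hom a))
    (hcoc : ∀ g, MemIdeal ((Θ.coc g : 𝓜(ℂ, B)) * β.mult g s - s * (Ψ'.coc g : 𝓜(ℂ, B))))
    (hcont : Continuous fun g => (Θ.coc g : 𝓜(ℂ, B)) * β.mult g s - s * Ψ'.coc g)
    {t₁ t₂ : 𝓜(ℂ, B)} (h : β.IsCuntzPair t₁ t₂) : AsympEquiv (sum h Θ Φ) Θ := by
  obtain ⟨S, hS, hTS, hSS, hShift, hSfix⟩ := ht.exists_shift
  have hVS_hom : ∀ a, Ψ.hom a * S = S * Ψ.hom a := fun a => ht.ext_right fun n => by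
    rw [mul_assoc, hShift, (hΨ _).hom, mul_assoc, (hΨ n).hom, ← mul_assoc, hShift]
  have hVS_coc : ∀ g, (Ψ.coc g : 𝓜(ℂ, B)) * S = S * Ψ.coc g := fun g => ht.ext_right fun n => by
    rw [mul_assoc, hShift, (hΨ _).coc, mul_assoc, (hΨ n).coc, ← mul_assoc, hShift]
  let T : Set.Ici (1 : ℝ) → 𝓜(ℂ, B) := fun τ => isometryPath t τ
  have hτ : ∀ τ : Set.Ici (1 : ℝ), (0 : ℝ) ≤ τ := fun τ => zero_le_one.trans τ.2
  have hT : ∀ τ, star (T τ) * T τ = 1 := fun τ =>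
    isometryPath_isometry ht.star_mul_self ht.orthogonal (hτ τ)
  have hTn : ∀ τ, ‖T τ‖ ≤ 1 := fun τ => norm_le_one_of_isometry (hT τ)
  have hT_int : ∀ τ, Intertwines (T τ) Ψ Ψ' := fun τ => intertwines_isometryPath hΨ' _
  have hT_fix : ∀ τ g, β.mult g (T τ) = T τ := fun τ g => ht.mult_isometryPath g _
  have hT_cont : Continuous T := (continuous_isometryPath t).comp continuous_subtype_val
  have hval : Tendsto (Subtype.val : Set.Ici (1 : ℝ) → ℝ) atTop atTop :=
    tendsto_comp_val_Ici_atTop.mpr tendsto_id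
  have hT_lim : ∀ b, Tendsto (fun τ => incl B b * T τ) atTop (𝓝 0) := fun b =>
    (ht.tendsto_incl_mul_isometryPath b).comp hval
  have hsT : ∀ τ, star (s * T τ) * (s * T τ) = 1 := fun τ => by
    rw [star_mul, mul_assoc, ← mul_assoc (star s), hs, one_mul, hT]
  let w : Set.Ici (1 : ℝ) → 𝓜(ℂ, B) := fun τ => absorbingUnitary (s * T τ) S (t 0) t₁ t₂
  have hw : ∀ τ, w τ ∈ unitary 𝓜(ℂ, B) := fun τ =>
    absorbingUnitary_mem (hsT τ) hS (ht.star_mul_self 0) hTS hSS h.left.isometry h.right.isometry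
      h.orthogonal h.sum_eq_one
  -- The defect of `s T_τ` is a fixed element of `B` times `T_τ`, so it tends to `0`.
  have hdef_hom : ∀ a τ, Θ.hom a * (s * T τ) - s * T τ * Ψ.hom a =
      (Θ.hom a * s - s * Ψ'.hom a) * T τ := fun a τ => by
    rw [mul_assoc s, ← (hT_int τ).hom]; noncomm_ring
  have hdef_hom' : ∀ a τ, star (s * T τ) * Θ.hom a - Ψ.hom a * star (s * T τ) =
      star ((Θ.hom (star a) * s - s * Ψ'.hom (star a)) * T τ) := fun a τ => by
    rw [← hdef_hom, map_star, map_star]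
    simp [mul_assoc]
  have hdef_coc : ∀ g τ, (Θ.coc g : 𝓜(ℂ, B)) * β.mult g (s * T τ) - s * T τ * Ψ.coc g =
      ((Θ.coc g : 𝓜(ℂ, B)) * β.mult g s - s * Ψ'.coc g) * T τ := fun g τ => by
    rw [map_mul, hT_fix, mul_assoc s, ← (hT_int τ).coc]; noncomm_ring
  have hdef_coc' : ∀ g τ, star (s * T τ) * (Θ.coc g : 𝓜(ℂ, B)) -
      Ψ.coc g * star (β.mult g (s * T τ)) =
      -((Ψ.coc g : 𝓜(ℂ, B)) *
        star (((Θ.coc g : 𝓜(ℂ, B)) * β.mult g s - s * Ψ'.coc g) * T τ) * Θ.coc g) := fun g τ => by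
    rw [← hdef_coc]
    exact star_mul_sub_eq (Unitary.star_mul_self_of_mem (SetLike.coe_mem _))
      (Unitary.mul_star_self_of_mem (SetLike.coe_mem _))
  have hmem : ∀ c c' x y z v r q p : 𝓜(ℂ, B), MemIdeal c → MemIdeal c' →
      MemIdeal (((c * x * y - z * c') * v + c * r * q) * p) := fun c c' x y z v r q p hc hc' =>
    (((((hc.mul_right x).mul_right y).sub (hc'.mul_left z)).mul_right v).add
      ((hc.mul_right r).mul_right q)).mul_right p
  have eq_hom := fun a τ => sub_absorbingUnitary_conj (StarAlgEquiv.refl ℂ 𝓜(ℂ, B)) rfl rfl rfl rfl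
    h.left.isometry h.right.isometry h.orthogonal (X := Θ.hom a) (hVS_hom a) ((hΨ 0).hom a) (hw τ)
  have eq_coc := fun g τ => sub_absorbingUnitary_conj (β.mult g) (hSfix g) (ht.fixed 0 g)
    (h.left.fixed g) (h.right.fixed g) h.left.isometry h.right.isometry h.orthogonal
    (X := (Θ.coc g : 𝓜(ℂ, B))) (hVS_coc g) ((hΨ 0).coc g) (hw τ)
  have hnS := norm_le_one_of_isometry hS
  have hn₀ := ht.norm_le_one 0
  have hn₁ := norm_le_one_of_isometry h.left.isometry
  have hn₂ := norm_le_one_of_isometry h.right.isometry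
  have hnsT := fun τ => norm_le_one_of_isometry (hsT τ)
  have hnw : ∀ τ, ‖w τ‖ ≤ 1 := fun τ => norm_unitary_le_one ⟨w τ, hw τ⟩
  simp only [StarAlgEquiv.coe_refl, id_eq] at eq_hom
  have bound_hom : ∀ a τ, ‖Θ.hom a - w τ * (sum h Θ Φ).hom a * star (w τ)‖ ≤
      3 * ‖(Θ.hom a * s - s * Ψ'.hom a) * T τ‖ +
        2 * ‖(Θ.hom (star a) * s - s * Ψ'.hom (star a)) * T τ‖ := fun a τ => by
    rw [hom_sum_apply]
    refine (congrArg norm (eq_hom a τ)).trans_le ?_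
    rw [hdef_hom, hdef_hom']
    refine (norm_defect_le (hnsT τ) (hnsT τ) hnS hn₀ hn₁ hn₂ (hnw τ)).trans_eq ?_
    rw [norm_star]
  have bound_coc : ∀ g τ, ‖(Θ.coc g : 𝓜(ℂ, B)) - w τ * (sum h Θ Φ).coc g * star (β.mult g (w τ))‖ ≤
      5 * ‖((Θ.coc g : 𝓜(ℂ, B)) * β.mult g s - s * Ψ'.coc g) * T τ‖ := fun g τ => by
    rw [coc_sum_apply]
    refine (congrArg norm (eq_coc g τ)).trans_le ?_
    rw [hdef_coc, hdef_coc']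
    refine (norm_defect_le (hnsT τ) ?_ hnS hn₀ hn₁ hn₂ ?_).trans ?_
    · rw [β.norm_mult]; exact hnsT τ
    · rw [β.norm_mult]; exact hnw τ
    · rw [norm_neg]
      have h₁ := (norm_mul_le ((Ψ.coc g : 𝓜(ℂ, B)) *
        star (((Θ.coc g : 𝓜(ℂ, B)) * β.mult g s - s * Ψ'.coc g) * T τ)) (Θ.coc g)).trans
          (mul_le_of_le_one_right (norm_nonneg _) (Θ.norm_coc_le g))
      have h₂ := (norm_mul_le (Ψ.coc g : 𝓜(ℂ, B))
        (star (((Θ.coc g : 𝓜(ℂ, B)) * β.mult g s - s * Ψ'.coc g) * T τ))).trans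
          (mul_le_of_le_one_left (norm_nonneg _) (Ψ.norm_coc_le g))
      rw [norm_star] at h₂
      linarith
  refine ⟨fun τ => ⟨w τ, hw τ⟩, ?_, fun a => ?_, fun a τ => ?_, fun K hK => ?_, fun τ g => ?_⟩
  · refine Continuous.subtype_mk ?_ _
    have hc : Continuous fun τ => s * T τ := hT_cont.const_mul s
    simp only [w, absorbingUnitary]
    fun_prop
  · rw [tendsto_iff_norm_sub_tendsto_zero]
    obtain ⟨b, hb⟩ := hhom a
    obtain ⟨b', hb'⟩ := hhom (star a)
    have h₁ := ((hT_lim b).norm.const_mul 3).add ((hT_lim b').norm.const_mul 2)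
    simp only [norm_zero, mul_zero, add_zero] at h₁
    refine squeeze_zero (fun _ => norm_nonneg _) (fun τ => ?_) h₁
    rw [norm_sub_rev]
    refine (bound_hom a τ).trans_eq ?_
    rw [← hb, ← hb']; rfl
  · change MemIdeal (Θ.hom a - w τ * (sum h Θ Φ).hom a * star (w τ))
    rw [hom_sum_apply]
    refine (congrArg MemIdeal (eq_hom a τ)).mpr (hmem _ _ _ _ _ _ _ _ _ ?_ ?_)
    · rw [hdef_hom]; exact (hhom a).mul_right _
    · rw [hdef_hom']; exact ((hhom (star a)).mul_right _).star
  -- The cocycle defect is a continuous map into `B`. Its image of `K` is compact, so multiplication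
  -- by `T_τ` sends it to `0` uniformly.
  · choose c hc using hcoc
    have hc_cont : Continuous c := by
      rw [(isometry_incl (B := B)).isEmbedding.continuous_iff]
      exact hcont.congr fun g => (hc g).symm
    rw [Metric.tendstoUniformlyOn_iff]
    intro ε hε
    have h₁ := eventually_forall_mem_norm_lt_of_compact (fun τ b => incl B b * T τ) 1 zero_le_one
      (fun τ x y => by rw [map_sub, sub_mul])
      (Eventually.of_forall fun τ x => by
        rw [one_mul]
        refine (norm_mul_le _ _).trans ?_
        rw [norm_incl]
        exact mul_le_of_le_one_right (norm_nonneg _) (hTn τ))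
      (hK.image hc_cont) hT_lim (ε := ε / 5) (by positivity)
    filter_upwards [h₁] with τ hτ g hg
    rw [dist_eq_norm]
    refine (bound_coc g τ).trans_lt ?_
    have h₂ := hτ _ (Set.mem_image_of_mem c hg)
    have h₃ : incl B (c g) = (Θ.coc g : 𝓜(ℂ, B)) * β.mult g s - s * Ψ'.coc g := hc g
    rw [h₃] at h₂
    linarith
  · change MemIdeal ((Θ.coc g : 𝓜(ℂ, B)) -
      w τ * ((sum h Θ Φ).coc g : 𝓜(ℂ, B)) * star (β.mult g (w τ)))
    rw [coc_sum_apply]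
    refine (congrArg MemIdeal (eq_coc g τ)).mpr (hmem _ _ _ _ _ _ _ _ _ ?_ ?_)
    · rw [hdef_coc]; exact (hcoc g).mul_right _
    · rw [hdef_coc']; exact ((((hcoc g).mul_right _).star.mul_left _).mul_right _).neg

end CocycleRep

end Absorption

/-! ### Approximating sequences and the existence of absorbing elements -/

section ApproximatingSequences

variable {G A B : Type*} [Group G] [TopologicalSpace G]
  [NonUnitalCStarAlgebra A] [NonUnitalCStarAlgebra B]
  {α : CStarAction G A} {β : CStarAction G B}

theorem CStarAction.mult_one_apply (β : CStarAction G B) (x : 𝓜(ℂ, B)) : β.mult 1 x = x :=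
  multiplier_ext_fst fun b => by
    change β.toHom 1 (x.fst ((β.toHom 1).symm b)) = x.fst b
    rw [β.toHom_symm_apply, inv_one, β.toHom_one_apply, β.toHom_one_apply]

namespace CocycleRep

theorem coc_one (Φ : CocycleRep α β) : (Φ.coc 1 : 𝓜(ℂ, B)) = 1 := by
  have h := Φ.coc_mul 1 1
  rw [mul_one, β.mult_one_apply] at h
  have h' := congrArg (star (Φ.coc 1 : 𝓜(ℂ, B)) * ·) h
  simpa only [← mul_assoc, Unitary.star_mul_self_of_mem (SetLike.coe_mem _), one_mul] using h'.symm

theorem coc_eq_star_mult_inv (Φ : CocycleRep α β) (g : G) :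
    (Φ.coc g : 𝓜(ℂ, B)) = β.mult g (star (Φ.coc g⁻¹ : 𝓜(ℂ, B))) := by
  have h := Φ.coc_mul g g⁻¹
  rw [mul_inv_cancel, Φ.coc_one] at h
  have h' := congrArg (· * β.mult g (star (Φ.coc g⁻¹ : 𝓜(ℂ, B)))) h
  simpa only [one_mul, mul_assoc, ← map_mul, Unitary.mul_star_self_of_mem (SetLike.coe_mem _),
    map_one, mul_one] using h'.symm

/-- Since `u_g = β_g(u_{g⁻¹})*`, the moving vector `β_g(f)` is traded for the fixed vector `f*` at
`g⁻¹`. This is a strict seminorm, controlled by the topology uniformly over `K⁻¹`. -/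
theorem norm_coc_sub_mul_incl (Φ Ψ : CocycleRep α β) (g : G) (f : B) :
    ‖(Φ.coc g - Ψ.coc g : 𝓜(ℂ, B)) * incl B (β.toHom g f)‖ =
      ‖(Φ.coc g⁻¹ : 𝓜(ℂ, B)).snd (star f) - (Ψ.coc g⁻¹ : 𝓜(ℂ, B)).snd (star f)‖ := by
  rw [Φ.coc_eq_star_mult_inv, Ψ.coc_eq_star_mult_inv, ← map_sub, ← β.mult_incl, ← map_mul,
    β.norm_mult, ← star_sub, ← norm_star, star_mul, star_star, ← map_star, mul_sub, incl_mul,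
    incl_mul, ← map_sub, norm_incl]

theorem continuous_hom_coc : Continuous fun Φ : CocycleRep α β =>
    ((fun a => toStrict (Φ.hom a),
      UniformOnFun.ofFun {K : Set G | IsCompact K} fun g => toStrict (Φ.coc g : 𝓜(ℂ, B))) :
      (A → StrictMultiplier B) × UniformOnFun G (StrictMultiplier B) {K | IsCompact K}) :=
  continuous_induced_dom

theorem tendsto_hom_mul_incl (Ψ : CocycleRep α β) (a : A) (f : B) :
    Tendsto (fun Φ : CocycleRep α β => Φ.hom a * incl B f) (𝓝 Ψ) (𝓝 (Ψ.hom a * incl B f)) := by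
  have h : Continuous fun Φ : CocycleRep α β => toStrict (Φ.hom a) :=
    (continuous_apply a).comp (continuous_fst.comp continuous_hom_coc)
  exact (tendsto_toStrict_iff.mp (h.tendsto Ψ)).1 f

theorem tendstoUniformlyOn_coc_snd (Ψ : CocycleRep α β) {K : Set G} (hK : IsCompact K) (f : B) :
    TendstoUniformlyOn (fun (Φ : CocycleRep α β) g => (Φ.coc g : 𝓜(ℂ, B)).snd f)
      (fun g => (Ψ.coc g : 𝓜(ℂ, B)).snd f) (𝓝 Ψ) K := by
  have h : Continuous fun Φ : CocycleRep α β =>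
      UniformOnFun.ofFun {K : Set G | IsCompact K} fun g => toStrict (Φ.coc g : 𝓜(ℂ, B)) :=
    continuous_snd.comp continuous_hom_coc
  have h₁ := UniformOnFun.tendsto_iff_tendstoUniformlyOn.mp (h.tendsto Ψ) K hK
  have h₂ : UniformContinuous fun x : StrictMultiplier B => (ofStrict x).snd f := by
    have h₃ : UniformContinuous fun x : StrictMultiplier B =>
        ((fun b => (ofStrict x).fst b, fun b => (ofStrict x).snd b) : (B → B) × (B → B)) :=
      uniformContinuous_comap
    exact (Pi.uniformContinuous_proj (fun _ : B => B) f).comp (uniformContinuous_snd.comp h₃)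
  exact h₂.comp_tendstoUniformlyOn h₁

theorem exists_approximates_of_separable [IsTopologicalGroup G] {C : Set (CocycleRep α β)}
    (hne : C.Nonempty) [TopologicalSpace.SeparableSpace C] (a : ℕ → A) {K : ℕ → Set G}
    (hK : ∀ n, IsCompact (K n)) :
    ∃ Φ : ℕ → CocycleRep α β, (∀ n, Φ n ∈ C) ∧ ∀ Ψ ∈ C, Approximates a K Φ Ψ := by
  have : Nonempty C := hne.to_subtype
  refine ⟨fun n => TopologicalSpace.denseSeq C n, fun n => Subtype.coe_prop _,
    fun Ψ hΨ f n ε hε => ?_⟩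
  have h₁ : ∀ᶠ Φ in 𝓝 Ψ, ∀ i ≤ n, ‖(Φ.hom (a i) - Ψ.hom (a i)) * incl B f‖ ≤ ε := by
    have hfin : {i : ℕ | i ≤ n}.Finite := Set.finite_Iic n
    refine (Filter.eventually_all_finite hfin).mpr fun i _ => ?_
    have := tendsto_iff_norm_sub_tendsto_zero.mp (Ψ.tendsto_hom_mul_incl (a i) f)
    simp_rw [← sub_mul] at this
    exact this.eventually_le_const hε
  have h₂ : ∀ᶠ Φ in 𝓝 Ψ, ∀ g ∈ K n,
      ‖(Φ.coc g - Ψ.coc g : 𝓜(ℂ, B)) * incl B (β.toHom g f)‖ ≤ ε := by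
    filter_upwards [Metric.tendstoUniformlyOn_iff.mp
      (Ψ.tendstoUniformlyOn_coc_snd (hK n).inv (star f)) ε hε] with Φ hΦ g hg
    rw [norm_coc_sub_mul_incl, ← dist_eq_norm, dist_comm]
    exact (hΦ g⁻¹ (by simpa using hg)).le
  have hmem : {Φ : C | (∀ i ≤ n, ‖(Φ.1.hom (a i) - Ψ.hom (a i)) * incl B f‖ ≤ ε) ∧
      ∀ g ∈ K n, ‖(Φ.1.coc g - Ψ.coc g : 𝓜(ℂ, B)) * incl B (β.toHom g f)‖ ≤ ε} ∈
      𝓝 (⟨Ψ, hΨ⟩ : C) :=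
    (continuous_subtype_val.tendsto (⟨Ψ, hΨ⟩ : C)).eventually (h₁.and h₂)
  obtain ⟨_, hx, k, rfl⟩ := mem_closure_iff_nhds.mp
    (TopologicalSpace.denseRange_denseSeq C ⟨Ψ, hΨ⟩) _ hmem
  exact ⟨k, hx⟩

/-- The cocycle of `Φ` applied to `β_g(b)`, as a continuous function of `g`. -/
def cocMap (Φ : CocycleRep α β) (b : B) : C(G, B) where
  toFun g := (Φ.coc g : 𝓜(ℂ, B)).fst (β.toHom g b)
  continuous_toFun := Φ.continuous_coc_fst (β.continuous_apply b)

/-- The data `φ(aᵢ) bₗ` and `g ↦ u_g β_g(bₗ)`, with `(bₗ)` dense in `B`, take values in a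
second-countable space, since `C(G, B)` is one. Hence the image of `C` is separable, and these data
suffice for `Approximates`. -/
theorem exists_approximates_of_separable_target [SecondCountableTopology G] [LocallyCompactSpace G]
    [TopologicalSpace.SeparableSpace B] {C : Set (CocycleRep α β)} (hne : C.Nonempty)
    (a : ℕ → A) {K : ℕ → Set G} (hK : ∀ n, IsCompact (K n)) :
    ∃ Φ : ℕ → CocycleRep α β, (∀ n, Φ n ∈ C) ∧ ∀ Ψ ∈ C, Approximates a K Φ Ψ := by
  have : SecondCountableTopology B := UniformSpace.secondCountable_of_separable B
  let b : ℕ → B := TopologicalSpace.denseSeq B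
  let J : CocycleRep α β → (ℕ → ℕ → B) × (ℕ → C(G, B)) := fun Φ =>
    (fun i l => (Φ.hom (a i)).fst (b l), fun l => Φ.cocMap (b l))
  have : Nonempty (J '' C) := (hne.image J).to_subtype
  choose Φ hΦ hJ using fun n => Subtype.coe_prop (TopologicalSpace.denseSeq (J '' C) n)
  refine ⟨Φ, hΦ, fun Ψ hΨ f n ε hε => ?_⟩
  set c : ℝ := 1 + ∑ i ∈ Finset.range (n + 1), ‖a i‖ with hc
  have hc₁ : 1 ≤ c := le_add_of_nonneg_right (Finset.sum_nonneg fun _ _ => norm_nonneg _)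
  have hca : ∀ i ≤ n, ‖a i‖ ≤ c := fun i hi => by
    have := Finset.single_le_sum (f := fun i => ‖a i‖) (fun _ _ => norm_nonneg _)
      (Finset.mem_range.mpr (Nat.lt_succ_of_le hi))
    linarith
  -- The differences tested have norm at most `2c`, so replacing `f` by `bₗ` costs at most `ε/2`.
  obtain ⟨l, hl⟩ := (TopologicalSpace.denseRange_denseSeq B).exists_dist_lt f
    (show 0 < ε / (4 * c) by positivity)
  rw [dist_eq_norm] at hl
  have hl' : 2 * c * ‖f - b l‖ ≤ ε / 2 := by
    calc 2 * c * ‖f - b l‖ ≤ 2 * c * (ε / (4 * c)) := by gcongr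
      _ = ε / 2 := by field_simp; norm_num
  have h₁ : ∀ᶠ p in 𝓝 (J Ψ), ∀ i ≤ n, ‖p.1 i l - (Ψ.hom (a i)).fst (b l)‖ ≤ ε / 2 := by
    refine (Filter.eventually_all_finite (Set.finite_Iic n)).mpr fun i _ => ?_
    have hcont : Continuous fun p : (ℕ → ℕ → B) × (ℕ → C(G, B)) => p.1 i l := by fun_prop
    have := tendsto_iff_norm_sub_tendsto_zero.mp (hcont.tendsto (J Ψ))
    exact this.eventually_le_const (by positivity)
  have h₂ : ∀ᶠ p in 𝓝 (J Ψ), ∀ g ∈ K n, ‖p.2 l g - Ψ.cocMap (b l) g‖ ≤ ε / 2 := by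
    have hcont : Continuous fun p : (ℕ → ℕ → B) × (ℕ → C(G, B)) => p.2 l := by fun_prop
    have := ContinuousMap.tendsto_iff_forall_isCompact_tendstoUniformlyOn.mp
      (hcont.tendsto (J Ψ)) (K n) (hK n)
    filter_upwards [Metric.tendstoUniformlyOn_iff.mp this (ε / 2) (by positivity)] with p hp g hg
    rw [← dist_eq_norm, dist_comm]
    exact (hp g hg).le
  have hΨJ : J Ψ ∈ J '' C := Set.mem_image_of_mem J hΨ
  have hmem : {p : J '' C | (∀ i ≤ n, ‖p.1.1 i l - (Ψ.hom (a i)).fst (b l)‖ ≤ ε / 2) ∧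
      ∀ g ∈ K n, ‖p.1.2 l g - Ψ.cocMap (b l) g‖ ≤ ε / 2} ∈ 𝓝 (⟨J Ψ, hΨJ⟩ : J '' C) :=
    (continuous_subtype_val.tendsto (⟨J Ψ, hΨJ⟩ : J '' C)).eventually (h₁.and h₂)
  obtain ⟨_, hx, k, rfl⟩ := mem_closure_iff_nhds.mp
    (TopologicalSpace.denseRange_denseSeq (J '' C) ⟨J Ψ, hΨJ⟩) _ hmem
  obtain ⟨hx₁, hx₂⟩ := hx
  rw [← hJ k] at hx₁ hx₂
  have hest : ∀ (x : 𝓜(ℂ, B)) (y z : B), ‖x‖ ≤ 2 * c → ‖y - z‖ = ‖f - b l‖ →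
      ‖x * incl B z‖ ≤ ε / 2 → ‖x * incl B y‖ ≤ ε := fun x y z hx hyz hz => by
    have h₃ : ‖x * incl B (y - z)‖ ≤ ε / 2 := by
      refine (norm_mul_le _ _).trans (le_trans ?_ hl')
      rw [norm_incl, hyz]
      gcongr
    calc ‖x * incl B y‖ = ‖x * incl B (y - z) + x * incl B z‖ := by
          rw [map_sub, mul_sub, sub_add_cancel]
      _ ≤ _ := norm_add_le _ _
      _ ≤ ε := by linarith
  refine ⟨k, fun i hi => ?_, fun g hg => ?_⟩
  · refine hest _ f (b l) ?_ rfl ?_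
    · refine (norm_sub_le _ _).trans ?_
      linarith [(Φ k).norm_hom_le (a i), Ψ.norm_hom_le (a i), hca i hi]
    · rw [norm_mul_incl]
      exact hx₁ i hi
  · refine hest _ _ (β.toHom g (b l)) ?_ ?_ ?_
    · refine (norm_sub_le _ _).trans ?_
      linarith [(Φ k).norm_coc_le g, Ψ.norm_coc_le g]
    · rw [← map_sub, StarAlgEquiv.norm_map (β.toHom g)]
    · rw [norm_mul_incl]
      exact hx₂ g hg

/-- A σ-additive set with an approximating sequence has an absorbing element. -/
theorem exists_isAbsorbing [IsTopologicalGroup G] (hB : IsSigmaUnital B)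
    (hβ : β.IsStronglyStable) {C : Set (CocycleRep α β)} (hC : IsSigmaAdditive C)
    {a : ℕ → A} (ha : DenseRange a)
    (K : CompactExhaustion G) {Φ : ℕ → CocycleRep α β} (hΦ : ∀ n, Φ n ∈ C)
    (happ : ∀ Ψ ∈ C, Approximates a K Φ Ψ) : ∃ Θ, IsAbsorbing C Θ := by
  obtain ⟨t, ht⟩ := hβ.exists_isCuntzFamily
  have hsum : ∀ Φ : ℕ → CocycleRep α β, (∀ n, Φ n ∈ C) →
      ∃ Ψ ∈ C, ∀ n, Intertwines (t n) (Φ n) Ψ := fun Φ hΦ => by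
    obtain ⟨Ψ, h₁, h₂⟩ := exists_isCountableSum ht Φ
    exact ⟨Ψ, hC.sum_mem Φ hΦ t ht.toIsCuntzSequence Ψ h₁, h₂⟩
  obtain ⟨Ω, hΩC, hΩ⟩ := hsum Φ hΦ
  obtain ⟨Θ, hΘC, hΘ⟩ := hsum (fun _ => Ω) fun _ => hΩC
  refine ⟨Θ, hΘC, fun Φ₀ hΦ₀ t₁ t₂ h => ?_⟩
  -- The inner repeat of `Φ₀` makes room for the shift, the outer one for the path of isometries.
  obtain ⟨Ψ, hΨC, hΨ⟩ := hsum (fun _ => Φ₀) fun _ => hΦ₀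
  obtain ⟨Ψ', hΨ'C, hΨ'⟩ := hsum (fun _ => Ψ) fun _ => hΨC
  obtain ⟨s, hs, hhom, hcoc, hcont⟩ :=
    exists_intertwining_isometry hB ht hΩ hΘ ha K (happ Ψ' hΨ'C)
  exact asympEquiv_of_intertwining_isometry ht hΨ hΨ' hs hhom hcoc hcont h

end CocycleRep

end ApproximatingSequences

end

/-! ### The theorem; its two cases differ only in the source of the approximating sequence. -/

theorem theorem3p12 {G A B : Type*}
    [Group G] [TopologicalSpace G] [IsTopologicalGroup G]
    [SecondCountableTopology G] [LocallyCompactSpace G]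
    [NonUnitalCStarAlgebra A] [TopologicalSpace.SeparableSpace A]
    [NonUnitalCStarAlgebra B] (hB : IsSigmaUnital B)
    (α : CStarAction G A) (β : CStarAction G B) (hβ : β.IsStronglyStable)
    (C : Set (CocycleRep α β)) (hne : C.Nonempty) (hC : CocycleRep.IsSigmaAdditive C) :
    (TopologicalSpace.SeparableSpace C → ∃ Θ, CocycleRep.IsAbsorbing C Θ) ∧
      (TopologicalSpace.SeparableSpace B → ∃ Θ, CocycleRep.IsAbsorbing C Θ) := by
  have ha := TopologicalSpace.denseRange_denseSeq A
  let K : CompactExhaustion G := CompactExhaustion.choice G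
  refine ⟨fun _ => ?_, fun _ => ?_⟩
  · obtain ⟨Φ, hΦ, happ⟩ := CocycleRep.exists_approximates_of_separable hne
      (TopologicalSpace.denseSeq A) K.isCompact
    exact CocycleRep.exists_isAbsorbing hB hβ hC ha K hΦ happ
  · obtain ⟨Φ, hΦ, happ⟩ := CocycleRep.exists_approximates_of_separable_target hne
      (TopologicalSpace.denseSeq A) K.isCompact
    exact CocycleRep.exists_isAbsorbing hB hβ hC ha K hΦ happ
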